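/- **Theorem.** Let $0<\alpha\le 1$, $1<\beta\le 2$, $a<b$, $T>0$. Let $\gamma$ (real), $d_+\ge 0$, $d_-\ge 0$ be bounded functions on $(0,T]$, and consider $$\partial^{\alpha}_{0,t}u=\gamma(t)\,\partial_x u+d_+(t)\,{}_aD^\beta_xu+d_-(t)\,{}_xD^\beta_bu+f(x,t),\qquad a<x<b,\ 0<t\le T,$$ with $u(x,0)=\phi(x)$ for $a\le x\le b$ and $u(a,t)=u(b,t)=0$ for $0<t\le T$. Here $\partial^{\alpha}_{0,t}u(x,t)=\frac1{\Gamma(1-\alpha)}\int_0^t\partial_\xi u(x,\xi)(t-\xi)^{-\alpha}d\xi$ is the Caputo derivative ($\partial_t u$ if $\alpha=1$), and ${}_aD^\beta_xu=\frac{1}{\Gamma(2-\beta)}\partial_x^2\int_a^x\frac{u(\eta,t)\,d\eta}{(x-\eta)^{\beta-1}}$, ${}_xD^\beta_bu=\frac{1}{\Gamma(2-\beta)}\partial_x^2\int_x^b\frac{u(\eta,t)\,d\eta}{(\eta-x)^{\beta-1}}$ are the Riemann–Liouville derivatives (both $\partial_x^2u$ if $\beta=2$). For integers $N,M\ge1$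 put $h=(b-a)/N$, $\tau=T/M$, $x_i=a+ih$, $t_j=j\tau$, $\sigma=1-\alpha/2$, $t_{j+\sigma}=(j+\sigma)\tau$. The scheme is $$\Delta^\alpha_{0,t_{j+\sigma}}u_i=\gamma(t_{j+\sigma})\frac{u^{(\sigma)}_{i+1}-u^{(\sigma)}_{i-1}}{2h}+\frac{d_+(t_{j+\sigma})}{h^\beta}\sum_{k=0}^{i+1}\omega_ku^{(\sigma)}_{i-k+1}+\frac{d_-(t_{j+\sigma})}{h^\beta}\sum_{k=0}^{N-i+1}\omega_ku^{(\sigma)}_{i+k-1}+f(x_i,t_{j+\sigma})$$ for $1\le i\le N-1$, $0\le j\le M-1$, with $u^0_i=\phi(x_i)$ for $1\le i\le N-1$ and $u^j_0=u^j_N=0$ for $0\le j\le M$, where $u^{(\sigma)}_i=\sigma u_i^{j+1}+(1-\sigma)u_i^j$ and the following notation is used. * $\Delta^\alpha_{0,t_{j+\sigma}}u_i=\frac{\tau^{-\alpha}}{\Gamma(2-\alpha)}\sum_{s=0}^jc^{(j)}_{j-s}(u_i^{s+1}-u_i^s)$, with $c^{(0)}_0=a_0$ and, for $j\ge1$, $c^{(j)}_0=a_0+b_1$,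 $c^{(j)}_m=a_m+b_{m+1}-b_m$ ($1\le m\le j-1$), $c^{(j)}_j=a_j-b_j$; here $a_0=\sigma^{1-\alpha}$ and, for $\ell\ge1$, $a_\ell=(\ell+\sigma)^{1-\alpha}-(\ell-1+\sigma)^{1-\alpha}$, $b_\ell=\frac{1}{2-\alpha}[(\ell+\sigma)^{2-\alpha}-(\ell-1+\sigma)^{2-\alpha}]-\frac12[(\ell+\sigma)^{1-\alpha}+(\ell-1+\sigma)^{1-\alpha}]$. * $\omega_0=\lambda_1g_0$, $\omega_1=\lambda_1g_1+\lambda_0g_0$, $\omega_k=\lambda_1g_k+\lambda_0g_{k-1}+\lambda_{-1}g_{k-2}$ ($k\ge2$), with $g_k=(-1)^k\binom{\beta}{k}$, $\lambda_1=\frac{\beta^2+3\beta+2}{12}$, $\lambda_0=\frac{4-\beta^2}{6}$, $\lambda_{-1}=\frac{\beta^2-3\beta+2}{12}$. Let $u$ be a solution of the problem of class $C^{4,3}_{x,t}([a,b]\times[0,T])$, i.e. all mixed derivatives $\partial_x^m\partial_t^nu$ with $m\le4$, $n\le3$ exist and are continuous on the closed rectangle. If $\beta<2$, suppose in addition that for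 each $t\in[0,T]$ the extension $v$ of $u(\cdot,t)$ by zero to $\mathbb R$ satisfies $v\in L^1(\mathbb R)$ and $\int_{\mathbb R}(1+|k|)^{2+\beta}|\hat v(k)|\,dk<\infty$, where $\hat v(k)=\int_{\mathbb R}e^{\mathrm ikx}v(x)\,dx$. Then there is a constant $\tilde c>0$, independent of $N$ and $M$, such that for all $N,M\ge1$ and every solution $(u_i^j)$ of the scheme, the error $E_i^j=u(x_i,t_j)-u_i^j$ satisfies $$\|E^j\|:=\Big(h\sum_{i=1}^{N-1}(E_i^j)^2\Big)^{1/2}\le\tilde c\,(\tau^2+h^2),\qquad 0\le j\le M.$$ -/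

import Mathlib

open Set MeasureTheory

noncomputable section

namespace TSFCDE

/-! ### The continuous problem -/

/-- The Caputo derivative of order `α ∈ (0, 1]` with base point `0`, at time `t`, of a function
on `[0, T]`; for `α = 1` it is the usual first derivative. -/
def caputoDeriv (α T : ℝ) (v : ℝ → ℝ) (t : ℝ) : ℝ :=
  if α = 1 then derivWithin v (Icc 0 T) t
  else 1 / Real.Gamma (1 - α) * ∫ ξ in (0 : ℝ)..t, derivWithin v (Icc 0 T) ξ / (t - ξ) ^ α

/-- The left Riemann-Liouville derivative of order `β ∈ (1, 2]` with base point `a`; for `β = 2`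
it is the usual second derivative. -/
def leftRL (β a : ℝ) (v : ℝ → ℝ) (x : ℝ) : ℝ :=
  if β = 2 then iteratedDeriv 2 v x
  else 1 / Real.Gamma (2 - β) *
    iteratedDeriv 2 (fun y => ∫ η in a..y, v η / (y - η) ^ (β - 1)) x

/-- The right Riemann-Liouville derivative of order `β ∈ (1, 2]` with base point `b`; for `β = 2`
it is the usual second derivative. -/
def rightRL (β b : ℝ) (v : ℝ → ℝ) (x : ℝ) : ℝ :=
  if β = 2 then iteratedDeriv 2 v x
  else 1 / Real.Gamma (2 - β) *
    iteratedDeriv 2 (fun y => ∫ η in y..b, v η / (η - y) ^ (β - 1)) x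

/-- `u` (written `u x t`) solves the initial-boundary value problem for the time-space fractional
convection-diffusion equation on `(a, b) × (0, T]`. -/
structure IsSolution (α β a b T : ℝ) (γ dp dm : ℝ → ℝ) (f : ℝ → ℝ → ℝ) (φ : ℝ → ℝ)
    (u : ℝ → ℝ → ℝ) : Prop where
  equation : ∀ x ∈ Ioo a b, ∀ t ∈ Ioc 0 T,
    caputoDeriv α T (fun s => u x s) t =
      γ t * deriv (fun y => u y t) x + dp t * leftRL β a (fun y => u y t) x
        + dm t * rightRL β b (fun y => u y t) x + f x t
  initial : ∀ x ∈ Icc a b, u x 0 = φ x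
  boundary : ∀ t ∈ Ioc 0 T, u a t = 0 ∧ u b t = 0

/-- `u ∈ C^{4,3}_{x,t}` on the closed rectangle `[a, b] × [0, T]`: all mixed derivatives
`D m n = ∂_x^m ∂_t^n u` with `m ≤ 4`, `n ≤ 3` exist (one-sidedly at the edges) and are continuous
on the closed rectangle. -/
def IsC43 (a b T : ℝ) (u : ℝ → ℝ → ℝ) : Prop :=
  ∃ D : ℕ → ℕ → ℝ → ℝ → ℝ,
    (∀ x ∈ Icc a b, ∀ t ∈ Icc 0 T, D 0 0 x t = u x t) ∧
    (∀ m ≤ 4, ∀ n ≤ 3,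
      ContinuousOn (fun p : ℝ × ℝ => D m n p.1 p.2) (Icc a b ×ˢ Icc 0 T)) ∧
    (∀ m < 4, ∀ n ≤ 3, ∀ x ∈ Icc a b, ∀ t ∈ Icc 0 T,
      HasDerivWithinAt (fun y => D m n y t) (D (m + 1) n x t) (Icc a b) x) ∧
    (∀ m ≤ 4, ∀ n < 3, ∀ x ∈ Icc a b, ∀ t ∈ Icc 0 T,
      HasDerivWithinAt (fun s => D m n x s) (D m (n + 1) x t) (Icc 0 T) t)

/-- The class `𝔏^r(ℝ)`: `v ∈ L¹(ℝ)` and `∫ (1 + |k|)^r |v̂(k)| dk < ∞`,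
with `v̂(k) = ∫ e^{ikx} v(x) dx`. -/
def MemFourierClass (r : ℝ) (v : ℝ → ℝ) : Prop :=
  Integrable v ∧
    Integrable (fun k : ℝ =>
      (1 + |k|) ^ r * ‖∫ x : ℝ, Complex.exp (Complex.I * (k : ℂ) * (x : ℂ)) * (v x : ℂ)‖)

/-! ### The difference scheme -/

/-- `a_ℓ^{(α,σ)}`. -/
def coefA (α σ : ℝ) (l : ℕ) : ℝ :=
  if l = 0 then σ ^ (1 - α)
  else ((l : ℝ) + σ) ^ (1 - α) - ((l : ℝ) - 1 + σ) ^ (1 - α)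

/-- `b_ℓ^{(α,σ)}`, used for `ℓ ≥ 1`. -/
def coefB (α σ : ℝ) (l : ℕ) : ℝ :=
  1 / (2 - α) * (((l : ℝ) + σ) ^ (2 - α) - ((l : ℝ) - 1 + σ) ^ (2 - α))
    - 1 / 2 * (((l : ℝ) + σ) ^ (1 - α) + ((l : ℝ) - 1 + σ) ^ (1 - α))

/-- `c_m^{(α,σ,j)}`, used for `0 ≤ m ≤ j`. -/
def coefC (α σ : ℝ) (j m : ℕ) : ℝ :=
  if j = 0 then coefA α σ 0
  else if m = 0 then coefA α σ 0 + coefB α σ 1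
  else if m = j then coefA α σ j - coefB α σ j
  else coefA α σ m + coefB α σ (m + 1) - coefB α σ m

/-- The discrete Caputo derivative `Δ^α_{0,t_{j+σ}} v` of a grid function `v` in time. -/
def discreteCaputo (α σ τ : ℝ) (j : ℕ) (v : ℕ → ℝ) : ℝ :=
  τ ^ (-α) / Real.Gamma (2 - α) *
    ∑ s ∈ Finset.range (j + 1), coefC α σ j (j - s) * (v (s + 1) - v s)

/-- The Grünwald coefficients `g_k^{(β)} = (-1)^k binom(β, k)`. -/
def grunwald (β : ℝ) (k : ℕ) : ℝ := (-1) ^ k * Ring.choose β k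

/-- The weighted and shifted Grünwald coefficients `ω_k^{(β)}`. -/
def weight (β : ℝ) : ℕ → ℝ
  | 0 => (β ^ 2 + 3 * β + 2) / 12 * grunwald β 0
  | 1 => (β ^ 2 + 3 * β + 2) / 12 * grunwald β 1 + (4 - β ^ 2) / 6 * grunwald β 0
  | k + 2 => (β ^ 2 + 3 * β + 2) / 12 * grunwald β (k + 2) + (4 - β ^ 2) / 6 * grunwald β (k + 1)
      + (β ^ 2 - 3 * β + 2) / 12 * grunwald β k

/-- The discrete spatial operator `δ_h^β` at the interior node `i` (`1 ≤ i ≤ N - 1`), with the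
values `g`, `p`, `q` of the coefficients `γ`, `d₊`, `d₋`. -/
def discreteSpace (β h : ℝ) (N : ℕ) (g p q : ℝ) (v : ℕ → ℝ) (i : ℕ) : ℝ :=
  g * ((v (i + 1) - v (i - 1)) / (2 * h))
    + p / h ^ β * ∑ k ∈ Finset.range (i + 2), weight β k * v (i + 1 - k)
    + q / h ^ β * ∑ k ∈ Finset.range (N - i + 2), weight β k * v (i + k - 1)

/-- `U` (written `U j i` for `u_i^j`) solves the implicit difference scheme with `N` space steps
and `M` time steps: `h = (b - a) / N`, `τ = T / M`, `x_i = a + i h`, `t_j = j τ`,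
`σ = 1 - α / 2`. -/
structure IsSchemeSolution (α β a b T : ℝ) (γ dp dm : ℝ → ℝ) (f : ℝ → ℝ → ℝ) (φ : ℝ → ℝ)
    (N M : ℕ) (U : ℕ → ℕ → ℝ) : Prop where
  step : ∀ i j : ℕ, 1 ≤ i → i < N → j < M →
    discreteCaputo α (1 - α / 2) (T / M) j (fun s => U s i) =
      discreteSpace β ((b - a) / N) N
        (γ ((j + (1 - α / 2)) * (T / M))) (dp ((j + (1 - α / 2)) * (T / M)))
        (dm ((j + (1 - α / 2)) * (T / M)))
        (fun l => (1 - α / 2) * U (j + 1) l + (1 - (1 - α / 2)) * U j l) i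
      + f (a + i * ((b - a) / N)) ((j + (1 - α / 2)) * (T / M))
  initial : ∀ i : ℕ, 1 ≤ i → i < N → U 0 i = φ (a + i * ((b - a) / N))
  boundary : ∀ j : ℕ, j ≤ M → U j 0 = 0 ∧ U j N = 0

/-- The discrete `L²` norm `‖v‖ = (h ∑_{i=1}^{N-1} v_i²)^{1/2}`. -/
def discreteNorm (h : ℝ) (N : ℕ) (v : ℕ → ℝ) : ℝ :=
  Real.sqrt (h * ∑ i ∈ Finset.Ico 1 N, v i ^ 2)

end TSFCDE

end

noncomputable section

namespace TSFCDE

/-! ### Coefficients of the discrete Caputo derivative -/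

lemma continuousOn_shifted_rpow {c p : ℝ} (hc : 0 < c) :
    ContinuousOn (fun y : ℝ => (c + y) ^ p) (Icc 0 1) := by
  refine ContinuousOn.rpow_const (by fun_prop) ?_
  intro y hy
  left
  have := hy.1
  positivity

lemma hasDerivAt_shifted_rpow {c p y : ℝ} (hc : 0 < c + y) :
    HasDerivAt (fun y : ℝ => (c + y) ^ p) (p * (c + y) ^ (p - 1)) y := by
  simpa using ((hasDerivAt_id y).const_add c).rpow_const (p := p) (Or.inl hc.ne')

lemma coefA_succ_eq_integral {α σ : ℝ} (hσ : 0 < σ) (m : ℕ) :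
    coefA α σ (m + 1) = (1 - α) * ∫ y in (0 : ℝ)..1, ((m : ℝ) + σ + y) ^ (-α) := by
  have hc : 0 < (m : ℝ) + σ := by positivity
  rw [← intervalIntegral.integral_const_mul]
  rw [intervalIntegral.integral_eq_sub_of_hasDerivAt
    (f := fun y => ((m : ℝ) + σ + y) ^ (1 - α))]
  · simp only [coefA, Nat.succ_ne_zero, if_false]
    push_cast
    congr 2 <;> ring
  · intro y hy
    rw [uIcc_of_le zero_le_one] at hy
    have := hasDerivAt_shifted_rpow (c := (m : ℝ) + σ) (p := 1 - α) (y := y)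
      (by have := hy.1; positivity)
    rwa [show 1 - α - 1 = -α by ring] at this
  · refine ContinuousOn.intervalIntegrable ?_
    rw [uIcc_of_le zero_le_one]
    exact (continuousOn_shifted_rpow hc).const_mul _

lemma coefB_succ_eq_integral {α σ : ℝ} (hα : α < 2) (hσ : 0 < σ) (m : ℕ) :
    coefB α σ (m + 1) = (1 - α) * ∫ y in (0 : ℝ)..1, (1 / 2 - y) * ((m : ℝ) + σ + y) ^ (-α) := by
  have hc : 0 < (m : ℝ) + σ := by positivity
  have h2 : 2 - α ≠ 0 := by linarith
  rw [← intervalIntegral.integral_const_mul]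
  rw [intervalIntegral.integral_eq_sub_of_hasDerivAt
    (f := fun y => (1 / 2 - y) * ((m : ℝ) + σ + y) ^ (1 - α)
      + 1 / (2 - α) * ((m : ℝ) + σ + y) ^ (2 - α))]
  · simp only [coefB]
    push_cast
    have e1 : (m : ℝ) + 1 + σ = m + σ + 1 := by ring
    have e2 : (m : ℝ) + 1 - 1 + σ = m + σ := by ring
    rw [e1, e2, add_zero]
    ring
  · intro y hy
    rw [uIcc_of_le zero_le_one] at hy
    have hy0 : 0 < (m : ℝ) + σ + y := by have := hy.1; positivity
    have h1 := hasDerivAt_shifted_rpow (c := (m : ℝ) + σ) (p := 1 - α) hy0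
    have h3 := (hasDerivAt_shifted_rpow (c := (m : ℝ) + σ) (p := 2 - α) hy0).const_mul (1 / (2 - α))
    have h4 := (((hasDerivAt_id y).const_sub (1 / 2)).mul h1).add h3
    refine h4.congr_deriv ?_
    have e1 : 1 - α - 1 = -α := by ring
    have e2 : 2 - α - 1 = 1 - α := by ring
    simp only [id]
    rw [e1, e2]
    field_simp
    ring
  · refine ContinuousOn.intervalIntegrable ?_
    rw [uIcc_of_le zero_le_one]
    exact ((by fun_prop : ContinuousOn (fun y : ℝ => 1 / 2 - y) (Icc 0 1)).mul
      (continuousOn_shifted_rpow hc)).const_mul _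

lemma integral_half_sub_mul_nonneg {f : ℝ → ℝ} (hf : ContinuousOn f (Icc 0 1))
    (ha : AntitoneOn f (Icc 0 1)) : 0 ≤ ∫ y in (0 : ℝ)..1, (1 / 2 - y) * f y := by
  have h1 : ∫ y in (0 : ℝ)..1, (1 / 2 - y) * f (1 / 2) = 0 := by
    rw [intervalIntegral.integral_mul_const, intervalIntegral.integral_sub (by simp) (by simp)]
    simp
  have hc : ContinuousOn (fun y : ℝ => 1 / 2 - y) (Icc 0 1) := by fun_prop
  refine h1.symm.le.trans (intervalIntegral.integral_mono_on zero_le_one ?_ ?_ ?_)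
  · exact Continuous.intervalIntegrable (by fun_prop) _ _
  · refine ContinuousOn.intervalIntegrable ?_
    rw [uIcc_of_le zero_le_one]
    exact hc.mul hf
  · intro y hy
    have hh : (1 / 2 : ℝ) ∈ Icc (0 : ℝ) 1 := by norm_num
    rcases le_total y (1 / 2) with h | h
    · have := ha hy hh h
      nlinarith
    · have := ha hh hy h
      nlinarith

lemma shifted_rpow_neg_le {α c y y' : ℝ} (hα : 0 ≤ α) (hc : 0 < c + y) (h : y ≤ y') :
    (c + y') ^ (-α) ≤ (c + y) ^ (-α) :=
  Real.rpow_le_rpow_of_nonpos hc (by linarith) (by linarith)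

lemma coefB_succ_nonneg {α σ : ℝ} (hα₀ : 0 ≤ α) (hα : α < 1) (hσ : 0 < σ) (m : ℕ) :
    0 ≤ coefB α σ (m + 1) := by
  have hc : 0 < (m : ℝ) + σ := by positivity
  rw [coefB_succ_eq_integral (by linarith) hσ]
  refine mul_nonneg (by linarith) (integral_half_sub_mul_nonneg (continuousOn_shifted_rpow hc) ?_)
  intro y hy y' _ h
  exact shifted_rpow_neg_le hα₀ (by have := hy.1; positivity) h

lemma rpow_neg_sub_antitone {α x y : ℝ} (hα : 0 ≤ α) (hx : 0 < x) (hxy : x ≤ y) :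
    y ^ (-α) - (y + 1) ^ (-α) ≤ x ^ (-α) - (x + 1) ^ (-α) := by
  have hd : ∀ z, 0 < z → HasDerivAt (fun z : ℝ => z ^ (-α) - (z + 1) ^ (-α))
      (-α * z ^ (-α - 1) - -α * (z + 1) ^ (-α - 1)) z := by
    intro z hz
    have h1 := (hasDerivAt_id z).rpow_const (p := -α) (Or.inl hz.ne')
    have h2 := ((hasDerivAt_id z).add_const 1).rpow_const (p := -α)
      (Or.inl (by simp only [id]; positivity))
    simpa [Function.comp_def] using h1.fun_sub h2
  have := antitoneOn_of_deriv_nonpos (convex_Ici x)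
    (f := fun z : ℝ => z ^ (-α) - (z + 1) ^ (-α))
    (fun z hz => (hd z (hx.trans_le hz)).continuousAt.continuousWithinAt)
    (fun z hz => ((hd z (hx.trans_le (interior_subset hz))).differentiableAt).differentiableWithinAt)
    (fun z hz => by
      have hz0 : 0 < z := hx.trans_le (interior_subset hz)
      rw [(hd z hz0).deriv]
      have : (z + 1) ^ (-α - 1) ≤ z ^ (-α - 1) :=
        Real.rpow_le_rpow_of_nonpos hz0 (by linarith) (by linarith)
      nlinarith)
  exact this (by simp) (by simpa using hxy) hxy

lemma coefB_succ_succ_le {α σ : ℝ} (hα₀ : 0 ≤ α) (hα : α < 1) (hσ : 0 < σ) (m : ℕ) :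
    coefB α σ (m + 2) ≤ coefB α σ (m + 1) := by
  have hc : 0 < (m : ℝ) + σ := by positivity
  have hc' : 0 < ((m + 1 : ℕ) : ℝ) + σ := by positivity
  rw [coefB_succ_eq_integral (m := m + 1) (by linarith) hσ,
    coefB_succ_eq_integral (m := m) (by linarith) hσ]
  refine mul_le_mul_of_nonneg_left ?_ (by linarith)
  have hh : ContinuousOn (fun y : ℝ => 1 / 2 - y) (Icc 0 1) := by fun_prop
  have h := integral_half_sub_mul_nonneg
    ((continuousOn_shifted_rpow (p := -α) hc).sub (continuousOn_shifted_rpow (p := -α) hc')) ?_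
  · simp only [mul_sub, Pi.sub_apply] at h
    rw [intervalIntegral.integral_sub] at h
    · linarith
    · refine ContinuousOn.intervalIntegrable ?_
      rw [uIcc_of_le zero_le_one]
      exact hh.mul (continuousOn_shifted_rpow hc)
    · refine ContinuousOn.intervalIntegrable ?_
      rw [uIcc_of_le zero_le_one]
      exact hh.mul (continuousOn_shifted_rpow hc')
  · intro y hy y' _ h
    have := rpow_neg_sub_antitone hα₀ (x := m + σ + y) (y := m + σ + y')
      (by have := hy.1; positivity) (by linarith)
    simp only [Pi.sub_apply]
    push_cast
    rw [show (m : ℝ) + 1 + σ + y' = m + σ + y' + 1 by ring,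
      show (m : ℝ) + 1 + σ + y = m + σ + y + 1 by ring]
    exact this

lemma coefA_sub_coefB_succ_eq_integral {α σ : ℝ} (hα : α < 2) (hσ : 0 < σ) (m : ℕ) :
    coefA α σ (m + 1) - coefB α σ (m + 1)
      = (1 - α) * ∫ y in (0 : ℝ)..1, (1 / 2 + y) * ((m : ℝ) + σ + y) ^ (-α) := by
  have hc : 0 < (m : ℝ) + σ := by positivity
  rw [coefA_succ_eq_integral hσ, coefB_succ_eq_integral hα hσ, ← mul_sub,
    ← intervalIntegral.integral_sub]
  · congr 2
    ext y
    ring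
  · refine ContinuousOn.intervalIntegrable ?_
    rw [uIcc_of_le zero_le_one]
    exact continuousOn_shifted_rpow hc
  · refine ContinuousOn.intervalIntegrable ?_
    rw [uIcc_of_le zero_le_one]
    exact (by fun_prop : ContinuousOn (fun y : ℝ => 1 / 2 - y) (Icc 0 1)).mul
      (continuousOn_shifted_rpow hc)

lemma intervalIntegrable_half_add_mul {α c : ℝ} (hc : 0 < c) :
    IntervalIntegrable (fun y : ℝ => (1 / 2 + y) * (c + y) ^ (-α)) volume 0 1 := by
  refine ContinuousOn.intervalIntegrable ?_
  rw [uIcc_of_le zero_le_one]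
  exact (by fun_prop : ContinuousOn (fun y : ℝ => 1 / 2 + y) (Icc 0 1)).mul
    (continuousOn_shifted_rpow hc)

lemma coefA_sub_coefB_succ_le {α σ : ℝ} (hα₀ : 0 ≤ α) (hα : α < 1) (hσ : 0 < σ) (m : ℕ) :
    coefA α σ (m + 2) - coefB α σ (m + 2) ≤ coefA α σ (m + 1) - coefB α σ (m + 1) := by
  have hc : 0 < (m : ℝ) + σ := by positivity
  have hc' : 0 < ((m + 1 : ℕ) : ℝ) + σ := by positivity
  rw [coefA_sub_coefB_succ_eq_integral (m := m + 1) (by linarith) hσ,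
    coefA_sub_coefB_succ_eq_integral (m := m) (by linarith) hσ]
  refine mul_le_mul_of_nonneg_left ?_ (by linarith)
  refine intervalIntegral.integral_mono_on zero_le_one (intervalIntegrable_half_add_mul hc')
    (intervalIntegrable_half_add_mul hc) fun y hy => ?_
  have hy0 := hy.1
  refine mul_le_mul_of_nonneg_left ?_ (by positivity)
  refine Real.rpow_le_rpow_of_nonpos (by positivity) ?_ (by linarith)
  push_cast
  linarith

lemma le_coefA_sub_coefB_succ {α σ : ℝ} (hα₀ : 0 ≤ α) (hα : α < 1) (hσ : 0 < σ) (m : ℕ) :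
    (1 - α) * ((m : ℝ) + 1 + σ) ^ (-α) ≤ coefA α σ (m + 1) - coefB α σ (m + 1) := by
  have hc : 0 < (m : ℝ) + σ := by positivity
  rw [coefA_sub_coefB_succ_eq_integral (by linarith) hσ]
  refine mul_le_mul_of_nonneg_left ?_ (by linarith)
  have h1 : ∫ y in (0 : ℝ)..1, (1 / 2 + y) * ((m : ℝ) + 1 + σ) ^ (-α)
      = ((m : ℝ) + 1 + σ) ^ (-α) := by
    rw [intervalIntegral.integral_mul_const, intervalIntegral.integral_add (by simp) (by simp)]
    norm_num
  rw [← h1]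
  refine intervalIntegral.integral_mono_on zero_le_one ?_
    (intervalIntegrable_half_add_mul hc) fun y hy => ?_
  · exact Continuous.intervalIntegrable (by fun_prop) _ _
  · have hy0 := hy.1
    have hy1 := hy.2
    refine mul_le_mul_of_nonneg_left ?_ (by positivity)
    exact Real.rpow_le_rpow_of_nonpos (by positivity) (by linarith) (by linarith)

lemma coefA_one_le {α σ : ℝ} (hα₀ : 0 ≤ α) (hα : α < 1) (hσ : 0 < σ) :
    coefA α σ 1 ≤ (1 - α) * σ ^ (-α) := by
  have h := coefA_succ_eq_integral (α := α) hσ 0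
  simp only [Nat.cast_zero, zero_add] at h
  rw [h]
  refine mul_le_mul_of_nonneg_left ?_ (by linarith)
  have h1 : ∫ _ in (0 : ℝ)..1, σ ^ (-α) = σ ^ (-α) := by simp
  rw [← h1]
  refine intervalIntegral.integral_mono_on zero_le_one ?_ (by simp) fun y hy => ?_
  · refine ContinuousOn.intervalIntegrable ?_
    rw [uIcc_of_le zero_le_one]
    exact continuousOn_shifted_rpow hσ
  · exact Real.rpow_le_rpow_of_nonpos hσ (by linarith [hy.1]) (by linarith)

lemma coefC_self_succ {α σ : ℝ} (j : ℕ) :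
    coefC α σ (j + 1) (j + 1) = coefA α σ (j + 1) - coefB α σ (j + 1) := by
  simp [coefC]

lemma coefC_one_le {α σ : ℝ} (hα₀ : 0 ≤ α) (hα : α < 1) (hσ : 0 < σ) {j : ℕ} (hj : 1 ≤ j) :
    coefC α σ j 1 ≤ coefA α σ 1 := by
  have h1 := coefB_succ_nonneg hα₀ hα hσ 0
  have h2 := coefB_succ_succ_le hα₀ hα hσ 0
  simp only [zero_add] at h1 h2
  simp only [coefC]
  rw [if_neg (by omega), if_neg one_ne_zero]
  split_ifs with h5
  · subst h5; linarith
  · norm_num; linarith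

lemma mul_coefC_one_le {α : ℝ} (hα₀ : 0 ≤ α) (hα : α < 1) {j : ℕ} (hj : 1 ≤ j) :
    (1 - α / 2) * coefC α (1 - α / 2) j 1 ≤ (1 - α) * coefC α (1 - α / 2) j 0 := by
  have hσ : 0 < 1 - α / 2 := by linarith
  have h1 := coefC_one_le hα₀ hα hσ hj
  have h2 := coefA_one_le hα₀ hα hσ
  have h3 := coefB_succ_nonneg hα₀ hα hσ 0
  simp only [zero_add] at h3
  have h4 : coefC α (1 - α / 2) j 0 = coefA α (1 - α / 2) 0 + coefB α (1 - α / 2) 1 := by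
    simp [coefC, show j ≠ 0 by omega]
  have h5 : coefA α (1 - α / 2) 0 = (1 - α / 2) * (1 - α / 2) ^ (-α) := by
    simp only [coefA, if_true]
    rw [sub_eq_add_neg 1 α, Real.rpow_add hσ, Real.rpow_one]
  rw [h4, h5]
  calc (1 - α / 2) * coefC α (1 - α / 2) j 1
      ≤ (1 - α / 2) * ((1 - α) * (1 - α / 2) ^ (-α)) := by
        exact mul_le_mul_of_nonneg_left (h1.trans h2) hσ.le
    _ ≤ _ := by nlinarith

lemma coefC_succ_le {α : ℝ} (hα₀ : 0 ≤ α) (hα : α < 1) {j m : ℕ} (hm : m < j)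
    (hpos : 0 ≤ coefC α (1 - α / 2) j 1) :
    coefC α (1 - α / 2) j (m + 1) ≤ coefC α (1 - α / 2) j m := by
  have hσ : 0 < 1 - α / 2 := by linarith
  rcases m with _ | m
  · have h := mul_coefC_one_le hα₀ hα (j := j) (by omega)
    simp only [zero_add]
    nlinarith
  · have h1 := coefA_sub_coefB_succ_le hα₀ hα hσ m
    have h2 := coefB_succ_nonneg hα₀ hα hσ (m + 1)
    have h3 := coefB_succ_succ_le hα₀ hα hσ (m + 1)
    simp only [coefC, show j ≠ 0 by omega, Nat.succ_ne_zero, if_false, show m + 1 ≠ j by omega]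
    split_ifs with h
    · subst h
      linarith
    · rw [show m + 1 + 1 = m + 2 by rfl] at *
      rw [show m + 1 + 2 = m + 2 + 1 by rfl] at *
      linarith

lemma coefC_self_ge {α : ℝ} (hα₀ : 0 ≤ α) (hα : α < 1) (j : ℕ) :
    (1 - α) * ((j : ℝ) + (1 - α / 2)) ^ (-α) ≤ coefC α (1 - α / 2) j j := by
  have hσ : 0 < 1 - α / 2 := by linarith
  rcases j with _ | j
  · simp only [coefC, coefA, if_true, Nat.cast_zero, zero_add]
    rw [sub_eq_add_neg 1 α, Real.rpow_add hσ, Real.rpow_one]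
    have := Real.rpow_nonneg hσ.le (-α)
    nlinarith
  · rw [coefC_self_succ]
    have := le_coefA_sub_coefB_succ hα₀ hα hσ j
    push_cast
    linarith

lemma coefC_one_nonneg {α : ℝ} (hα₀ : 0 ≤ α) (hα : α < 1) {j : ℕ} (hj : 1 ≤ j) :
    0 ≤ coefC α (1 - α / 2) j 1 := by
  have hσ : 0 < 1 - α / 2 := by linarith
  have h1 := le_coefA_sub_coefB_succ hα₀ hα hσ 0
  have h2 := coefB_succ_nonneg hα₀ hα hσ 1
  have h3 : 0 ≤ (1 - α) * (((0 : ℕ) : ℝ) + 1 + (1 - α / 2)) ^ (-α) := by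
    refine mul_nonneg (by linarith) (Real.rpow_nonneg ?_ _)
    push_cast; linarith
  simp only [zero_add] at h1
  simp only [coefC]
  rw [if_neg (by omega), if_neg one_ne_zero]
  split_ifs with h6
  · subst h6; linarith
  · norm_num at *; linarith

lemma coefC_antitone {α : ℝ} (hα₀ : 0 ≤ α) (hα : α < 1) {j m : ℕ} (hm : m < j) :
    coefC α (1 - α / 2) j (m + 1) ≤ coefC α (1 - α / 2) j m :=
  coefC_succ_le hα₀ hα hm (coefC_one_nonneg hα₀ hα (by omega))

lemma coefC_pos {α : ℝ} (hα₀ : 0 ≤ α) (hα : α < 1) {j m : ℕ} (hm : m ≤ j) :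
    0 < coefC α (1 - α / 2) j m := by
  induction hm using Nat.decreasingInduction with
  | self =>
    refine lt_of_lt_of_le ?_ (coefC_self_ge hα₀ hα j)
    refine mul_pos (by linarith) (Real.rpow_pos_of_pos ?_ _)
    have : (0 : ℝ) ≤ j := by positivity
    linarith
  | of_succ k hk ih => exact ih.trans_le (coefC_antitone hα₀ hα hk)

lemma coefC_one_eq {j m : ℕ} (hm : m ≤ j) :
    coefC 1 (1 - 1 / 2) j m = if m = 0 then 1 else 0 := by
  have hA : ∀ l : ℕ, coefA 1 (1 - 1 / 2) l = if l = 0 then 1 else 0 := by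
    intro l; simp [coefA]
  have hB : ∀ l : ℕ, coefB 1 (1 - 1 / 2) (l + 1) = 0 := by
    intro l; simp only [coefB]; norm_num
  simp only [coefC, hA]
  rcases m with _ | m
  · have := hB 0
    rw [zero_add] at this
    simp only [this]
    simp
  · rcases j with _ | j
    · omega
    · simp only [hB]
      simp

/-! ### Energy inequality and discrete fractional Gronwall inequality -/

lemma partial_energy_lower_bound (w v : ℕ → ℝ) {J : ℕ} (hw : ∀ s ≤ J, 0 < w s)
    (hmono : ∀ s < J, w s ≤ w (s + 1)) :
    ∀ n ≤ J, (∑ s ∈ Finset.range (n + 1), w s * (v (s + 1) - v s)) ^ 2 / (2 * w n)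
      ≤ ∑ s ∈ Finset.range (n + 1),
        w s * (v (s + 1) - v s) * (v (n + 1) - (v (s + 1) + v s) / 2) := by
  intro n
  induction n with
  | zero =>
    intro _
    have h0 := hw 0 (by omega)
    simp only [zero_add, Finset.sum_range_one]
    rw [div_le_iff₀ (by positivity)]
    apply le_of_eq
    ring
  | succ n ih =>
    intro hn
    have ih' := ih (by omega)
    have h1 := hw (n + 1) hn
    have h2 := hw n (by omega)
    have h3 := hmono n (by omega)
    set S := ∑ s ∈ Finset.range (n + 1), w s * (v (s + 1) - v s) with hS
    have e : ∑ s ∈ Finset.range (n + 1),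
        w s * (v (s + 1) - v s) * (v (n + 1 + 1) - (v (s + 1) + v s) / 2)
        = ∑ s ∈ Finset.range (n + 1),
          w s * (v (s + 1) - v s) * (v (n + 1) - (v (s + 1) + v s) / 2)
          + S * (v (n + 1 + 1) - v (n + 1)) := by
      rw [hS, Finset.sum_mul, ← Finset.sum_add_distrib]
      refine Finset.sum_congr rfl fun s _ => ?_
      ring
    rw [Finset.sum_range_succ, ← hS, Finset.sum_range_succ (n := n + 1), e]
    set d := v (n + 1 + 1) - v (n + 1) with hd
    have h4 : S ^ 2 / (2 * w (n + 1)) ≤ S ^ 2 / (2 * w n) := by gcongr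
    have h5 : (S + w (n + 1) * d) ^ 2 / (2 * w (n + 1))
        = S ^ 2 / (2 * w (n + 1)) + S * d + w (n + 1) * d ^ 2 / 2 := by
      field_simp
      ring
    have h6 : v (n + 1 + 1) - (v (n + 1 + 1) + v (n + 1)) / 2 = d / 2 := by rw [hd]; ring
    rw [h5, h6]
    nlinarith

lemma weighted_energy_inequality {σ : ℝ} (hσ : 1 / 2 < σ) (hσ₁ : σ ≤ 1) (w v : ℕ → ℝ) {j : ℕ}
    (hw : ∀ s ≤ j, 0 < w s) (hmono : ∀ s < j, w s ≤ w (s + 1))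
    (hlast : ∀ i, j = i + 1 → σ * w i ≤ (2 * σ - 1) * w j) :
    1 / 2 * ∑ s ∈ Finset.range (j + 1), w s * (v (s + 1) ^ 2 - v s ^ 2)
      ≤ (σ * v (j + 1) + (1 - σ) * v j)
        * ∑ s ∈ Finset.range (j + 1), w s * (v (s + 1) - v s) := by
  rcases j with _ | j
  · have h0 := hw 0 le_rfl
    simp only [zero_add, Finset.sum_range_one]
    have : 0 ≤ w 0 * ((2 * σ - 1) * (v 1 - v 0) ^ 2) :=
      mul_nonneg h0.le (mul_nonneg (by linarith) (sq_nonneg _))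
    nlinarith
  · have hF := partial_energy_lower_bound w v hw hmono j (by omega)
    have h1 := hw (j + 1) le_rfl
    have h2 := hw j (by omega)
    have h3 := hmono j (by omega)
    have h4 := hlast j rfl
    set S := ∑ s ∈ Finset.range (j + 1), w s * (v (s + 1) - v s) with hS
    set d := v (j + 1 + 1) - v (j + 1) with hd
    have e : (σ * v (j + 1 + 1) + (1 - σ) * v (j + 1)) * S
        - 1 / 2 * ∑ s ∈ Finset.range (j + 1), w s * (v (s + 1) ^ 2 - v s ^ 2)
        = ∑ s ∈ Finset.range (j + 1),
          w s * (v (s + 1) - v s) * (v (j + 1) - (v (s + 1) + v s) / 2) + σ * d * S := by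
      rw [hS, Finset.mul_sum, Finset.mul_sum, Finset.mul_sum, ← Finset.sum_sub_distrib,
        ← Finset.sum_add_distrib]
      refine Finset.sum_congr rfl fun s _ => ?_
      rw [hd]
      ring
    rw [Finset.sum_range_succ, Finset.sum_range_succ (n := j + 1), ← hS]
    suffices h : 0 ≤ S ^ 2 / (2 * w j) + σ * d * S
        + (2 * σ - 1) / 2 * w (j + 1) * d ^ 2 by
      have h5 : v (j + 1 + 1) ^ 2 - v (j + 1) ^ 2 = d * (v (j + 1 + 1) + v (j + 1)) := by
        rw [hd]; ring
      have h6 : (σ * v (j + 1 + 1) + (1 - σ) * v (j + 1)) * (w (j + 1) * d)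
          - 1 / 2 * (w (j + 1) * (v (j + 1 + 1) ^ 2 - v (j + 1) ^ 2))
          = (2 * σ - 1) / 2 * w (j + 1) * d ^ 2 := by
        rw [hd]; ring
      nlinarith
    have h7 : S ^ 2 / (2 * w j) + σ * d * S + (2 * σ - 1) / 2 * w (j + 1) * d ^ 2
        = ((S + σ * w j * d) ^ 2
          + ((2 * σ - 1) * w (j + 1) - σ ^ 2 * w j) * w j * d ^ 2) / (2 * w j) := by
      field_simp
      ring
    rw [h7]
    refine div_nonneg (add_nonneg (sq_nonneg _) ?_) (by positivity)
    refine mul_nonneg (mul_nonneg ?_ h2.le) (sq_nonneg _)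
    have h8 : 0 ≤ σ * (1 - σ) * w j :=
      mul_nonneg (mul_nonneg (by linarith) (by linarith)) h2.le
    nlinarith

lemma discreteCaputo_energy {α τ : ℝ} (hα₀ : 0 < α) (hα₁ : α ≤ 1) (hτ : 0 < τ) (j : ℕ)
    (v : ℕ → ℝ) :
    1 / 2 * discreteCaputo α (1 - α / 2) τ j (fun s => v s ^ 2)
      ≤ ((1 - α / 2) * v (j + 1) + (1 - (1 - α / 2)) * v j)
        * discreteCaputo α (1 - α / 2) τ j v := by
  have hc : 0 ≤ τ ^ (-α) / Real.Gamma (2 - α) :=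
    div_nonneg (Real.rpow_nonneg hτ.le _) (Real.Gamma_pos_of_pos (by linarith)).le
  suffices h : 1 / 2 * ∑ s ∈ Finset.range (j + 1),
      coefC α (1 - α / 2) j (j - s) * (v (s + 1) ^ 2 - v s ^ 2)
      ≤ ((1 - α / 2) * v (j + 1) + (1 - (1 - α / 2)) * v j)
        * ∑ s ∈ Finset.range (j + 1), coefC α (1 - α / 2) j (j - s) * (v (s + 1) - v s) by
    have := mul_le_mul_of_nonneg_left h hc
    simp only [discreteCaputo]
    linarith
  rcases hα₁.lt_or_eq with h1 | h1
  · refine weighted_energy_inequality (by linarith) (by linarith)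
      (fun s => coefC α (1 - α / 2) j (j - s)) v ?_ ?_ ?_
    · intro s _
      exact coefC_pos hα₀.le h1 (by omega)
    · intro s hs
      have := coefC_antitone hα₀.le h1 (j := j) (m := j - (s + 1)) (by omega)
      rwa [show j - (s + 1) + 1 = j - s by omega] at this
    · rintro i rfl
      have := mul_coefC_one_le hα₀.le h1 (j := i + 1) (by omega)
      simp only [Nat.sub_self, Nat.add_sub_cancel_left]
      rw [show 2 * (1 - α / 2) - 1 = 1 - α by ring]
      exact this
  · subst h1
    rw [Finset.sum_eq_single_of_mem j (by simp), Finset.sum_eq_single_of_mem j (by simp)]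
    · rw [coefC_one_eq (by omega)]
      simp only [Nat.sub_self, if_true]
      apply le_of_eq
      ring
    · intro s hs hsj
      rw [Finset.mem_range] at hs
      rw [coefC_one_eq (by omega), if_neg (by omega), zero_mul]
    · intro s hs hsj
      rw [Finset.mem_range] at hs
      rw [coefC_one_eq (by omega), if_neg (by omega), zero_mul]

lemma weighted_difference_lower_bound (w f : ℕ → ℝ) {j : ℕ}
    (hmono : ∀ s < j, w s ≤ w (s + 1)) (hf : ∀ s ≤ j, 0 ≤ f s) :
    ∀ n ≤ j, w 0 * f 0 - w n * f (n + 1)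
      ≤ ∑ s ∈ Finset.range (n + 1), w s * (f s - f (s + 1)) := by
  intro n
  induction n with
  | zero => intro _; simp only [zero_add, Finset.sum_range_one]; linarith
  | succ n ih =>
    intro hn
    have h1 := ih (by omega)
    rw [Finset.sum_range_succ]
    have h2 := mul_le_mul_of_nonneg_right (hmono n (by omega)) (hf (n + 1) hn)
    linarith

lemma discreteCaputo_gronwall {α T : ℝ} (hα₀ : 0 < α) (hα₁ : α ≤ 1) (hT : 0 < T) :
    ∃ K : ℝ, 0 < K ∧ ∀ M : ℕ, 0 < M → ∀ (e : ℕ → ℝ) (B : ℝ), e 0 = 0 → 0 ≤ B →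
      (∀ j < M, discreteCaputo α (1 - α / 2) (T / M) j e ≤ B) → ∀ j ≤ M, e j ≤ K * B := by
  rcases hα₁.lt_or_eq with h1 | h1
  · have hG : 0 < Real.Gamma (2 - α) := Real.Gamma_pos_of_pos (by linarith)
    have hTp : 0 < T ^ α := Real.rpow_pos_of_pos hT _
    refine ⟨Real.Gamma (2 - α) * T ^ α / (1 - α), div_pos (by positivity) (by linarith), ?_⟩
    intro M hM e B he0 hB hdisc
    set K := Real.Gamma (2 - α) * T ^ α / (1 - α) with hK
    have hM' : (0 : ℝ) < M := by exact_mod_cast hM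
    have hτ : 0 < T / M := by positivity
    have hKB : 0 ≤ K * B := mul_nonneg (div_nonneg (by positivity) (by linarith)) hB
    intro j
    induction j using Nat.strong_induction_on with
    | _ n ih =>
      intro hn
      rcases n with _ | j
      · rw [he0]; exact hKB
      · have hd := hdisc j (by omega)
        have hjM : (j : ℝ) + (1 - α / 2) ≤ M := by
          have : (j : ℝ) + 1 ≤ M := by exact_mod_cast hn
          linarith
        have hj0 : 0 < (j : ℝ) + (1 - α / 2) := by
          have : (0 : ℝ) ≤ j := by positivity
          linarith
        have hcj : B * Real.Gamma (2 - α) ≤ (T / M) ^ (-α) * (coefC α (1 - α / 2) j j * (K * B)) := by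
          have h2 := coefC_self_ge hα₀.le h1 j
          have h3 : (M : ℝ) ^ (-α) ≤ ((j : ℝ) + (1 - α / 2)) ^ (-α) :=
            Real.rpow_le_rpow_of_nonpos hj0 hjM (by linarith)
          have h4 : (T / M) ^ (-α) * (M : ℝ) ^ (-α) = T ^ (-α) := by
            rw [← Real.mul_rpow hτ.le hM'.le, div_mul_cancel₀ _ hM'.ne']
          have h5 : T ^ (-α) * T ^ α = 1 := by
            rw [← Real.rpow_add hT]; simp
          have h6 : (0 : ℝ) ≤ (T / M) ^ (-α) := Real.rpow_nonneg hτ.le _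
          have h7 : (1 - α) * (M : ℝ) ^ (-α) ≤ coefC α (1 - α / 2) j j :=
            (mul_le_mul_of_nonneg_left h3 (by linarith)).trans h2
          calc B * Real.Gamma (2 - α) = (T / M) ^ (-α) * ((1 - α) * (M : ℝ) ^ (-α) * (K * B)) := by
                have h8 : 1 - α ≠ 0 := by linarith
                calc B * Real.Gamma (2 - α) = B * Real.Gamma (2 - α) * (T ^ (-α) * T ^ α) := by
                      rw [h5, mul_one]
                  _ = _ := by
                      rw [← h4, hK]
                      field_simp
            _ ≤ _ := by gcongr
        have hτp : 0 < (T / M) ^ (-α) := Real.rpow_pos_of_pos hτ _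
        have hsum : ∑ s ∈ Finset.range (j + 1), coefC α (1 - α / 2) j (j - s) * (e (s + 1) - e s)
            ≤ coefC α (1 - α / 2) j j * (K * B) := by
          rw [discreteCaputo, div_mul_eq_mul_div, div_le_iff₀ hG] at hd
          exact le_of_mul_le_mul_left (hd.trans hcj) hτp
        have hlow := weighted_difference_lower_bound
          (fun s => coefC α (1 - α / 2) j (j - s)) (fun s => K * B - e s) (j := j) ?_ ?_ j le_rfl
        · simp only [he0, Nat.sub_self, Nat.sub_zero, sub_sub_sub_cancel_left] at hlow
          have hc0 := coefC_pos hα₀.le h1 (j := j) (m := 0) (by omega)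
          have h9 : 0 ≤ coefC α (1 - α / 2) j 0 * (K * B - e (j + 1)) := by linarith
          have := nonneg_of_mul_nonneg_right h9 hc0
          linarith
        · intro s hs
          have := coefC_antitone hα₀.le h1 (j := j) (m := j - (s + 1)) (by omega)
          rwa [show j - (s + 1) + 1 = j - s by omega] at this
        · intro s hs
          have := ih s (by omega) (by omega)
          linarith
  · subst h1
    refine ⟨T, hT, ?_⟩
    intro M hM e B he0 hB hdisc
    have hM' : (0 : ℝ) < M := by exact_mod_cast hM
    have key : ∀ j ≤ M, e j ≤ j * (T / M * B) := by
      intro j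
      induction j with
      | zero => intro _; simp [he0]
      | succ j ih =>
        intro hj
        have h2 := ih (by omega)
        have h3 := hdisc j (by omega)
        rw [discreteCaputo, Finset.sum_eq_single_of_mem j (by simp)] at h3
        · rw [coefC_one_eq (by omega), Nat.sub_self, if_pos rfl, Real.rpow_neg_one,
            show (2 : ℝ) - 1 = 1 by norm_num, Real.Gamma_one, div_one, one_mul, inv_mul_eq_div,
            div_le_iff₀ (by positivity)] at h3
          push_cast
          linarith
        · intro s hs hsj
          rw [Finset.mem_range] at hs
          rw [coefC_one_eq (by omega), if_neg (by omega), zero_mul]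
    intro j hj
    refine (key j hj).trans ?_
    have : (j : ℝ) ≤ M := by exact_mod_cast hj
    calc (j : ℝ) * (T / M * B) ≤ M * (T / M * B) := by gcongr
      _ = T * B := by field_simp

/-! ### Grünwald coefficients and the weights -/

lemma grunwald_zero (β : ℝ) : grunwald β 0 = 1 := by simp [grunwald]

lemma grunwald_succ (β : ℝ) (k : ℕ) :
    grunwald β (k + 1) = grunwald β k * ((k - β) / (k + 1)) := by
  have h : Ring.choose β (k + 1) = Ring.choose β k * ((β - k) / (k + 1)) := by
    rw [Ring.choose_eq_smul, Ring.choose_eq_smul, descPochhammer_succ_right,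
      Polynomial.smeval_mul, Nat.factorial_succ]
    simp only [Polynomial.smeval_sub, Polynomial.smeval_X, Polynomial.smeval_natCast, smul_eq_mul]
    have : (k.factorial : ℝ) ≠ 0 := by positivity
    have h2 : (k : ℝ) + 1 ≠ 0 := by positivity
    push_cast
    field_simp
    simp
  rw [grunwald, grunwald, h, pow_succ]
  ring

lemma grunwald_succ_eq_sub (β : ℝ) (k : ℕ) :
    grunwald β (k + 1) = grunwald (β - 1) (k + 1) - grunwald (β - 1) k := by
  have h := Ring.choose_succ_succ (β - 1) k
  rw [sub_add_cancel] at h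
  rw [grunwald, grunwald, grunwald, h, pow_succ]
  ring

lemma sum_grunwald (β : ℝ) (n : ℕ) :
    ∑ k ∈ Finset.range (n + 1), grunwald β k = grunwald (β - 1) n := by
  induction n with
  | zero => simp [grunwald_zero]
  | succ n ih => rw [Finset.sum_range_succ, ih, grunwald_succ_eq_sub β n]; ring

lemma grunwald_one (β : ℝ) : grunwald β 1 = -β := by
  have := grunwald_succ β 0
  simpa [grunwald_zero] using this

lemma grunwald_two (β : ℝ) : grunwald β 2 = β * (β - 1) / 2 := by
  have := grunwald_succ β 1
  rw [this, grunwald_one]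
  push_cast
  ring

lemma grunwald_three (β : ℝ) : grunwald β 3 = β * (β - 1) * (2 - β) / 6 := by
  have := grunwald_succ β 2
  rw [this, grunwald_two]
  push_cast
  ring

lemma grunwald_add_two_nonneg {β : ℝ} (h₁ : 1 ≤ β) (h₂ : β ≤ 2) (k : ℕ) :
    0 ≤ grunwald β (k + 2) := by
  induction k with
  | zero => simp only [zero_add, grunwald_two]; nlinarith
  | succ k ih =>
    rw [grunwald_succ β (k + 2)]
    refine mul_nonneg ih (div_nonneg ?_ (by positivity))
    push_cast
    have : (0 : ℝ) ≤ k := by positivity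
    linarith

lemma grunwald_sub_one_succ_nonpos {β : ℝ} (h₁ : 1 ≤ β) (h₂ : β ≤ 2) (k : ℕ) :
    grunwald (β - 1) (k + 1) ≤ 0 := by
  induction k with
  | zero => simp only [zero_add, grunwald_one]; linarith
  | succ k ih =>
    rw [grunwald_succ (β - 1) (k + 1)]
    refine mul_nonpos_of_nonpos_of_nonneg ih (div_nonneg ?_ (by positivity))
    push_cast
    have : (0 : ℝ) ≤ k := by positivity
    linarith

lemma weight_zero (β : ℝ) : weight β 0 = (β ^ 2 + 3 * β + 2) / 12 := by
  simp [weight, grunwald_zero]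

lemma weight_one (β : ℝ) : weight β 1 = (-β ^ 3 - 5 * β ^ 2 - 2 * β + 8) / 12 := by
  simp only [weight, grunwald_zero, grunwald_one]
  ring

lemma weight_two (β : ℝ) :
    weight β 2 = (β ^ 2 + 3 * β + 2) / 12 * (β * (β - 1) / 2) - (4 - β ^ 2) / 6 * β
      + (β ^ 2 - 3 * β + 2) / 12 := by
  simp only [weight, zero_add, grunwald_zero, grunwald_one, grunwald_two]
  ring

lemma weight_zero_add_weight_two_nonneg {β : ℝ} (h₁ : 1 ≤ β) :
    0 ≤ weight β 0 + weight β 2 := by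
  rw [weight_zero, weight_two]
  obtain ⟨x, rfl⟩ : ∃ x, β = 1 + x := ⟨β - 1, by ring⟩
  have hx : 0 ≤ x := by linarith
  have : 0 ≤ (x ^ 4 + 10 * x ^ 3 + 27 * x ^ 2 + 10 * x) / 24 := by positivity
  refine this.trans (le_of_eq ?_)
  ring

lemma weight_add_three_nonneg {β : ℝ} (h₁ : 1 ≤ β) (h₂ : β ≤ 2) (k : ℕ) :
    0 ≤ weight β (k + 3) := by
  have hl1 : 0 ≤ (β ^ 2 + 3 * β + 2) / 12 := by positivity
  have hl0 : 0 ≤ (4 - β ^ 2) / 6 := by nlinarith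
  rcases k with _ | k
  · have h1 := grunwald_add_two_nonneg h₁ h₂ 1
    have h2 := grunwald_add_two_nonneg h₁ h₂ 0
    simp only [weight, zero_add, Nat.reduceAdd, grunwald_one] at *
    have : 0 ≤ (β ^ 2 - 3 * β + 2) / 12 * -β := by
      have := mul_nonneg (mul_nonneg (sub_nonneg.2 h₁) (sub_nonneg.2 h₂))
        (zero_le_one.trans h₁)
      linarith
    have := mul_nonneg hl1 h1
    have := mul_nonneg hl0 h2
    linarith
  · have hg := grunwald_add_two_nonneg h₁ h₂ k
    have e3 : grunwald β (k + 3) = grunwald β (k + 2) * ((k + 2 - β) / (k + 3)) := by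
      rw [grunwald_succ β (k + 2)]; push_cast; ring_nf
    have e4 : grunwald β (k + 4) = grunwald β (k + 2) * ((k + 2 - β) / (k + 3))
        * ((k + 3 - β) / (k + 4)) := by
      rw [grunwald_succ β (k + 3), e3]; push_cast; ring_nf
    have hk : (0 : ℝ) ≤ k := by positivity
    have hw : weight β (k + 1 + 3) = grunwald β (k + 2) *
        (12 * k ^ 2 + (72 - 18 * β - 6 * β ^ 2) * k + ((2 - β) * (β + 5)) ^ 2)
          / (12 * (k + 3) * (k + 4)) := by
      rw [show k + 1 + 3 = (k + 2) + 2 by ring, weight, show k + 2 + 2 = k + 4 by ring,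
        show k + 2 + 1 = k + 3 by ring, e4, e3]
      field_simp
      ring
    rw [hw]
    have : 0 ≤ (72 - 18 * β - 6 * β ^ 2) * k := mul_nonneg (by nlinarith) hk
    positivity

lemma sum_weight (β : ℝ) (n : ℕ) :
    ∑ k ∈ Finset.range (n + 3), weight β k
      = (β ^ 2 + 3 * β + 2) / 12 * grunwald (β - 1) (n + 2)
        + (4 - β ^ 2) / 6 * grunwald (β - 1) (n + 1)
        + (β ^ 2 - 3 * β + 2) / 12 * grunwald (β - 1) n := by
  induction n with
  | zero =>
    simp only [zero_add, Finset.sum_range_succ, Finset.sum_range_zero, weight_zero, weight_one,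
      weight_two, grunwald_zero, grunwald_one, grunwald_two]
    ring
  | succ n ih =>
    rw [show n + 1 + 3 = n + 3 + 1 by ring, Finset.sum_range_succ, ih,
      show n + 3 = n + 1 + 2 by ring, weight, grunwald_succ_eq_sub β (n + 1 + 1),
      grunwald_succ_eq_sub β (n + 1), grunwald_succ_eq_sub β n]
    ring

lemma sum_weight_nonpos {β : ℝ} (h₁ : 1 ≤ β) (h₂ : β ≤ 2) (n : ℕ) :
    ∑ k ∈ Finset.range (n + 3), weight β k ≤ 0 := by
  rw [sum_weight]
  rcases n with _ | n
  · simp only [zero_add, grunwald_zero, grunwald_one, grunwald_two]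
    have h3 : 0 ≤ (β - 1) * ((β ^ 2 + 3 * β + 2) / 12 * ((2 - β) / 2) + (4 - β ^ 2) / 6
        + (2 - β) / 12) := by
      refine mul_nonneg (by linarith) (add_nonneg (add_nonneg (mul_nonneg (by positivity) ?_) ?_) ?_)
      · linarith
      · nlinarith
      · linarith
    linarith
  · have hg := grunwald_sub_one_succ_nonpos h₁ h₂ n
    have hk : (0 : ℝ) ≤ n := by positivity
    have e2 : grunwald (β - 1) (n + 2) = grunwald (β - 1) (n + 1) * ((n + 2 - β) / (n + 2)) := by
      rw [grunwald_succ (β - 1) (n + 1)]; push_cast; ring_nf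
    have e3 : grunwald (β - 1) (n + 3) = grunwald (β - 1) (n + 1) * ((n + 2 - β) / (n + 2))
        * ((n + 3 - β) / (n + 3)) := by
      rw [grunwald_succ (β - 1) (n + 2), e2]; push_cast; ring_nf
    rw [show n + 1 + 2 = n + 3 by ring, show n + 1 + 1 = n + 2 by ring, e3, e2]
    have hw : (β ^ 2 + 3 * β + 2) / 12 * (grunwald (β - 1) (n + 1) * ((n + 2 - β) / (n + 2))
          * ((n + 3 - β) / (n + 3)))
        + (4 - β ^ 2) / 6 * (grunwald (β - 1) (n + 1) * ((n + 2 - β) / (n + 2)))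
        + (β ^ 2 - 3 * β + 2) / 12 * grunwald (β - 1) (n + 1)
        = grunwald (β - 1) (n + 1) *
          ((12 * n ^ 2 + (60 - 12 * β - 6 * β ^ 2) * n
            + (2 - β) * (36 + β - 6 * β ^ 2 - β ^ 3)) / (12 * (n + 2) * (n + 3))) := by
      field_simp
      ring
    rw [hw]
    refine mul_nonpos_of_nonpos_of_nonneg hg (div_nonneg ?_ (by positivity))
    have h5 : 0 ≤ (60 - 12 * β - 6 * β ^ 2) * n := mul_nonneg (by nlinarith) hk
    have h6 : 0 ≤ (2 - β) * (36 + β - 6 * β ^ 2 - β ^ 3) := by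
      refine mul_nonneg (by linarith) ?_
      nlinarith [mul_nonneg (by linarith : (0 : ℝ) ≤ 2 - β) (by linarith : (0:ℝ) ≤ β),
        mul_nonneg (mul_nonneg (by linarith : (0 : ℝ) ≤ 2 - β) (by linarith : (0:ℝ) ≤ β))
          (by linarith : (0:ℝ) ≤ β)]
    positivity

/-! ### Negative semidefiniteness of the spatial operators -/

section QuadraticForm

variable {z : ℤ → ℝ}

lemma summable_mul_shift (hz : z.support.Finite) (m : ℤ) : Summable fun n => z n * z (n + m) := by
  refine summable_of_hasFiniteSupport (hz.subset ?_)
  intro n hn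
  simp only [Function.mem_support] at hn ⊢
  exact left_ne_zero_of_mul hn

lemma summable_shift_sq (hz : z.support.Finite) (m : ℤ) : Summable fun n => z (n + m) * z (n + m) := by
  have := summable_mul_shift hz 0
  simp only [add_zero] at this
  exact ((Equiv.addRight m).summable_iff (f := fun n => z n * z n)).2 this

lemma tsum_mul_shift_le (hz : z.support.Finite) (m : ℤ) :
    ∑' n, z n * z (n + m) ≤ ∑' n, z n * z n := by
  have h1 := summable_mul_shift hz m
  have h2 := summable_shift_sq hz m
  have h3 : Summable fun n => z n * z n := by simpa using summable_mul_shift hz 0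
  have h4 : ∑' n, z (n + m) * z (n + m) = ∑' n, z n * z n :=
    (Equiv.addRight m).tsum_eq (fun n => z n * z n)
  calc ∑' n, z n * z (n + m) ≤ ∑' n, (1 / 2 * (z n * z n) + 1 / 2 * (z (n + m) * z (n + m))) := by
        refine h1.tsum_le_tsum (fun n => ?_) ((h3.mul_left _).add (h2.mul_left _))
        nlinarith [sq_nonneg (z n - z (n + m))]
    _ = ∑' n, z n * z n := by
        rw [(h3.mul_left _).tsum_add (h2.mul_left _), tsum_mul_left, tsum_mul_left, h4]
        ring

lemma tsum_mul_shift_neg (m : ℤ) :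
    ∑' n, z n * z (n + -m) = ∑' n, z n * z (n + m) := by
  rw [← (Equiv.addRight m).tsum_eq]
  refine tsum_congr fun n => ?_
  simp [mul_comm]

lemma sum_weight_mul_shift_nonpos {β : ℝ} (h₁ : 1 ≤ β) (h₂ : β ≤ 2) (hz : z.support.Finite) (n : ℕ) :
    ∑ k ∈ Finset.range (n + 3), weight β k * ∑' m, z m * z (m + (1 - k)) ≤ 0 := by
  set S := ∑' m, z m * z m with hS
  have hS0 : 0 ≤ S := tsum_nonneg fun m => mul_self_nonneg _
  have hw : ∑ k ∈ Finset.range (n + 3), weight β k * ∑' m, z m * z (m + (1 - k))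
      ≤ (∑ k ∈ Finset.range (n + 3), weight β k) * S := by
    rw [add_comm n 3, Finset.sum_range_add, Finset.sum_range_add, add_mul]
    refine add_le_add ?_ ?_
    · simp only [Finset.sum_range_succ, Finset.sum_range_zero]
      have h0 := tsum_mul_shift_le hz 1
      have h3 := tsum_mul_shift_neg (z := z) 1
      have h4 := mul_le_mul_of_nonneg_left h0 (weight_zero_add_weight_two_nonneg h₁)
      norm_num at *
      rw [h3, ← hS]
      linarith
    · rw [Finset.sum_mul]
      refine Finset.sum_le_sum fun k _ => ?_
      have := weight_add_three_nonneg h₁ h₂ k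
      rw [add_comm] at this
      exact mul_le_mul_of_nonneg_left (tsum_mul_shift_le hz _) this
  exact hw.trans (mul_nonpos_of_nonpos_of_nonneg (sum_weight_nonpos h₁ h₂ n) hS0)

end QuadraticForm

lemma left_quadratic_form_nonpos {β : ℝ} (h₁ : 1 ≤ β) (h₂ : β ≤ 2) {N : ℕ} (v : ℕ → ℝ)
    (h0 : v 0 = 0) (hN : v N = 0) :
    ∑ i ∈ Finset.Ico 1 N, v i * ∑ k ∈ Finset.range (i + 2), weight β k * v (i + 1 - k) ≤ 0 := by
  set z : ℤ → ℝ := fun n => if 1 ≤ n ∧ n < N then v n.toNat else 0 with hzdef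
  have hsupp : z.support ⊆ (Finset.Ico (1 : ℤ) N : Set ℤ) := by
    intro n hn
    by_contra hc
    simp only [Finset.coe_Ico, mem_Ico] at hc
    simp [hzdef, hc] at hn
  have hfin : z.support.Finite := (Finset.finite_toSet _).subset hsupp
  have hzv : ∀ i : ℕ, i ≤ N → z i = v i := by
    intro i hi
    simp only [hzdef]
    by_cases h : 1 ≤ (i : ℤ) ∧ (i : ℤ) < N
    · rw [if_pos h]; simp
    · rw [if_neg h]
      have : i = 0 ∨ i = N := by omega
      rcases this with rfl | rfl
      · exact h0.symm
      · exact hN.symm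
  refine le_of_eq_of_le ?_ (sum_weight_mul_shift_nonpos h₁ h₂ hfin N)
  have hts : ∀ k : ℕ, ∑' m, z m * z (m + (1 - k))
      = ∑ i ∈ Finset.Ico 1 N, z (i : ℕ) * z ((i : ℕ) + (1 - k)) := by
    intro k
    rw [tsum_eq_sum (s := (Finset.Ico 1 N).map Nat.castEmbedding)]
    · rw [Finset.sum_map]; rfl
    · intro m hm
      have : z m = 0 := by
        by_contra hc
        have := hsupp hc
        simp only [Finset.coe_Ico, mem_Ico] at this
        apply hm
        simp only [Finset.mem_map, Finset.mem_Ico, Nat.castEmbedding_apply]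
        exact ⟨m.toNat, by omega, by omega⟩
      rw [this, zero_mul]
  simp only [hts, Finset.mul_sum]
  rw [Finset.sum_comm]
  refine Finset.sum_congr rfl fun i hi => ?_
  rw [Finset.mem_Ico] at hi
  have hsub : Finset.range (i + 2) ⊆ Finset.range (N + 3) :=
    Finset.range_subset_range.2 (by omega)
  rw [← Finset.sum_subset hsub]
  · refine Finset.sum_congr rfl fun k hk => ?_
    rw [Finset.mem_range] at hk
    have e : ((i : ℕ) : ℤ) + (1 - k) = ((i + 1 - k : ℕ) : ℤ) := by omega
    rw [e, hzv i hi.2.le]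
    rcases Nat.eq_zero_or_pos k with rfl | hk0
    · rw [hzv _ (by omega)]; ring
    · rw [hzv _ (by omega)]; ring
  · intro k _ hk
    rw [Finset.mem_range] at hk
    have : z ((i : ℕ) + (1 - k)) = 0 := by
      simp only [hzdef]
      rw [if_neg (by omega)]
    rw [this]
    ring

lemma right_sum_eq_left_sum_reflect (β : ℝ) {N i : ℕ} (hi : i < N) (hi₁ : 1 ≤ i) (v : ℕ → ℝ) :
    ∑ k ∈ Finset.range (N - i + 2), weight β k * v (i + k - 1)
      = ∑ k ∈ Finset.range (N - i + 2), weight β k * v (N - (N - i + 1 - k)) := by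
  refine Finset.sum_congr rfl fun k hk => ?_
  rw [Finset.mem_range] at hk
  congr 2
  omega

lemma right_quadratic_form_nonpos {β : ℝ} (h₁ : 1 ≤ β) (h₂ : β ≤ 2) {N : ℕ} (v : ℕ → ℝ)
    (h0 : v 0 = 0) (hN : v N = 0) :
    ∑ i ∈ Finset.Ico 1 N, v i * ∑ k ∈ Finset.range (N - i + 2), weight β k * v (i + k - 1)
      ≤ 0 := by
  have h := left_quadratic_form_nonpos h₁ h₂ (N := N) (fun n => v (N - n)) (by simpa using hN)
    (by simpa using h0)
  refine le_of_eq_of_le ?_ h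
  refine Finset.sum_bij' (fun i _ => N - i) (fun i _ => N - i) ?_ ?_ ?_ ?_ ?_
  · intro i hi; rw [Finset.mem_Ico] at *; omega
  · intro i hi; rw [Finset.mem_Ico] at *; omega
  · intro i hi; rw [Finset.mem_Ico] at *; omega
  · intro i hi; rw [Finset.mem_Ico] at *; omega
  · intro i hi
    rw [Finset.mem_Ico] at hi
    rw [right_sum_eq_left_sum_reflect β hi.2 hi.1, show N - (N - i) = i by omega]

lemma advection_form_eq_zero {N : ℕ} (v : ℕ → ℝ) (h0 : v 0 = 0) (hN : v N = 0) :
    ∑ i ∈ Finset.Ico 1 N, v i * (v (i + 1) - v (i - 1)) = 0 := by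
  rcases N with _ | N
  · simp
  have h : ∀ n, ∑ i ∈ Finset.Ico 1 (n + 1), v i * (v (i + 1) - v (i - 1)) = v n * v (n + 1) := by
    intro n
    induction n with
    | zero => simp [h0]
    | succ n ih =>
      rw [Finset.sum_Ico_succ_top (by omega), ih]
      simp only [Nat.add_sub_cancel]
      ring
  rw [h, hN, mul_zero]

lemma discreteSpace_form_nonpos {β h g p q : ℝ} (h₁ : 1 ≤ β) (h₂ : β ≤ 2) (hh : 0 < h)
    (hp : 0 ≤ p) (hq : 0 ≤ q) {N : ℕ} (v : ℕ → ℝ) (h0 : v 0 = 0) (hN : v N = 0) :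
    ∑ i ∈ Finset.Ico 1 N, v i * discreteSpace β h N g p q v i ≤ 0 := by
  have e : ∑ i ∈ Finset.Ico 1 N, v i * discreteSpace β h N g p q v i
      = g / (2 * h) * ∑ i ∈ Finset.Ico 1 N, v i * (v (i + 1) - v (i - 1))
        + p / h ^ β * ∑ i ∈ Finset.Ico 1 N,
          v i * ∑ k ∈ Finset.range (i + 2), weight β k * v (i + 1 - k)
        + q / h ^ β * ∑ i ∈ Finset.Ico 1 N,
          v i * ∑ k ∈ Finset.range (N - i + 2), weight β k * v (i + k - 1) := by
    rw [Finset.mul_sum, Finset.mul_sum, Finset.mul_sum, ← Finset.sum_add_distrib,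
      ← Finset.sum_add_distrib]
    refine Finset.sum_congr rfl fun i _ => ?_
    simp only [discreteSpace]
    ring
  rw [e, advection_form_eq_zero v h0 hN, mul_zero, zero_add]
  have hhβ : 0 < h ^ β := Real.rpow_pos_of_pos hh _
  exact add_nonpos
    (mul_nonpos_of_nonneg_of_nonpos (by positivity) (left_quadratic_form_nonpos h₁ h₂ v h0 hN))
    (mul_nonpos_of_nonneg_of_nonpos (by positivity) (right_quadratic_form_nonpos h₁ h₂ v h0 hN))

/-! ### Stability of the scheme -/

lemma discreteCaputo_const_mul_sum (α σ τ h : ℝ) (j : ℕ) (s : Finset ℕ) (w : ℕ → ℕ → ℝ) :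
    discreteCaputo α σ τ j (fun n => h * ∑ i ∈ s, w n i)
      = h * ∑ i ∈ s, discreteCaputo α σ τ j (fun n => w n i) := by
  simp only [discreteCaputo, ← Finset.mul_sum]
  rw [Finset.sum_comm, mul_left_comm]
  congr 1
  rw [Finset.mul_sum]
  refine Finset.sum_congr rfl fun n _ => ?_
  rw [← Finset.mul_sum, Finset.sum_sub_distrib]
  ring

lemma scheme_stability {α T : ℝ} (hα₀ : 0 < α) (hα₁ : α ≤ 1) (hT : 0 < T) :
    ∃ K : ℝ, 0 < K ∧ ∀ (β h ρ : ℝ) (N M : ℕ) (g p q : ℕ → ℝ) (E R : ℕ → ℕ → ℝ),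
      1 ≤ β → β ≤ 2 → 0 < h → 0 < M → 0 ≤ ρ →
      (∀ j < M, 0 ≤ p j) → (∀ j < M, 0 ≤ q j) →
      (∀ j ≤ M, E j 0 = 0 ∧ E j N = 0) → (∀ i, 1 ≤ i → i < N → E 0 i = 0) →
      (∀ i j, 1 ≤ i → i < N → j < M →
        discreteCaputo α (1 - α / 2) (T / M) j (fun s => E s i)
          = discreteSpace β h N (g j) (p j) (q j)
            (fun l => (1 - α / 2) * E (j + 1) l + (1 - (1 - α / 2)) * E j l) i + R j i) →
      (∀ i j, 1 ≤ i → i < N → j < M → |R j i| ≤ ρ) →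
      ∀ j ≤ M, h * ∑ i ∈ Finset.Ico 1 N, E j i ^ 2 ≤ K * (h * N * ρ ^ 2) := by
  obtain ⟨K, hK, hgron⟩ := discreteCaputo_gronwall hα₀ hα₁ hT
  refine ⟨4 * K ^ 2, by positivity, ?_⟩
  intro β h ρ N M g p q E R hβ₁ hβ₂ hh hM hρ hp hq hbd hinit heq hR
  set e : ℕ → ℝ := fun j => h * ∑ i ∈ Finset.Ico 1 N, E j i ^ 2 with he
  have he0 : ∀ j, 0 ≤ e j := fun j =>
    mul_nonneg hh.le (Finset.sum_nonneg fun i _ => sq_nonneg _)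
  obtain ⟨J, hJmem, hJ⟩ := Finset.exists_max_image (Finset.range (M + 1)) e ⟨0, by simp⟩
  have hJ' : ∀ j ≤ M, e j ≤ e J := fun j hj => hJ j (by simpa [Nat.lt_succ_iff] using hj)
  rw [Finset.mem_range] at hJmem
  have hM' : (0 : ℝ) < M := by exact_mod_cast hM
  have hσ₀ : 0 ≤ 1 - α / 2 := by linarith
  have hσ₁ : 0 ≤ 1 - (1 - α / 2) := by linarith
  have hdisc : ∀ j < M, discreteCaputo α (1 - α / 2) (T / M) j e
      ≤ 2 * K * (h * N * ρ ^ 2) + e J / (2 * K) := by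
    intro j hj
    set W : ℕ → ℝ := fun l => (1 - α / 2) * E (j + 1) l + (1 - (1 - α / 2)) * E j l with hW
    have hWsq : ∀ l, W l ^ 2 ≤ (1 - α / 2) * E (j + 1) l ^ 2 + (1 - (1 - α / 2)) * E j l ^ 2 := by
      intro l
      have : 0 ≤ (1 - α / 2) * (1 - (1 - α / 2)) * (E (j + 1) l - E j l) ^ 2 := by positivity
      simp only [hW]
      nlinarith
    have hWsum : h * ∑ i ∈ Finset.Ico 1 N, W i ^ 2 ≤ e J := by
      calc h * ∑ i ∈ Finset.Ico 1 N, W i ^ 2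
          ≤ h * ∑ i ∈ Finset.Ico 1 N,
            ((1 - α / 2) * E (j + 1) i ^ 2 + (1 - (1 - α / 2)) * E j i ^ 2) := by
            gcongr with i _
            exact hWsq i
        _ = (1 - α / 2) * e (j + 1) + (1 - (1 - α / 2)) * e j := by
            rw [Finset.sum_add_distrib, ← Finset.mul_sum, ← Finset.mul_sum]
            simp only [he]
            ring
        _ ≤ (1 - α / 2) * e J + (1 - (1 - α / 2)) * e J := by
            gcongr
            · exact hJ' _ hj
            · exact hJ' _ hj.le
        _ = e J := by ring
    have hform := discreteSpace_form_nonpos (g := g j) hβ₁ hβ₂ hh (hp j hj) (hq j hj) W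
      (by simp [hW, (hbd j hj.le).1, (hbd (j + 1) hj).1])
      (by simp [hW, (hbd j hj.le).2, (hbd (j + 1) hj).2]) (N := N)
    have hpt : ∀ i ∈ Finset.Ico 1 N,
        1 / 2 * discreteCaputo α (1 - α / 2) (T / M) j (fun s => E s i ^ 2)
          ≤ W i * discreteSpace β h N (g j) (p j) (q j) W i
            + (K * ρ ^ 2 + W i ^ 2 / (4 * K)) := by
      intro i hi
      rw [Finset.mem_Ico] at hi
      have h1 := discreteCaputo_energy hα₀ hα₁ (τ := T / M) (by positivity) j (fun s => E s i)
      rw [heq i j hi.1 hi.2 hj] at h1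
      have h2 : W i * R j i ≤ K * ρ ^ 2 + W i ^ 2 / (4 * K) := by
        have h3 : R j i ^ 2 ≤ ρ ^ 2 := sq_le_sq' (by linarith [(abs_le.1 (hR i j hi.1 hi.2 hj)).1])
          (abs_le.1 (hR i j hi.1 hi.2 hj)).2
        have h4 : 0 ≤ (2 * K * R j i - W i) ^ 2 / (4 * K) := by positivity
        have h5 : (2 * K * R j i - W i) ^ 2 / (4 * K)
            = K * R j i ^ 2 - W i * R j i + W i ^ 2 / (4 * K) := by
          field_simp
          ring
        nlinarith
      refine h1.trans ?_
      change W i * (discreteSpace β h N (g j) (p j) (q j) W i + R j i) ≤ _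
      rw [mul_add]
      linarith
    have hsum := Finset.sum_le_sum hpt
    rw [Finset.sum_add_distrib, Finset.sum_add_distrib, ← Finset.mul_sum, ← Finset.sum_div,
      Finset.sum_const, Nat.card_Ico, nsmul_eq_mul] at hsum
    have hcard : ((N - 1 : ℕ) : ℝ) * (K * ρ ^ 2) ≤ N * (K * ρ ^ 2) := by
      gcongr
      omega
    simp only [he]
    rw [discreteCaputo_const_mul_sum]
    have h6 : ∑ i ∈ Finset.Ico 1 N, discreteCaputo α (1 - α / 2) (T / M) j (fun s => E s i ^ 2)
        ≤ 2 * (N * (K * ρ ^ 2)) + (∑ i ∈ Finset.Ico 1 N, W i ^ 2) / (2 * K) := by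
      have : (∑ i ∈ Finset.Ico 1 N, W i ^ 2) / (2 * K)
          = 2 * ((∑ i ∈ Finset.Ico 1 N, W i ^ 2) / (4 * K)) := by
        field_simp
        ring
      linarith
    calc _ ≤ h * (2 * (N * (K * ρ ^ 2)) + (∑ i ∈ Finset.Ico 1 N, W i ^ 2) / (2 * K)) := by gcongr
      _ = 2 * K * (h * N * ρ ^ 2) + (h * ∑ i ∈ Finset.Ico 1 N, W i ^ 2) / (2 * K) := by ring
      _ ≤ _ := by gcongr
  have hinit' : e 0 = 0 := by
    simp only [he]
    rw [Finset.sum_eq_zero, mul_zero]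
    intro i hi
    rw [Finset.mem_Ico] at hi
    simp [hinit i hi.1 hi.2]
  have hmax := hgron M hM e _ hinit'
    (add_nonneg (by positivity) (div_nonneg (he0 J) (by positivity))) hdisc J (by omega)
  have h7 : K * (2 * K * (h * N * ρ ^ 2) + e J / (2 * K))
      = 2 * K ^ 2 * (h * N * ρ ^ 2) + e J / 2 := by
    field_simp
  intro j hj
  have := hJ' j hj
  simp only [he] at *
  linarith

/-! ### Taylor estimates -/

lemma abs_sub_le_of_abs_deriv_le_pow {s : Set ℝ} (hs : Convex ℝ s) {f f' : ℝ → ℝ} {x y B : ℝ}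
    (hB : 0 ≤ B) {n : ℕ} (hx : x ∈ s) (hy : y ∈ s)
    (hf : ∀ z ∈ s, HasDerivWithinAt f (f' z) s z) (hb : ∀ z ∈ s, |f' z| ≤ B * |z - x| ^ n) :
    |f y - f x| ≤ B * |y - x| ^ (n + 1) := by
  have hsub : uIcc x y ⊆ s := hs.ordConnected.uIcc_subset hx hy
  have := (convex_uIcc x y).norm_image_sub_le_of_norm_hasDerivWithin_le (f := f) (f' := f')
    (C := B * |y - x| ^ n) (fun z hz => (hf z (hsub hz)).mono hsub) (fun z hz => ?_)
    left_mem_uIcc right_mem_uIcc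
  · rw [Real.norm_eq_abs, Real.norm_eq_abs] at this
    rw [pow_succ, ← mul_assoc]
    exact this
  · refine (hb z (hsub hz)).trans ?_
    have := abs_sub_left_of_mem_uIcc hz
    gcongr

lemma taylor_one {s : Set ℝ} (hs : Convex ℝ s) {f f₁ : ℝ → ℝ} {x y B : ℝ}
    (hB : 0 ≤ B) (hx : x ∈ s) (hy : y ∈ s)
    (hf : ∀ z ∈ s, HasDerivWithinAt f (f₁ z) s z) (hb : ∀ z ∈ s, |f₁ z - f₁ x| ≤ B * |z - x|) :
    |f y - f x - (y - x) * f₁ x| ≤ B * |y - x| ^ 2 := by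
  have := abs_sub_le_of_abs_deriv_le_pow hs (f := fun z => f z - (z - x) * f₁ x)
    (f' := fun z => f₁ z - f₁ x) (n := 1) hB hx hy
    (fun z hz => by
      simpa using (hf z hz).fun_sub (((hasDerivWithinAt_id z s).sub_const x).mul_const (f₁ x)))
    (fun z hz => by simpa using hb z hz)
  convert this using 2
  ring

lemma taylor_two {s : Set ℝ} (hs : Convex ℝ s) {f f₁ f₂ : ℝ → ℝ} {x y B : ℝ}
    (hB : 0 ≤ B) (hx : x ∈ s) (hy : y ∈ s)
    (hf : ∀ z ∈ s, HasDerivWithinAt f (f₁ z) s z) (hf₁ : ∀ z ∈ s, HasDerivWithinAt f₁ (f₂ z) s z)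
    (hb : ∀ z ∈ s, |f₂ z - f₂ x| ≤ B * |z - x|) :
    |f y - f x - (y - x) * f₁ x - (y - x) ^ 2 / 2 * f₂ x| ≤ B * |y - x| ^ 3 := by
  have := abs_sub_le_of_abs_deriv_le_pow hs
    (f := fun z => f z - (z - x) * f₁ x - (z - x) ^ 2 / 2 * f₂ x)
    (f' := fun z => f₁ z - f₁ x - (z - x) * f₂ x) (n := 2) hB hx hy
    (fun z hz => by
      have h1 := ((hasDerivWithinAt_id z s).sub_const x)
      have h2 := ((hf z hz).fun_sub (h1.mul_const (f₁ x))).fun_sub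
        (((h1.fun_pow 2).div_const 2).mul_const (f₂ x))
      refine h2.congr_deriv ?_
      simp)
    (fun z hz => taylor_one hs hB hx hz hf₁ hb)
  convert this using 2
  ring

lemma taylor_three {s : Set ℝ} (hs : Convex ℝ s) {f f₁ f₂ f₃ : ℝ → ℝ} {x y B : ℝ}
    (hB : 0 ≤ B) (hx : x ∈ s) (hy : y ∈ s)
    (hf : ∀ z ∈ s, HasDerivWithinAt f (f₁ z) s z) (hf₁ : ∀ z ∈ s, HasDerivWithinAt f₁ (f₂ z) s z)
    (hf₂ : ∀ z ∈ s, HasDerivWithinAt f₂ (f₃ z) s z)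
    (hb : ∀ z ∈ s, |f₃ z - f₃ x| ≤ B * |z - x|) :
    |f y - f x - (y - x) * f₁ x - (y - x) ^ 2 / 2 * f₂ x - (y - x) ^ 3 / 6 * f₃ x|
      ≤ B * |y - x| ^ 4 := by
  have := abs_sub_le_of_abs_deriv_le_pow hs
    (f := fun z => f z - (z - x) * f₁ x - (z - x) ^ 2 / 2 * f₂ x - (z - x) ^ 3 / 6 * f₃ x)
    (f' := fun z => f₁ z - f₁ x - (z - x) * f₂ x - (z - x) ^ 2 / 2 * f₃ x) (n := 3) hB hx hy
    (fun z hz => by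
      have h1 := ((hasDerivWithinAt_id z s).sub_const x)
      have h2 := (((hf z hz).fun_sub (h1.mul_const (f₁ x))).fun_sub
        (((h1.fun_pow 2).div_const 2).mul_const (f₂ x))).fun_sub
        (((h1.fun_pow 3).div_const 6).mul_const (f₃ x))
      refine h2.congr_deriv ?_
      simp only [id]
      push_cast
      ring)
    (fun z hz => taylor_two hs hB hx hz hf₁ hf₂ hb)
  convert this using 2
  ring

lemma abs_second_difference_sub_le {s : Set ℝ} (hs : Convex ℝ s) {f f₁ f₂ f₃ : ℝ → ℝ} {x h B : ℝ}
    (hB : 0 ≤ B) (hx : x ∈ s) (hx₁ : x + h ∈ s) (hx₂ : x - h ∈ s)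
    (hf : ∀ z ∈ s, HasDerivWithinAt f (f₁ z) s z) (hf₁ : ∀ z ∈ s, HasDerivWithinAt f₁ (f₂ z) s z)
    (hf₂ : ∀ z ∈ s, HasDerivWithinAt f₂ (f₃ z) s z)
    (hb : ∀ z ∈ s, |f₃ z - f₃ x| ≤ B * |z - x|) :
    |f (x + h) - 2 * f x + f (x - h) - h ^ 2 * f₂ x| ≤ 2 * B * |h| ^ 4 := by
  have h1 := taylor_three hs hB hx hx₁ hf hf₁ hf₂ hb
  have h2 := taylor_three hs hB hx hx₂ hf hf₁ hf₂ hb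
  rw [show x + h - x = h by ring] at h1
  rw [show x - h - x = -h by ring, abs_neg] at h2
  have h3 := abs_add_le (f (x + h) - f x - h * f₁ x - h ^ 2 / 2 * f₂ x - h ^ 3 / 6 * f₃ x)
    (f (x - h) - f x - -h * f₁ x - (-h) ^ 2 / 2 * f₂ x - (-h) ^ 3 / 6 * f₃ x)
  refine le_trans (le_of_eq ?_) (h3.trans (by linarith))
  congr 1
  ring

lemma abs_central_difference_sub_le {s : Set ℝ} (hs : Convex ℝ s) {f f₁ f₂ : ℝ → ℝ} {x h B : ℝ}
    (hB : 0 ≤ B) (hh : 0 < h) (hx : x ∈ s) (hx₁ : x + h ∈ s) (hx₂ : x - h ∈ s)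
    (hf : ∀ z ∈ s, HasDerivWithinAt f (f₁ z) s z) (hf₁ : ∀ z ∈ s, HasDerivWithinAt f₁ (f₂ z) s z)
    (hb : ∀ z ∈ s, |f₂ z - f₂ x| ≤ B * |z - x|) :
    |(f (x + h) - f (x - h)) / (2 * h) - f₁ x| ≤ B * h ^ 2 := by
  have h1 := taylor_two hs hB hx hx₁ hf hf₁ hb
  have h2 := taylor_two hs hB hx hx₂ hf hf₁ hb
  rw [show x + h - x = h by ring, abs_of_pos hh] at h1
  rw [show x - h - x = -h by ring, abs_neg, abs_of_pos hh] at h2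
  have h3 := abs_sub (f (x + h) - f x - h * f₁ x - h ^ 2 / 2 * f₂ x)
    (f (x - h) - f x - -h * f₁ x - (-h) ^ 2 / 2 * f₂ x)
  have e : (f (x + h) - f (x - h)) / (2 * h) - f₁ x
      = ((f (x + h) - f x - h * f₁ x - h ^ 2 / 2 * f₂ x)
        - (f (x - h) - f x - -h * f₁ x - (-h) ^ 2 / 2 * f₂ x)) / (2 * h) := by
    field_simp
    ring
  rw [e, abs_div, abs_of_pos (by positivity : 0 < 2 * h), div_le_iff₀ (by positivity)]
  refine h3.trans ?_
  nlinarith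

lemma abs_linear_interpolation_sub_le {s : Set ℝ} (hs : Convex ℝ s) {f f₁ : ℝ → ℝ} {p τ θ B : ℝ}
    (hB : 0 ≤ B) (hθ₀ : 0 ≤ θ) (hθ₁ : θ ≤ 1) (hp : p ∈ s) (hp₁ : p + τ ∈ s)
    (hf : ∀ z ∈ s, HasDerivWithinAt f (f₁ z) s z)
    (hb : ∀ z ∈ s, ∀ w ∈ s, |f₁ z - f₁ w| ≤ B * |z - w|) :
    |θ * f (p + τ) + (1 - θ) * f p - f (p + θ * τ)| ≤ B * τ ^ 2 := by
  have hm : p + θ * τ ∈ s := by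
    have := hs hp hp₁ (by linarith : 0 ≤ 1 - θ) hθ₀ (by ring)
    simp only [smul_eq_mul] at this
    convert this using 1
    ring
  have h1 := taylor_one hs hB hm hp₁ hf fun z hz => hb z hz _ hm
  have h2 := taylor_one hs hB hm hp hf fun z hz => hb z hz _ hm
  rw [sq_abs, show p + τ - (p + θ * τ) = (1 - θ) * τ by ring] at h1
  rw [sq_abs, show p - (p + θ * τ) = -(θ * τ) by ring] at h2
  have e : θ * f (p + τ) + (1 - θ) * f p - f (p + θ * τ)
      = θ * (f (p + τ) - f (p + θ * τ) - (1 - θ) * τ * f₁ (p + θ * τ))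
        + (1 - θ) * (f p - f (p + θ * τ) - -(θ * τ) * f₁ (p + θ * τ)) := by ring
  rw [e]
  refine (abs_add_le _ _).trans ?_
  rw [abs_mul, abs_mul, abs_of_nonneg hθ₀, abs_of_nonneg (by linarith : 0 ≤ 1 - θ)]
  have h3 := mul_le_mul_of_nonneg_left h1 hθ₀
  have h4 := mul_le_mul_of_nonneg_left h2 (by linarith : 0 ≤ 1 - θ)
  have h5 : θ * (B * ((1 - θ) * τ) ^ 2) + (1 - θ) * (B * (-(θ * τ)) ^ 2)
      = θ * (1 - θ) * (B * τ ^ 2) := by ring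
  have h6 : 0 ≤ B * τ ^ 2 := by positivity
  have h7 : θ * (1 - θ) ≤ 1 := by nlinarith
  nlinarith

/-! ### Truncation error of the discrete Caputo derivative -/

lemma discreteCaputo_sum_eq (α σ : ℝ) (j : ℕ) (d : ℕ → ℝ) :
    ∑ s ∈ Finset.range (j + 1), coefC α σ j (j - s) * d s
      = coefA α σ 0 * d j + ∑ s ∈ Finset.range j,
        (coefA α σ (j - s) * d s + coefB α σ (j - s) * (d (s + 1) - d s)) := by
  rcases j with _ | j
  · simp [coefC]
  set A : ℕ → ℝ := fun s => (coefA α σ (j + 1 - s) - coefB α σ (j + 1 - s)) * d s with hA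
  set B : ℕ → ℝ := fun s => coefB α σ (j + 1 - s) * d (s + 1) with hB
  have e1 : ∑ s ∈ Finset.range (j + 1),
      (coefA α σ (j + 1 - s) * d s + coefB α σ (j + 1 - s) * (d (s + 1) - d s))
      = ∑ s ∈ Finset.range (j + 1), A s + ∑ s ∈ Finset.range (j + 1), B s := by
    rw [← Finset.sum_add_distrib]
    refine Finset.sum_congr rfl fun s _ => ?_
    simp only [hA, hB]
    ring
  rw [e1, Finset.sum_range_succ, Finset.sum_range_succ' (fun s => coefC α σ (j + 1) (j + 1 - s) * d s),
    Finset.sum_range_succ' A, Finset.sum_range_succ B]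
  have e2 : ∑ s ∈ Finset.range j, coefC α σ (j + 1) (j + 1 - (s + 1)) * d (s + 1)
      = ∑ s ∈ Finset.range j, A (s + 1) + ∑ s ∈ Finset.range j, B s := by
    rw [← Finset.sum_add_distrib]
    refine Finset.sum_congr rfl fun s hs => ?_
    rw [Finset.mem_range] at hs
    simp only [hA, hB, coefC]
    rw [if_neg (by omega), if_neg (by omega), if_neg (by omega),
      show j + 1 - (s + 1) + 1 = j + 1 - s by omega]
    ring
  rw [e2]
  simp only [hA, hB, Nat.sub_self, Nat.sub_zero, coefC_self_succ]
  have e3 : coefC α σ (j + 1) 0 = coefA α σ 0 + coefB α σ 1 := by simp [coefC]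
  rw [e3, show j + 1 - j = 1 by omega]
  ring

lemma intervalIntegrable_sub_rpow {α t x y : ℝ} (hα : α < 1) :
    IntervalIntegrable (fun ξ : ℝ => (t - ξ) ^ (-α)) volume x y := by
  have h := intervalIntegral.intervalIntegrable_rpow' (a := t - x) (b := t - y) (r := -α)
    (by linarith)
  simpa using h.comp_sub_left t

lemma integral_sub_rpow {α t : ℝ} (hα : α < 1) :
    ∫ ξ in (0 : ℝ)..t, (t - ξ) ^ (-α) = t ^ (1 - α) / (1 - α) := by
  rw [intervalIntegral.integral_comp_sub_left (fun y => y ^ (-α)), sub_self, sub_zero,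
    integral_rpow (Or.inl (by linarith)), Real.zero_rpow (by linarith), sub_zero,
    show -α + 1 = 1 - α by ring]

lemma integral_affine_full_cell {α σ τ A κ : ℝ} (hα : α < 1) (hσ : 0 < σ) (hτ : 0 < τ) (s m : ℕ) :
    ∫ ξ in (s * τ)..((s + 1 : ℕ) * τ),
        (A + κ * (ξ - s * τ - τ / 2)) * (((s : ℝ) + m + 1 + σ) * τ - ξ) ^ (-α)
      = τ ^ (1 - α) / (1 - α) * (A * coefA α σ (m + 1) + κ * τ * coefB α σ (m + 1)) := by
  have h1α : 1 - α ≠ 0 := by linarith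
  have hc : 0 < (m : ℝ) + σ := by positivity
  have hsub := intervalIntegral.integral_comp_sub_mul (a := 0) (b := 1)
    (fun ξ => (A + κ * (ξ - s * τ - τ / 2)) * (((s : ℝ) + m + 1 + σ) * τ - ξ) ^ (-α))
    hτ.ne' ((s + 1 : ℕ) * τ)
  rw [mul_one, mul_zero, sub_zero, show ((s + 1 : ℕ) : ℝ) * τ - τ = s * τ by push_cast; ring,
    smul_eq_mul] at hsub
  have hI1 : IntervalIntegrable (fun y : ℝ => ((m : ℝ) + σ + y) ^ (-α)) volume 0 1 := by
    refine ContinuousOn.intervalIntegrable ?_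
    rw [uIcc_of_le zero_le_one]
    exact continuousOn_shifted_rpow hc
  have hI2 : IntervalIntegrable (fun y : ℝ => (1 / 2 - y) * ((m : ℝ) + σ + y) ^ (-α)) volume 0 1 :=
    hI1.continuousOn_mul (by fun_prop)
  have hint : ∫ y in (0 : ℝ)..1, (A + κ * (((s + 1 : ℕ) : ℝ) * τ - τ * y - s * τ - τ / 2))
        * (((s : ℝ) + m + 1 + σ) * τ - (((s + 1 : ℕ) : ℝ) * τ - τ * y)) ^ (-α)
      = ∫ y in (0 : ℝ)..1, (τ ^ (-α) * A * ((m : ℝ) + σ + y) ^ (-α)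
        + τ ^ (-α) * (κ * τ) * ((1 / 2 - y) * ((m : ℝ) + σ + y) ^ (-α))) := by
    refine intervalIntegral.integral_congr fun y hy => ?_
    rw [uIcc_of_le zero_le_one] at hy
    have hy0 := hy.1
    rw [show ((s : ℝ) + m + 1 + σ) * τ - (((s + 1 : ℕ) : ℝ) * τ - τ * y)
        = τ * (m + σ + y) by push_cast; ring, Real.mul_rpow hτ.le (by positivity)]
    push_cast
    ring
  rw [hint, intervalIntegral.integral_add (hI1.const_mul _) (hI2.const_mul _),
    intervalIntegral.integral_const_mul, intervalIntegral.integral_const_mul] at hsub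
  rw [coefA_succ_eq_integral hσ, coefB_succ_eq_integral (by linarith) hσ,
    show 1 - α = 1 + -α by ring, Real.rpow_add hτ, Real.rpow_one]
  rw [← sub_eq_zero] at hsub ⊢
  have h1α' : 1 + -α ≠ 0 := by rwa [← sub_eq_add_neg]
  field_simp at hsub ⊢
  linarith

lemma integral_affine_last_cell {α τ A κ p : ℝ} (hα : α < 1) (hτ : 0 < τ) :
    ∫ ξ in p..(p + (1 - α / 2) * τ),
        (A + κ * (ξ - p - τ / 2)) * (p + (1 - α / 2) * τ - ξ) ^ (-α)
      = τ ^ (1 - α) / (1 - α) * (A * coefA α (1 - α / 2) 0) := by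
  have h1α : 1 - α ≠ 0 := by linarith
  have h2α : 2 - α ≠ 0 := by linarith
  set σ := 1 - α / 2 with hσdef
  have hσ : 0 < σ := by linarith
  have hsub := intervalIntegral.integral_comp_sub_left (a := p) (b := p + σ * τ)
    (fun y => (A + κ * (σ * τ - τ / 2 - y)) * y ^ (-α)) (p + σ * τ)
  rw [sub_self, add_sub_cancel_left] at hsub
  have e : ∀ ξ, (A + κ * (σ * τ - τ / 2 - (p + σ * τ - ξ))) * (p + σ * τ - ξ) ^ (-α)
      = (A + κ * (ξ - p - τ / 2)) * (p + σ * τ - ξ) ^ (-α) := by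
    intro ξ
    ring
  simp only [e] at hsub
  rw [hsub]
  have hst : 0 < σ * τ := by positivity
  have hI1 : IntervalIntegrable (fun y : ℝ => y ^ (-α)) volume 0 (σ * τ) :=
    intervalIntegral.intervalIntegrable_rpow' (by linarith)
  have hI2 : IntervalIntegrable (fun y : ℝ => y ^ (1 - α)) volume 0 (σ * τ) :=
    intervalIntegral.intervalIntegrable_rpow' (by linarith)
  have hint : ∫ y in (0 : ℝ)..(σ * τ), (A + κ * (σ * τ - τ / 2 - y)) * y ^ (-α)
      = ∫ y in (0 : ℝ)..(σ * τ), ((A + κ * (σ * τ - τ / 2)) * y ^ (-α) - κ * y ^ (1 - α)) := by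
    refine intervalIntegral.integral_congr_ae (Filter.Eventually.of_forall fun y hy => ?_)
    rw [uIoc_of_le hst.le] at hy
    rw [show 1 - α = 1 + -α by ring, Real.rpow_add hy.1, Real.rpow_one]
    ring
  have r1 : (σ * τ) ^ (-α + 1) = σ ^ (1 - α) * τ ^ (1 - α) := by
    rw [show -α + 1 = 1 - α by ring, Real.mul_rpow hσ.le hτ.le]
  have r2 : (σ * τ) ^ (1 - α + 1) = σ * τ * (σ ^ (1 - α) * τ ^ (1 - α)) := by
    rw [Real.rpow_add hst, Real.rpow_one, Real.mul_rpow hσ.le hτ.le, mul_comm]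
  rw [hint, intervalIntegral.integral_sub (hI1.const_mul _) (hI2.const_mul _),
    intervalIntegral.integral_const_mul, intervalIntegral.integral_const_mul,
    integral_rpow (Or.inl (by linarith)), integral_rpow (Or.inl (by linarith)),
    Real.zero_rpow (by linarith), Real.zero_rpow (by linarith), sub_zero, sub_zero, r1, r2,
    show 1 - α + 1 = 1 + (1 - α) by ring, show -α + 1 = 1 - α by ring]
  have e3 : coefA α σ 0 = σ ^ (1 - α) := by simp [coefA]
  rw [e3]
  have h3 : 1 + (1 - α) ≠ 0 := by linarith
  have h4 : σ * τ / (1 + (1 - α)) = τ / 2 := by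
    rw [hσdef]
    field_simp
    ring
  have h5 : κ * (σ * τ * (σ ^ (1 - α) * τ ^ (1 - α)) / (1 + (1 - α)))
      = κ * (σ ^ (1 - α) * τ ^ (1 - α)) * (τ / 2) := by
    rw [← h4]
    ring
  rw [h5]
  have h6 : (σ * τ - τ / 2) / (1 - α) = τ / 2 := by
    rw [hσdef]
    field_simp
    ring
  have h7 : (A + κ * (σ * τ - τ / 2)) * (σ ^ (1 - α) * τ ^ (1 - α) / (1 - α))
      = A * (σ ^ (1 - α) * τ ^ (1 - α) / (1 - α))
        + κ * (σ ^ (1 - α) * τ ^ (1 - α)) * ((σ * τ - τ / 2) / (1 - α)) := by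
    ring
  rw [h7, h6]
  ring

lemma abs_deriv_sub_last_cell_le {T τ p d L : ℝ} {v v₁ v₂ : ℝ → ℝ} (hL : 0 ≤ L) (hτ : 0 < τ)
    (hv : ∀ t ∈ Icc 0 T, HasDerivWithinAt v (v₁ t) (Icc 0 T) t)
    (hv₁ : ∀ t ∈ Icc 0 T, HasDerivWithinAt v₁ (v₂ t) (Icc 0 T) t)
    (hv₂ : ∀ t ∈ Icc 0 T, ∀ s ∈ Icc 0 T, |v₂ t - v₂ s| ≤ L * |t - s|)
    (hp : 0 ≤ p) (hpT : p + τ ≤ T) (hd₀ : 0 ≤ d) (hd : d ≤ τ) :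
    |v₁ (p + d) - ((v (p + τ) - v p) / τ + v₂ p * (d - τ / 2))| ≤ 7 * L * τ ^ 2 := by
  have hp' : p ∈ Icc 0 T := ⟨hp, by linarith⟩
  have h1 := taylor_two (convex_Icc 0 T) hL hp' (y := p + τ) ⟨by linarith, hpT⟩ hv hv₁
    fun z hz => hv₂ z hz p hp'
  have h2 := taylor_one (convex_Icc 0 T) hL hp' (y := p + d) ⟨by linarith, by linarith⟩ hv₁
    fun z hz => hv₂ z hz p hp'
  rw [add_sub_cancel_left] at h1 h2
  rw [abs_of_pos hτ] at h1
  rw [abs_of_nonneg hd₀] at h2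
  set e1 := v (p + τ) - v p - τ * v₁ p - τ ^ 2 / 2 * v₂ p with he1
  set e2 := v₁ (p + d) - v₁ p - d * v₂ p with he2
  have e : v₁ (p + d) - ((v (p + τ) - v p) / τ + v₂ p * (d - τ / 2)) = e2 - e1 / τ := by
    rw [he1, he2]
    field_simp
    ring
  rw [e]
  refine (abs_sub _ _).trans ?_
  rw [abs_div, abs_of_pos hτ]
  have h3 : |e1| / τ ≤ L * τ ^ 2 := by
    rw [div_le_iff₀ hτ]
    linarith
  have h4 : L * d ^ 2 ≤ L * τ ^ 2 := by gcongr
  have h5 : 0 ≤ L * τ ^ 2 := by positivity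
  linarith

lemma abs_deriv_sub_full_cell_le {T τ p d L : ℝ} {v v₁ v₂ : ℝ → ℝ} (hL : 0 ≤ L) (hτ : 0 < τ)
    (hv : ∀ t ∈ Icc 0 T, HasDerivWithinAt v (v₁ t) (Icc 0 T) t)
    (hv₁ : ∀ t ∈ Icc 0 T, HasDerivWithinAt v₁ (v₂ t) (Icc 0 T) t)
    (hv₂ : ∀ t ∈ Icc 0 T, ∀ s ∈ Icc 0 T, |v₂ t - v₂ s| ≤ L * |t - s|)
    (hp : 0 ≤ p) (hpT : p + 2 * τ ≤ T) (hd₀ : 0 ≤ d) (hd : d ≤ τ) :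
    |v₁ (p + d) - ((v (p + τ) - v p) / τ
      + ((v (p + 2 * τ) - v (p + τ)) - (v (p + τ) - v p)) / τ ^ 2 * (d - τ / 2))|
      ≤ 7 * L * τ ^ 2 := by
  have hp' : p ∈ Icc 0 T := ⟨hp, by linarith⟩
  have h1 := taylor_two (convex_Icc 0 T) hL hp' (y := p + τ) ⟨by linarith, by linarith⟩ hv hv₁
    fun z hz => hv₂ z hz p hp'
  have h3 := taylor_two (convex_Icc 0 T) hL hp' (y := p + 2 * τ) ⟨by linarith, by linarith⟩ hv hv₁
    fun z hz => hv₂ z hz p hp'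
  have h2 := taylor_one (convex_Icc 0 T) hL hp' (y := p + d) ⟨by linarith, by linarith⟩ hv₁
    fun z hz => hv₂ z hz p hp'
  rw [add_sub_cancel_left] at h1 h2 h3
  rw [abs_of_pos hτ] at h1
  rw [abs_of_pos (by positivity : 0 < 2 * τ)] at h3
  rw [abs_of_nonneg hd₀] at h2
  set e1 := v (p + τ) - v p - τ * v₁ p - τ ^ 2 / 2 * v₂ p with he1
  set e2 := v₁ (p + d) - v₁ p - d * v₂ p with he2
  set e3 := v (p + 2 * τ) - v p - 2 * τ * v₁ p - (2 * τ) ^ 2 / 2 * v₂ p with he3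
  have e : v₁ (p + d) - ((v (p + τ) - v p) / τ
      + ((v (p + 2 * τ) - v (p + τ)) - (v (p + τ) - v p)) / τ ^ 2 * (d - τ / 2))
      = e2 - (e1 / τ + (e3 - 2 * e1) / τ ^ 2 * (d - τ / 2)) := by
    rw [he1, he2, he3]
    field_simp
    ring
  rw [e]
  refine (abs_sub _ _).trans ?_
  have h6 : |e1 / τ| ≤ L * τ ^ 2 := by
    rw [abs_div, abs_of_pos hτ, div_le_iff₀ hτ]
    linarith
  have h7 : |(e3 - 2 * e1) / τ ^ 2 * (d - τ / 2)| ≤ 10 * L * τ * (τ / 2) := by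
    rw [abs_mul, abs_div, abs_of_pos (by positivity : 0 < τ ^ 2)]
    refine mul_le_mul ?_ (abs_le.2 ⟨by linarith, by linarith⟩) (abs_nonneg _) (by positivity)
    rw [div_le_iff₀ (by positivity)]
    refine (abs_sub _ _).trans ?_
    rw [abs_mul, abs_two]
    nlinarith
  have h8 := abs_add_le (e1 / τ) ((e3 - 2 * e1) / τ ^ 2 * (d - τ / 2))
  have h4 : L * d ^ 2 ≤ L * τ ^ 2 := by gcongr
  nlinarith

lemma caputo_truncation_of_lt_one {α T : ℝ} (hα₀ : 0 < α) (hα : α < 1) (hT : 0 < T)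
    {L : ℝ} {v v₁ v₂ : ℝ → ℝ} (hL : 0 ≤ L)
    (hv : ∀ t ∈ Icc 0 T, HasDerivWithinAt v (v₁ t) (Icc 0 T) t)
    (hv₁ : ∀ t ∈ Icc 0 T, HasDerivWithinAt v₁ (v₂ t) (Icc 0 T) t)
    (hv₂ : ∀ t ∈ Icc 0 T, ∀ s ∈ Icc 0 T, |v₂ t - v₂ s| ≤ L * |t - s|)
    {τ : ℝ} (hτ : 0 < τ) {j : ℕ} (hj : ((j : ℝ) + 1) * τ ≤ T) :
    |discreteCaputo α (1 - α / 2) τ j (fun s => v (s * τ))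
      - caputoDeriv α T v ((j + (1 - α / 2)) * τ)|
      ≤ 7 * T ^ (1 - α) / Real.Gamma (2 - α) * L * τ ^ 2 := by
  have h1α : 0 < 1 - α := by linarith
  set σ := 1 - α / 2 with hσdef
  have hσ : 0 < σ := by linarith
  have hσ1 : σ ≤ 1 := by linarith
  set t := ((j : ℝ) + σ) * τ with ht
  have htT : t ≤ T := by
    refine le_trans ?_ hj
    rw [ht]
    gcongr
  have ht0 : 0 < t := by positivity
  set d : ℕ → ℝ := fun s => v ((s + 1 : ℕ) * τ) - v (s * τ) with hd
  set K : ℝ → ℝ := fun ξ => (t - ξ) ^ (-α) with hK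
  have hKint : ∀ x y, IntervalIntegrable K volume x y := fun x y => intervalIntegrable_sub_rpow hα
  have hv₁cont : ContinuousOn v₁ (Icc 0 T) := fun x hx => (hv₁ x hx).continuousWithinAt
  have hfint : ∀ x y, 0 ≤ x → x ≤ y → y ≤ T →
      IntervalIntegrable (fun ξ => v₁ ξ * K ξ) volume x y := by
    intro x y hx hxy hy
    refine (hKint x y).continuousOn_mul (hv₁cont.mono ?_)
    rw [uIcc_of_le hxy]
    exact Icc_subset_Icc hx hy
  have hcell : ∀ (x y A κ c : ℝ), 0 ≤ x → x ≤ y → y ≤ t →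
      (∀ ξ ∈ Icc x y, |v₁ ξ - (A + κ * (ξ - c - τ / 2))| ≤ 7 * L * τ ^ 2) →
      |(∫ ξ in x..y, v₁ ξ * K ξ) - ∫ ξ in x..y, (A + κ * (ξ - c - τ / 2)) * K ξ|
        ≤ 7 * L * τ ^ 2 * ∫ ξ in x..y, K ξ := by
    intro x y A κ c hx hxy hy hb
    have hg : IntervalIntegrable (fun ξ => (A + κ * (ξ - c - τ / 2)) * K ξ) volume x y :=
      (hKint x y).continuousOn_mul (by fun_prop)
    rw [← intervalIntegral.integral_sub (hfint x y hx hxy (hy.trans htT)) hg,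
      ← intervalIntegral.integral_const_mul, ← Real.norm_eq_abs]
    refine intervalIntegral.norm_integral_le_of_norm_le hxy ?_ ((hKint x y).const_mul _)
    refine Filter.Eventually.of_forall fun ξ hξ => ?_
    rw [← sub_mul, norm_mul, Real.norm_eq_abs, Real.norm_eq_abs]
    have hK0 : 0 ≤ K ξ := Real.rpow_nonneg (by linarith [hξ.2]) _
    rw [abs_of_nonneg hK0]
    exact mul_le_mul_of_nonneg_right (hb ξ ⟨hξ.1.le, hξ.2⟩) hK0
  have hnode : ∀ s : ℕ, s ≤ j → (s : ℝ) * τ ≤ j * τ := fun s hs => by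
    have : (s : ℝ) ≤ j := by exact_mod_cast hs
    gcongr
  have hjt : (j : ℝ) * τ ≤ t := by
    rw [ht]
    have : (j : ℝ) ≤ j + σ := by linarith
    gcongr
  have hfull : ∀ s ∈ Finset.range j,
      |(∫ ξ in (s * τ)..((s + 1 : ℕ) * τ), v₁ ξ * K ξ)
        - τ ^ (-α) / (1 - α) * (coefA α σ (j - s) * d s + coefB α σ (j - s) * (d (s + 1) - d s))|
        ≤ 7 * L * τ ^ 2 * ∫ ξ in (s * τ)..((s + 1 : ℕ) * τ), K ξ := by
    intro s hs
    rw [Finset.mem_range] at hs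
    have hs0 : (0 : ℝ) ≤ s * τ := by positivity
    have e2 : ((s + 1 : ℕ) : ℝ) * τ = s * τ + τ := by push_cast; ring
    have e3 : ((s + 1 + 1 : ℕ) : ℝ) * τ = s * τ + 2 * τ := by push_cast; ring
    have hsj := hnode (s + 1) hs
    have key := hcell (s * τ) ((s + 1 : ℕ) * τ) (d s / τ) ((d (s + 1) - d s) / τ ^ 2) (s * τ)
      hs0 (by rw [e2]; linarith) (hsj.trans hjt) ?_
    · obtain ⟨m, hm⟩ : ∃ m, j = s + m + 1 := ⟨j - s - 1, by omega⟩
      have hI := integral_affine_full_cell (A := d s / τ) (κ := (d (s + 1) - d s) / τ ^ 2)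
        hα hσ hτ s m
      have htm : ((s : ℝ) + m + 1 + σ) * τ = t := by
        rw [ht, hm]; push_cast; ring
      rw [htm] at hI
      simp only [hK] at key ⊢
      rw [hI] at key
      rw [show j - s = m + 1 by omega]
      convert key using 3
      rw [show 1 - α = 1 + -α by ring, Real.rpow_add hτ, Real.rpow_one]
      have : 1 + -α ≠ 0 := by linarith
      field_simp
    · intro ξ hξ
      rw [e2] at hξ
      have := abs_deriv_sub_full_cell_le hL hτ hv hv₁ hv₂ (p := s * τ) (d := ξ - s * τ) hs0
        (by rw [e2] at hsj; linarith) (by linarith [hξ.1]) (by linarith [hξ.2])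
      simp only [hd]
      rw [e3, e2]
      convert this using 4
      ring
  have hlast : |(∫ ξ in (j * τ)..t, v₁ ξ * K ξ) - τ ^ (-α) / (1 - α) * (coefA α σ 0 * d j)|
      ≤ 7 * L * τ ^ 2 * ∫ ξ in (j * τ)..t, K ξ := by
    have hj0 : (0 : ℝ) ≤ j * τ := by positivity
    have e2 : ((j + 1 : ℕ) : ℝ) * τ = j * τ + τ := by push_cast; ring
    have et : t = j * τ + σ * τ := by rw [ht]; ring
    have hστ : σ * τ ≤ τ := by nlinarith
    have key := hcell (j * τ) t (d j / τ) (v₂ (j * τ)) (j * τ) hj0 hjt le_rfl ?_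
    · have hI := integral_affine_last_cell (A := d j / τ) (κ := v₂ (j * τ)) (p := j * τ) hα hτ
      rw [← hσdef, ← et] at hI
      simp only [hK] at key ⊢
      rw [hI] at key
      convert key using 3
      rw [show 1 - α = 1 + -α by ring, Real.rpow_add hτ, Real.rpow_one]
      have : 1 + -α ≠ 0 := by linarith
      field_simp
    · intro ξ hξ
      have := abs_deriv_sub_last_cell_le hL hτ hv hv₁ hv₂ (p := j * τ) (d := ξ - j * τ) hj0
        (by linarith) (by linarith [hξ.1]) (by linarith [hξ.2])
      simp only [hd]
      rw [e2]
      convert this using 4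
      ring
  have hsplit : ∀ f : ℝ → ℝ, (∀ x y, 0 ≤ x → x ≤ y → y ≤ T → IntervalIntegrable f volume x y) →
      ∫ ξ in (0 : ℝ)..t, f ξ = (∑ s ∈ Finset.range j, ∫ ξ in (s * τ)..((s + 1 : ℕ) * τ), f ξ)
        + ∫ ξ in (j * τ)..t, f ξ := by
    intro f hf
    have h1 := intervalIntegral.sum_integral_adjacent_intervals (f := f) (μ := volume)
      (a := fun s : ℕ => (s : ℝ) * τ) (n := j) (fun s hs => ?_)
    · rw [h1]
      simp only [Nat.cast_zero, zero_mul]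
      rw [intervalIntegral.integral_add_adjacent_intervals]
      · exact hf _ _ le_rfl (by positivity) (hjt.trans htT)
      · exact hf _ _ (by positivity) hjt htT
    · have := hnode (s + 1) hs
      refine hf _ _ (by positivity) ?_ (this.trans (hjt.trans htT))
      push_cast
      nlinarith
  have hcap : caputoDeriv α T v t = 1 / Real.Gamma (1 - α) * ∫ ξ in (0 : ℝ)..t, v₁ ξ * K ξ := by
    rw [caputoDeriv, if_neg hα.ne]
    congr 1
    refine intervalIntegral.integral_congr fun ξ hξ => ?_
    rw [uIcc_of_le ht0.le] at hξ
    have hξT : ξ ∈ Icc 0 T := ⟨hξ.1, hξ.2.trans htT⟩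
    simp only [hK]
    rw [(hv ξ hξT).derivWithin (uniqueDiffOn_Icc hT ξ hξT), Real.rpow_neg (by linarith [hξ.2]),
      div_eq_mul_inv]
  have hΓ : Real.Gamma (2 - α) = (1 - α) * Real.Gamma (1 - α) := by
    rw [show 2 - α = (1 - α) + 1 by ring, Real.Gamma_add_one h1α.ne']
  have hΓ1 : 0 < Real.Gamma (1 - α) := Real.Gamma_pos_of_pos h1α
  have hdisc : discreteCaputo α σ τ j (fun s => v (s * τ))
      = 1 / Real.Gamma (1 - α) * ((∑ s ∈ Finset.range j, τ ^ (-α) / (1 - α) *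
          (coefA α σ (j - s) * d s + coefB α σ (j - s) * (d (s + 1) - d s)))
        + τ ^ (-α) / (1 - α) * (coefA α σ 0 * d j)) := by
    have := discreteCaputo_sum_eq α σ j d
    simp only [discreteCaputo]
    simp only [hd] at this ⊢
    rw [this, ← Finset.mul_sum, hΓ]
    field_simp
    ring
  rw [hcap, hdisc, hsplit _ hfint, ← mul_sub, abs_mul, abs_of_pos (by positivity : 0 < 1 / Real.Gamma (1 - α))]
  have hKtot := hsplit K (fun x y _ _ _ => hKint x y)
  have hKval : ∫ ξ in (0 : ℝ)..t, K ξ ≤ T ^ (1 - α) / (1 - α) := by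
    simp only [hK]
    rw [integral_sub_rpow hα]
    gcongr
  have hsumle : |((∑ s ∈ Finset.range j, τ ^ (-α) / (1 - α) *
          (coefA α σ (j - s) * d s + coefB α σ (j - s) * (d (s + 1) - d s)))
        + τ ^ (-α) / (1 - α) * (coefA α σ 0 * d j))
      - ((∑ s ∈ Finset.range j, ∫ ξ in (s * τ)..((s + 1 : ℕ) * τ), v₁ ξ * K ξ)
        + ∫ ξ in (j * τ)..t, v₁ ξ * K ξ)| ≤ 7 * L * τ ^ 2 * (T ^ (1 - α) / (1 - α)) := by
    rw [abs_sub_comm, add_sub_add_comm, ← Finset.sum_sub_distrib]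
    calc _ ≤ (∑ s ∈ Finset.range j, 7 * L * τ ^ 2 * ∫ ξ in (s * τ)..((s + 1 : ℕ) * τ), K ξ)
          + 7 * L * τ ^ 2 * ∫ ξ in (j * τ)..t, K ξ :=
          (abs_add_le _ _).trans (add_le_add
            ((Finset.abs_sum_le_sum_abs _ _).trans (Finset.sum_le_sum hfull)) hlast)
      _ = 7 * L * τ ^ 2 * ∫ ξ in (0 : ℝ)..t, K ξ := by
          rw [hKtot, mul_add, Finset.mul_sum]
      _ ≤ _ := by gcongr
  calc _ ≤ 1 / Real.Gamma (1 - α) * (7 * L * τ ^ 2 * (T ^ (1 - α) / (1 - α))) := by gcongr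
    _ = _ := by
      rw [hΓ]
      field_simp

lemma caputo_truncation {α T : ℝ} (hα₀ : 0 < α) (hα₁ : α ≤ 1) (hT : 0 < T) :
    ∃ C : ℝ, 0 ≤ C ∧ ∀ (L : ℝ) (v v₁ v₂ : ℝ → ℝ), 0 ≤ L →
      (∀ t ∈ Icc 0 T, HasDerivWithinAt v (v₁ t) (Icc 0 T) t) →
      (∀ t ∈ Icc 0 T, HasDerivWithinAt v₁ (v₂ t) (Icc 0 T) t) →
      (∀ t ∈ Icc 0 T, ∀ s ∈ Icc 0 T, |v₂ t - v₂ s| ≤ L * |t - s|) →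
      ∀ (τ : ℝ) (j : ℕ), 0 < τ → ((j : ℝ) + 1) * τ ≤ T →
        |discreteCaputo α (1 - α / 2) τ j (fun s => v (s * τ))
          - caputoDeriv α T v ((j + (1 - α / 2)) * τ)| ≤ C * L * τ ^ 2 := by
  rcases hα₁.lt_or_eq with h1 | h1
  · refine ⟨7 * T ^ (1 - α) / Real.Gamma (2 - α),
      div_nonneg (by positivity) (Real.Gamma_pos_of_pos (by linarith)).le, ?_⟩
    intro L v v₁ v₂ hL hv hv₁ hv₂ τ j hτ hj
    exact caputo_truncation_of_lt_one hα₀ h1 hT hL hv hv₁ hv₂ hτ hj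
  · subst h1
    refine ⟨7, by norm_num, ?_⟩
    intro L v v₁ v₂ hL hv hv₁ hv₂ τ j hτ hj
    have hj0 : (0 : ℝ) ≤ j * τ := by positivity
    have hmem : ((j : ℝ) + (1 - 1 / 2)) * τ ∈ Icc 0 T :=
      ⟨by norm_num; positivity, by nlinarith⟩
    have hcap : caputoDeriv 1 T v ((j + (1 - 1 / 2)) * τ) = v₁ ((j + (1 - 1 / 2)) * τ) := by
      rw [caputoDeriv, if_pos rfl]
      exact (hv _ hmem).derivWithin (uniqueDiffOn_Icc hT _ hmem)
    have hdisc : discreteCaputo 1 (1 - 1 / 2) τ j (fun s => v (s * τ))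
        = (v (j * τ + τ) - v (j * τ)) / τ := by
      rw [discreteCaputo, Finset.sum_eq_single_of_mem j (by simp)]
      · rw [coefC_one_eq (by omega), Nat.sub_self, if_pos rfl, Real.rpow_neg_one,
          show (2 : ℝ) - 1 = 1 by norm_num, Real.Gamma_one, div_one, one_mul, inv_mul_eq_div]
        push_cast
        rw [add_mul, one_mul]
      · intro s hs hsj
        rw [Finset.mem_range] at hs
        rw [coefC_one_eq (by omega), if_neg (by omega), zero_mul]
    have := abs_deriv_sub_last_cell_le hL hτ hv hv₁ hv₂ (p := j * τ) (d := τ / 2) hj0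
      (by linarith) (by linarith) (by linarith)
    rw [sub_self, mul_zero, add_zero] at this
    rw [hcap, hdisc, abs_sub_comm]
    convert this using 4
    ring

/-! ### Asymptotics of the Grünwald coefficients of negative order -/

lemma grunwald_neg_pos {s : ℝ} (hs : 0 < s) (n : ℕ) : 0 < grunwald (-s) n := by
  induction n with
  | zero => simp [grunwald_zero]
  | succ n ih =>
    rw [grunwald_succ, sub_neg_eq_add]
    positivity

lemma grunwald_neg_mul_GammaSeq {s : ℝ} (hs : 0 < s) (n : ℕ) :
    grunwald (-s) n * Real.GammaSeq s n = (n : ℝ) ^ s / (s + n) := by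
  have hprod : ∀ n : ℕ, grunwald (-s) n * n.factorial = ∏ j ∈ Finset.range n, (s + j) := by
    intro n
    induction n with
    | zero => simp [grunwald_zero]
    | succ n ih =>
      rw [Finset.prod_range_succ, ← ih, grunwald_succ, Nat.factorial_succ]
      push_cast
      field_simp
      ring
  have hpos : 0 < ∏ j ∈ Finset.range n, (s + j) := Finset.prod_pos fun j _ => by positivity
  rw [Real.GammaSeq, Finset.prod_range_succ, ← hprod] at *
  have h1 : 0 < grunwald (-s) n := grunwald_neg_pos hs n
  have h2 : (n.factorial : ℝ) ≠ 0 := by positivity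
  have h3 : s + n ≠ 0 := by positivity
  field_simp

lemma sum_grunwald_neg_mul (μ : ℝ) (n : ℕ) :
    ∑ k ∈ Finset.range (n + 1), grunwald (-μ) k * ((n : ℝ) + 1 - k) = grunwald (-(μ + 2)) n := by
  induction n with
  | zero => simp [grunwald_zero]
  | succ n ih =>
    have h1 : ∑ k ∈ Finset.range (n + 1 + 1), grunwald (-μ) k * (((n + 1 : ℕ) : ℝ) + 1 - k)
        = ∑ k ∈ Finset.range (n + 1 + 1), grunwald (-μ) k * ((n : ℝ) + 1 - k)
          + ∑ k ∈ Finset.range (n + 1 + 1), grunwald (-μ) k := by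
      rw [← Finset.sum_add_distrib]
      refine Finset.sum_congr rfl fun k _ => ?_
      push_cast
      ring
    have h2 := grunwald_succ_eq_sub (-μ - 1) n
    rw [show -μ - 1 - 1 = -(μ + 2) by ring] at h2
    rw [h1, Finset.sum_range_succ, ih, sum_grunwald, h2]
    push_cast
    ring

lemma abs_log_add_sub_log_sub_le {c d : ℝ} (hd : 0 ≤ d) (hc : 0 < c) (hdc : 2 * d ≤ c) :
    |Real.log (c + d) - Real.log (c - d) - 2 * d / c| ≤ 4 * (d / c) ^ 3 := by
  set x := d / c with hx
  have hx0 : 0 ≤ x := by positivity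
  have hx1 : x ≤ 1 / 2 := by rw [hx, div_le_iff₀ hc]; linarith
  have hax : |x| = x := abs_of_nonneg hx0
  have h1 := Real.abs_log_sub_add_sum_range_le (x := x) (by rw [hax]; linarith) 2
  have h2 := Real.abs_log_sub_add_sum_range_le (x := -x) (by rw [abs_neg, hax]; linarith) 2
  rw [abs_neg, hax] at h2
  rw [hax] at h1
  simp only [Finset.sum_range_succ, Finset.sum_range_zero] at h1 h2
  norm_num at h1 h2
  have e1 : Real.log (c + d) = Real.log c + Real.log (1 + x) := by
    rw [← Real.log_mul hc.ne' (by linarith), hx]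
    congr 1
    field_simp
  have e2 : Real.log (c - d) = Real.log c + Real.log (1 - x) := by
    rw [← Real.log_mul hc.ne' (by linarith), hx]
    congr 1
    field_simp
  have h3 : x ^ 3 / (1 - x) ≤ 2 * x ^ 3 := by
    rw [div_le_iff₀ (by linarith)]
    have : 0 ≤ x ^ 3 := by positivity
    nlinarith
  rw [e1, e2, mul_div_assoc, ← hx]
  rw [abs_le] at h1 h2 ⊢
  constructor <;> linarith [h1.1, h1.2, h2.1, h2.2]

/-- The ratio between a Grünwald coefficient of order `-(μ + 2)` and its leading term. -/
def grunwaldRatio (μ : ℝ) (n : ℕ) : ℝ :=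
  Real.Gamma (μ + 2) * grunwald (-(μ + 2)) n / ((n : ℝ) + 1 + μ / 2) ^ (μ + 1)

lemma grunwaldRatio_pos {μ : ℝ} (hμ : 0 < μ) (n : ℕ) : 0 < grunwaldRatio μ n := by
  have h1 := grunwald_neg_pos (s := μ + 2) (by linarith) n
  have h2 : 0 < Real.Gamma (μ + 2) := Real.Gamma_pos_of_pos (by linarith)
  rw [grunwaldRatio]
  positivity

lemma tendsto_grunwaldRatio {μ : ℝ} (hμ : 0 < μ) :
    Filter.Tendsto (grunwaldRatio μ) Filter.atTop (nhds 1) := by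
  have hΓ : 0 < Real.Gamma (μ + 2) := Real.Gamma_pos_of_pos (by linarith)
  have h1 := Real.GammaSeq_tendsto_Gamma (μ + 2)
  have hinv : Filter.Tendsto (fun n : ℕ => ((n : ℝ))⁻¹) Filter.atTop (nhds 0) :=
    tendsto_inv_atTop_zero.comp tendsto_natCast_atTop_atTop
  have h2 : Filter.Tendsto (fun n : ℕ => (1 + (μ + 2) * (n : ℝ)⁻¹)) Filter.atTop (nhds 1) := by
    simpa using (hinv.const_mul (μ + 2)).const_add 1
  have h3 : Filter.Tendsto (fun n : ℕ => (1 + (1 + μ / 2) * (n : ℝ)⁻¹) ^ (μ + 1))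
      Filter.atTop (nhds 1) := by
    have : Filter.Tendsto (fun n : ℕ => (1 + (1 + μ / 2) * (n : ℝ)⁻¹)) Filter.atTop (nhds 1) := by
      simpa using (hinv.const_mul (1 + μ / 2)).const_add 1
    simpa using this.rpow_const (p := μ + 1) (Or.inl one_ne_zero)
  have h4 := (tendsto_const_nhds (x := Real.Gamma (μ + 2))).div (h1.mul (h2.mul h3))
    (by simpa using hΓ.ne')
  rw [mul_one, mul_one, div_self hΓ.ne'] at h4
  refine h4.congr' ?_
  filter_upwards [Filter.eventually_gt_atTop 0] with n hn
  have hn' : (0 : ℝ) < n := by exact_mod_cast hn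
  have h5 := grunwald_neg_mul_GammaSeq (s := μ + 2) (by linarith) n
  have h6 := grunwald_neg_pos (s := μ + 2) (by linarith) n
  have h7 : Real.GammaSeq (μ + 2) n = (n : ℝ) ^ (μ + 2) / (μ + 2 + n) / grunwald (-(μ + 2)) n := by
    rw [eq_div_iff h6.ne', ← h5, mul_comm]
  have h8 : ((n : ℝ) + 1 + μ / 2) ^ (μ + 1)
      = (n : ℝ) ^ (μ + 1) * (1 + (1 + μ / 2) * (n : ℝ)⁻¹) ^ (μ + 1) := by
    rw [← Real.mul_rpow hn'.le (by positivity)]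
    congr 1
    field_simp
    ring
  have h9 : (n : ℝ) ^ (μ + 2) = (n : ℝ) ^ (μ + 1) * n := by
    rw [show μ + 2 = μ + 1 + 1 by ring, Real.rpow_add_one hn'.ne']
  rw [Pi.div_apply, grunwaldRatio, h7, h8, h9]
  have h10 : 0 < (n : ℝ) ^ (μ + 1) := by positivity
  have h11 : 0 < (1 + (1 + μ / 2) * (n : ℝ)⁻¹) ^ (μ + 1) := by positivity
  set X := (1 + (1 + μ / 2) * (n : ℝ)⁻¹) ^ (μ + 1)
  set Y := (n : ℝ) ^ (μ + 1)
  field_simp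
  ring

lemma abs_log_grunwaldRatio_succ_sub_le {μ : ℝ} (hμ : 0 < μ) (hμ₁ : μ < 1) (n : ℕ) :
    |Real.log (grunwaldRatio μ (n + 1)) - Real.log (grunwaldRatio μ n)|
      ≤ 12 / ((n : ℝ) + 1) ^ 3 := by
  have hΓ : 0 < Real.Gamma (μ + 2) := Real.Gamma_pos_of_pos (by linarith)
  have hg := grunwald_neg_pos (s := μ + 2) (by linarith) n
  have hn : (0 : ℝ) ≤ n := by positivity
  set c : ℝ := (n : ℝ) + 3 / 2 + μ / 2 with hc
  have hc0 : 0 < c := by positivity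
  have h1 := abs_log_add_sub_log_sub_le (c := c) (d := (1 + μ) / 2) (by positivity) hc0
    (by rw [hc]; linarith)
  have h2 := abs_log_add_sub_log_sub_le (c := c) (d := 1 / 2) (by positivity) hc0
    (by rw [hc]; linarith)
  have e : Real.log (grunwaldRatio μ (n + 1)) - Real.log (grunwaldRatio μ n)
      = (Real.log (c + (1 + μ) / 2) - Real.log (c - (1 + μ) / 2) - 2 * ((1 + μ) / 2) / c)
        - (μ + 1) * (Real.log (c + 1 / 2) - Real.log (c - 1 / 2) - 2 * (1 / 2) / c) := by
    have a1 : (0 : ℝ) < (n + 1 : ℕ) + 1 + μ / 2 := by positivity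
    have a2 : (0 : ℝ) < (n : ℝ) + 1 + μ / 2 := by positivity
    have a3 : (0 : ℝ) < (n : ℝ) - -(μ + 2) := by rw [sub_neg_eq_add]; positivity
    have a4 : (0 : ℝ) < (n : ℝ) + 1 := by positivity
    rw [grunwaldRatio, grunwaldRatio, grunwald_succ,
      Real.log_div (by positivity) (by positivity), Real.log_div (by positivity) (by positivity),
      Real.log_rpow a1, Real.log_rpow a2, ← mul_assoc,
      Real.log_mul (by positivity) (by positivity), Real.log_div a3.ne' a4.ne',
      show c + (1 + μ) / 2 = n - -(μ + 2) by rw [hc]; ring,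
      show c - (1 + μ) / 2 = n + 1 by rw [hc]; ring,
      show c + 1 / 2 = (n + 1 : ℕ) + 1 + μ / 2 by rw [hc]; push_cast; ring,
      show c - 1 / 2 = (n : ℝ) + 1 + μ / 2 by rw [hc]; ring]
    ring
  rw [e]
  refine (abs_sub _ _).trans ?_
  rw [abs_mul, abs_of_pos (by linarith : 0 < μ + 1)]
  have hb : ∀ d : ℝ, 0 ≤ d → d ≤ 1 → 4 * (d / c) ^ 3 ≤ 4 / ((n : ℝ) + 1) ^ 3 := by
    intro d hd hd1
    have : d / c ≤ 1 / ((n : ℝ) + 1) := by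
      apply div_le_div₀ zero_le_one hd1 (by positivity)
      rw [hc]
      linarith
    calc 4 * (d / c) ^ 3 ≤ 4 * (1 / ((n : ℝ) + 1)) ^ 3 := by gcongr
      _ = _ := by rw [div_pow, one_pow]; ring
  have h3 := h1.trans (hb _ (by positivity) (by linarith))
  have h4 := h2.trans (hb _ (by positivity) (by linarith))
  have h5 : 12 / ((n : ℝ) + 1) ^ 3 = 4 / ((n : ℝ) + 1) ^ 3 + 2 * (4 / ((n : ℝ) + 1) ^ 3) := by ring
  rw [h5]
  refine add_le_add h3 (mul_le_mul (by linarith) h4 (abs_nonneg _) (by norm_num))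

lemma abs_log_grunwaldRatio_le {μ : ℝ} (hμ : 0 < μ) (hμ₁ : μ < 1) (n : ℕ) :
    |Real.log (grunwaldRatio μ n)| ≤ 48 / ((n : ℝ) + 1) ^ 2 := by
  have hlim : Filter.Tendsto (fun n => Real.log (grunwaldRatio μ n)) Filter.atTop (nhds 0) := by
    have := (tendsto_grunwaldRatio hμ).log one_ne_zero
    simpa using this
  have hb : Filter.Tendsto (fun n : ℕ => 48 / ((n : ℝ) + 1) ^ 2) Filter.atTop (nhds 0) := by
    refine Filter.Tendsto.const_div_atTop ?_ _
    refine (Filter.tendsto_pow_atTop two_ne_zero).comp ?_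
    exact Filter.tendsto_atTop_add_const_right _ _ tendsto_natCast_atTop_atTop
  have hstep : ∀ n : ℕ, 12 / ((n : ℝ) + 1) ^ 3
      ≤ 48 / ((n : ℝ) + 1) ^ 2 - 48 / (((n + 1 : ℕ) : ℝ) + 1) ^ 2 := by
    intro n
    have hn : (0 : ℝ) ≤ n := by positivity
    push_cast
    rw [div_sub_div _ _ (by positivity) (by positivity), div_le_div_iff₀ (by positivity) (by positivity)]
    have : 0 ≤ (n : ℝ) ^ 4 + n ^ 3 + n ^ 2 + n := by positivity
    have e : (48 * ((n : ℝ) + 1 + 1) ^ 2 - (n + 1) ^ 2 * 48) * (n + 1) ^ 3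
        - 12 * ((n + 1) ^ 2 * (n + 1 + 1) ^ 2)
        = (n + 1) ^ 2 * (84 * n ^ 2 + 192 * n + 96) := by ring
    have : 0 ≤ ((n : ℝ) + 1) ^ 2 * (84 * n ^ 2 + 192 * n + 96) := by positivity
    linarith
  have hd := fun n => abs_le.1 (abs_log_grunwaldRatio_succ_sub_le hμ hμ₁ n)
  have h1 : Antitone fun n : ℕ => Real.log (grunwaldRatio μ n) + 48 / ((n : ℝ) + 1) ^ 2 :=
    antitone_nat_of_succ_le fun n => by linarith [(hd n).2, hstep n]
  have h2 : Monotone fun n : ℕ => Real.log (grunwaldRatio μ n) - 48 / ((n : ℝ) + 1) ^ 2 :=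
    monotone_nat_of_le_succ fun n => by linarith [(hd n).1, hstep n]
  have h3 := h1.le_of_tendsto (by simpa using hlim.add hb) n
  have h4 := h2.ge_of_tendsto (by simpa using hlim.sub hb) n
  rw [abs_le]
  constructor <;> linarith

lemma abs_exp_sub_one_le_mul_exp (x : ℝ) : |Real.exp x - 1| ≤ |x| * Real.exp |x| := by
  have h1 := Real.add_one_le_exp x
  have h2 := Real.add_one_le_exp (-x)
  have h3 : Real.exp x * Real.exp (-x) = 1 := by rw [← Real.exp_add]; simp
  have h4 : Real.exp x - 1 ≤ x * Real.exp x := by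
    have := mul_le_mul_of_nonneg_left h2 (Real.exp_pos x).le
    linarith
  have h5 : Real.exp x ≤ Real.exp |x| := Real.exp_le_exp.2 (le_abs_self x)
  have h6 : (1 : ℝ) ≤ Real.exp |x| := Real.one_le_exp (abs_nonneg x)
  rw [abs_le]
  constructor
  · have := neg_abs_le x
    nlinarith [abs_nonneg x]
  · have := le_abs_self x
    refine h4.trans ?_
    calc x * Real.exp x ≤ |x| * Real.exp x := by gcongr
      _ ≤ _ := by gcongr

lemma abs_grunwald_neg_sub_le {μ : ℝ} (hμ : 0 < μ) (hμ₁ : μ < 1) :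
    ∃ C : ℝ, 0 ≤ C ∧ ∀ n : ℕ,
      |grunwald (-(μ + 2)) n - ((n : ℝ) + 1 + μ / 2) ^ (μ + 1) / Real.Gamma (μ + 2)|
        ≤ C * ((n : ℝ) + 1 + μ / 2) ^ (μ - 1) := by
  have hΓ : 0 < Real.Gamma (μ + 2) := Real.Gamma_pos_of_pos (by linarith)
  refine ⟨4 * 48 * Real.exp 48 / Real.Gamma (μ + 2), by positivity, ?_⟩
  intro n
  have hn : (0 : ℝ) ≤ n := by positivity
  set m : ℝ := (n : ℝ) + 1 + μ / 2 with hm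
  have hm0 : 0 < m := by positivity
  have h1 := abs_log_grunwaldRatio_le hμ hμ₁ n
  have h2 : 48 / ((n : ℝ) + 1) ^ 2 ≤ 48 := by
    rw [div_le_iff₀ (by positivity)]
    nlinarith
  have h3 : 48 / ((n : ℝ) + 1) ^ 2 ≤ 4 * 48 / m ^ 2 := by
    rw [div_le_div_iff₀ (by positivity) (by positivity)]
    have : m ≤ 2 * ((n : ℝ) + 1) := by rw [hm]; linarith
    have : m ^ 2 ≤ (2 * ((n : ℝ) + 1)) ^ 2 := by gcongr
    nlinarith
  have h4 := abs_exp_sub_one_le_mul_exp (Real.log (grunwaldRatio μ n))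
  rw [Real.exp_log (grunwaldRatio_pos hμ n)] at h4
  have h5 : |grunwaldRatio μ n - 1| ≤ 4 * 48 / m ^ 2 * Real.exp 48 :=
    h4.trans (mul_le_mul (h1.trans h3) (Real.exp_le_exp.2 (h1.trans h2)) (Real.exp_pos _).le
      (by positivity))
  have hmp : 0 < m ^ (μ + 1) := by positivity
  have e : grunwald (-(μ + 2)) n - m ^ (μ + 1) / Real.Gamma (μ + 2)
      = m ^ (μ + 1) / Real.Gamma (μ + 2) * (grunwaldRatio μ n - 1) := by
    rw [grunwaldRatio, ← hm]
    field_simp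
  have e2 : m ^ (μ + 1) = m ^ (μ - 1) * m ^ 2 := by
    rw [← Real.rpow_natCast m 2, ← Real.rpow_add hm0]
    norm_num
    ring_nf
  rw [e, abs_mul, abs_of_pos (by positivity)]
  calc _ ≤ m ^ (μ + 1) / Real.Gamma (μ + 2) * (4 * 48 / m ^ 2 * Real.exp 48) := by gcongr
    _ = _ := by
      rw [e2]
      field_simp

lemma sum_grunwald_neg_le {μ : ℝ} (hμ : 0 < μ) (hμ₁ : μ < 1) :
    ∃ C : ℝ, 0 ≤ C ∧ ∀ n : ℕ,
      ∑ k ∈ Finset.range (n + 1), grunwald (-μ) k ≤ C * ((n : ℝ) + 1) ^ μ := by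
  obtain ⟨C, hC, h⟩ := abs_grunwald_neg_sub_le hμ hμ₁
  have hΓ : 0 < Real.Gamma (μ + 2) := Real.Gamma_pos_of_pos (by linarith)
  refine ⟨(1 / Real.Gamma (μ + 2) + C) * 3 ^ (μ + 1), by positivity, ?_⟩
  intro n
  have hn : (0 : ℝ) ≤ n := by positivity
  have h1 : ((n : ℝ) + 1) * ∑ k ∈ Finset.range (n + 1), grunwald (-μ) k
      ≤ grunwald (-(μ + 2)) (2 * n + 1) := by
    rw [← sum_grunwald_neg_mul, Finset.mul_sum]
    calc _ ≤ ∑ k ∈ Finset.range (n + 1), grunwald (-μ) k * (((2 * n + 1 : ℕ) : ℝ) + 1 - k) := by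
          refine Finset.sum_le_sum fun k hk => ?_
          rw [Finset.mem_range] at hk
          have hk' : (k : ℝ) ≤ n := by exact_mod_cast Nat.lt_succ_iff.1 hk
          have := (grunwald_neg_pos hμ k).le
          rw [mul_comm]
          refine mul_le_mul_of_nonneg_left ?_ this
          push_cast
          linarith
      _ ≤ _ := by
          refine Finset.sum_le_sum_of_subset_of_nonneg
            (Finset.range_subset_range.2 (by omega)) fun k hk _ => ?_
          rw [Finset.mem_range] at hk
          have hk' : (k : ℝ) ≤ ((2 * n + 1 : ℕ) : ℝ) := by exact_mod_cast Nat.lt_succ_iff.1 hk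
          exact mul_nonneg (grunwald_neg_pos hμ k).le (by linarith)
  have h2 := (abs_le.1 (h (2 * n + 1))).2
  push_cast at h2
  set m : ℝ := 2 * (n : ℝ) + 1 + 1 + μ / 2 with hm
  have hm1 : 1 ≤ m := by rw [hm]; linarith
  have h3 : m ^ (μ - 1) ≤ m ^ (μ + 1) := Real.rpow_le_rpow_of_exponent_le hm1 (by linarith)
  have h4 : m ^ (μ + 1) ≤ 3 ^ (μ + 1) * ((n : ℝ) + 1) ^ (μ + 1) := by
    rw [← Real.mul_rpow (by norm_num) (by positivity)]
    refine Real.rpow_le_rpow (by linarith) ?_ (by linarith)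
    rw [hm]
    linarith
  have h5 : grunwald (-(μ + 2)) (2 * n + 1)
      ≤ (1 / Real.Gamma (μ + 2) + C) * (3 ^ (μ + 1) * ((n : ℝ) + 1) ^ (μ + 1)) := by
    calc _ ≤ m ^ (μ + 1) / Real.Gamma (μ + 2) + C * m ^ (μ - 1) := by linarith
      _ ≤ m ^ (μ + 1) / Real.Gamma (μ + 2) + C * m ^ (μ + 1) := by gcongr
      _ = (1 / Real.Gamma (μ + 2) + C) * m ^ (μ + 1) := by ring
      _ ≤ _ := by gcongr
  rw [Real.rpow_add_one (by positivity : (n : ℝ) + 1 ≠ 0)] at h5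
  have h6 := h1.trans h5
  have h7 : (0 : ℝ) < (n : ℝ) + 1 := by positivity
  refine le_of_mul_le_mul_left (h6.trans (le_of_eq ?_)) h7
  ring

/-! ### The Peano kernel of the Grünwald quadrature rule -/

lemma abs_rpow_chord_sub_le {μ m θ : ℝ} (hμ : 0 < μ) (hμ₁ : μ < 1) (hm : 0 < m)
    (hθ₀ : 0 ≤ θ) (hθ₁ : θ ≤ 1) :
    |θ * (m + 1) ^ (μ + 1) + (1 - θ) * m ^ (μ + 1) - (m + θ) ^ (μ + 1)|
      ≤ 2 * m ^ (μ - 1) := by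
  have hd : ∀ z ∈ Ici m, HasDerivWithinAt (fun x : ℝ => x ^ (μ + 1)) ((μ + 1) * z ^ μ) (Ici m) z := by
    intro z hz
    have := Real.hasDerivAt_rpow_const (x := z) (p := μ + 1) (Or.inl (hm.trans_le hz).ne')
    rw [add_sub_cancel_right] at this
    exact this.hasDerivWithinAt
  have hd2 : ∀ z ∈ Ici m, HasDerivWithinAt (fun x : ℝ => (μ + 1) * x ^ μ)
      ((μ + 1) * (μ * z ^ (μ - 1))) (Ici m) z := by
    intro z hz
    have := Real.hasDerivAt_rpow_const (x := z) (p := μ) (Or.inl (hm.trans_le hz).ne')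
    exact (this.const_mul _).hasDerivWithinAt
  have hmp : 0 ≤ m ^ (μ - 1) := by positivity
  have h := abs_linear_interpolation_sub_le (convex_Ici m) (p := m) (τ := 1) (θ := θ)
    (B := 2 * m ^ (μ - 1)) (by positivity) hθ₀ hθ₁ (by simp) (by simp) hd ?_
  · simpa using h
  · intro z hz w hw
    have := abs_sub_le_of_abs_deriv_le_pow (convex_Ici m) (n := 0) (B := 2 * m ^ (μ - 1))
      (by positivity) hw hz hd2 ?_
    · simpa using this
    · intro y hy
      have hy0 : 0 < y := hm.trans_le hy
      have h1 : y ^ (μ - 1) ≤ m ^ (μ - 1) := Real.rpow_le_rpow_of_nonpos hm hy (by linarith)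
      have h2 : 0 ≤ y ^ (μ - 1) := by positivity
      rw [abs_of_nonneg (by positivity), pow_zero, mul_one, ← mul_assoc]
      exact mul_le_mul (by nlinarith) h1 h2 (by norm_num)

lemma abs_grunwald_kernel_le {μ : ℝ} (hμ : 0 < μ) (hμ₁ : μ < 1) :
    ∃ C : ℝ, 0 ≤ C ∧ ∀ (y : ℝ) (K : ℕ), 0 < y → y ≤ K →
      |∑ k ∈ Finset.range K, grunwald (-μ) k * max (y - k - μ / 2) 0
        - y ^ (μ + 1) / Real.Gamma (μ + 2)| ≤ C * y ^ (μ - 1) := by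
  obtain ⟨C, hC, hG⟩ := abs_grunwald_neg_sub_le hμ hμ₁
  have hΓ : 0 < Real.Gamma (μ + 2) := Real.Gamma_pos_of_pos (by linarith)
  set Γ := Real.Gamma (μ + 2) with hΓdef
  have h2μ : (0 : ℝ) < 2 ^ (1 - μ) := by positivity
  refine ⟨((2 + 2 ^ (μ + 1) / Γ) + (C + 2 / Γ)) * 2 ^ (1 - μ), by positivity, ?_⟩
  intro y K hy hyK
  have hyp : 0 < y ^ (μ - 1) := by positivity
  rcases lt_or_ge y (1 + μ / 2) with hlt | hge
  · have hy2 : y ≤ 2 := by linarith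
    have hK : 0 < K := by
      by_contra hc
      have : K = 0 := by omega
      subst this
      simp at hyK
      linarith
    rw [Finset.sum_eq_single_of_mem 0 (by simpa using hK)]
    · rw [grunwald_zero, one_mul]
      have h1 : |max (y - (0 : ℕ) - μ / 2) 0 - y ^ (μ + 1) / Γ| ≤ 2 + 2 ^ (μ + 1) / Γ := by
        refine (abs_sub _ _).trans (add_le_add ?_ ?_)
        · rw [abs_of_nonneg (le_max_right _ _)]
          refine max_le ?_ (by norm_num)
          push_cast
          linarith
        · rw [abs_of_nonneg (by positivity)]
          gcongr
      have h2 : 1 ≤ 2 ^ (1 - μ) * y ^ (μ - 1) := by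
        have : (2 : ℝ) ^ (μ - 1) ≤ y ^ (μ - 1) :=
          Real.rpow_le_rpow_of_nonpos hy hy2 (by linarith)
        calc (1 : ℝ) = 2 ^ (1 - μ) * 2 ^ (μ - 1) := by
              rw [← Real.rpow_add (by norm_num)]; simp
          _ ≤ _ := by gcongr
      have h3 : 0 ≤ C + 2 / Γ := by positivity
      have h4 : 0 ≤ 2 + 2 ^ (μ + 1) / Γ := by positivity
      calc _ ≤ (2 + 2 ^ (μ + 1) / Γ) * 1 := by rw [mul_one]; exact h1
        _ ≤ ((2 + 2 ^ (μ + 1) / Γ) + (C + 2 / Γ)) * (2 ^ (1 - μ) * y ^ (μ - 1)) := by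
            refine mul_le_mul (by linarith) h2 zero_le_one (by linarith)
        _ = _ := by ring
    · intro k _ hk
      have : (1 : ℝ) ≤ k := by exact_mod_cast Nat.one_le_iff_ne_zero.2 hk
      rw [max_eq_right (by linarith), mul_zero]
  · set n := ⌊y - 1 - μ / 2⌋₊ with hn
    have hn1 : (n : ℝ) ≤ y - 1 - μ / 2 := Nat.floor_le (by linarith)
    have hn2 : y - 1 - μ / 2 < n + 1 := Nat.lt_floor_add_one _
    set m : ℝ := (n : ℝ) + 1 + μ / 2 with hm
    set θ : ℝ := y - m with hθ
    have hn0 : (0 : ℝ) ≤ n := by positivity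
    have hm0 : 0 < m := by positivity
    have hm1 : 1 ≤ m := by rw [hm]; linarith
    have hθ0 : 0 ≤ θ := by rw [hθ, hm]; linarith
    have hθ1 : θ ≤ 1 := by rw [hθ, hm]; linarith
    have hKn : n + 2 ≤ K := by
      have : ((n + 1 : ℕ) : ℝ) < K := by push_cast; linarith
      have := Nat.cast_lt.1 this
      omega
    have hsum : ∑ k ∈ Finset.range K, grunwald (-μ) k * max (y - k - μ / 2) 0
        = θ * grunwald (-(μ + 2)) (n + 1) + (1 - θ) * grunwald (-(μ + 2)) n := by
      rw [← Finset.sum_subset (Finset.range_subset_range.2 hKn)]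
      · have e1 : ∀ k ∈ Finset.range (n + 2), grunwald (-μ) k * max (y - k - μ / 2) 0
            = θ * (grunwald (-μ) k * (((n + 1 : ℕ) : ℝ) + 1 - k))
              + (1 - θ) * (grunwald (-μ) k * ((n : ℝ) + 1 - k)) := by
          intro k hk
          rw [Finset.mem_range] at hk
          have hk' : (k : ℝ) ≤ n + 1 := by exact_mod_cast Nat.lt_succ_iff.1 hk
          rw [max_eq_left (by linarith)]
          push_cast
          rw [hθ, hm]
          ring
        rw [Finset.sum_congr rfl e1, Finset.sum_add_distrib, ← Finset.mul_sum, ← Finset.mul_sum,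
          sum_grunwald_neg_mul, Finset.sum_range_succ, sum_grunwald_neg_mul]
        push_cast
        ring
      · intro k _ hk
        rw [Finset.mem_range, not_lt] at hk
        have hk' : (n : ℝ) + 2 ≤ k := by exact_mod_cast hk
        rw [max_eq_right (by linarith), mul_zero]
    have h1 := hG n
    have h2 := hG (n + 1)
    have h3 := abs_rpow_chord_sub_le hμ hμ₁ hm0 hθ0 hθ1
    rw [← hm] at h1
    have hm' : ((n + 1 : ℕ) : ℝ) + 1 + μ / 2 = m + 1 := by rw [hm]; push_cast; ring
    rw [hm'] at h2
    have hym : m + θ = y := by rw [hθ]; ring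
    rw [hym] at h3
    have hmono : (m + 1) ^ (μ - 1) ≤ m ^ (μ - 1) :=
      Real.rpow_le_rpow_of_nonpos hm0 (by linarith) (by linarith)
    have h2' := h2.trans (mul_le_mul_of_nonneg_left hmono hC)
    have hmy : m ^ (μ - 1) ≤ 2 ^ (1 - μ) * y ^ (μ - 1) := by
      have : (2 * m) ^ (μ - 1) ≤ y ^ (μ - 1) :=
        Real.rpow_le_rpow_of_nonpos hy (by linarith) (by linarith)
      rw [Real.mul_rpow (by norm_num) hm0.le] at this
      calc m ^ (μ - 1) = 2 ^ (1 - μ) * (2 ^ (μ - 1) * m ^ (μ - 1)) := by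
            rw [← mul_assoc, ← Real.rpow_add (by norm_num)]; simp
        _ ≤ _ := by gcongr
    rw [hsum]
    have e : θ * grunwald (-(μ + 2)) (n + 1) + (1 - θ) * grunwald (-(μ + 2)) n - y ^ (μ + 1) / Γ
        = θ * (grunwald (-(μ + 2)) (n + 1) - (m + 1) ^ (μ + 1) / Γ)
          + (1 - θ) * (grunwald (-(μ + 2)) n - m ^ (μ + 1) / Γ)
          + (θ * (m + 1) ^ (μ + 1) + (1 - θ) * m ^ (μ + 1) - y ^ (μ + 1)) / Γ := by
      ring
    rw [e]
    have hmp : 0 < m ^ (μ - 1) := by positivity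
    calc _ ≤ θ * (C * m ^ (μ - 1)) + (1 - θ) * (C * m ^ (μ - 1)) + 2 * m ^ (μ - 1) / Γ := by
          refine (abs_add_le _ _).trans (add_le_add ((abs_add_le _ _).trans (add_le_add ?_ ?_)) ?_)
          · rw [abs_mul, abs_of_nonneg hθ0]; gcongr
          · rw [abs_mul, abs_of_nonneg (by linarith : 0 ≤ 1 - θ)]
            exact mul_le_mul_of_nonneg_left h1 (by linarith)
          · rw [abs_div, abs_of_pos hΓ]; gcongr
      _ = (C + 2 / Γ) * m ^ (μ - 1) := by ring
      _ ≤ ((2 + 2 ^ (μ + 1) / Γ) + (C + 2 / Γ)) * (2 ^ (1 - μ) * y ^ (μ - 1)) := by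
          have h4 : 0 ≤ 2 + 2 ^ (μ + 1) / Γ := by positivity
          have h5 : 0 ≤ C + 2 / Γ := by positivity
          exact mul_le_mul (by linarith) hmy hmp.le (by linarith)
      _ = _ := by ring

/-! ### Truncation error of the spatial operators for `β < 2` -/

/-- `V 0` is a `C³` function on the line, vanishing outside `(a, b)`, with derivatives
`V 1`, `V 2`, `V 3`, whose fourth derivative `V 4` on `(a, b)` is continuous up to the end points
and bounded by `L`. -/
structure IsC3Extension (a b L : ℝ) (V : ℕ → ℝ → ℝ) : Prop where
  hasDerivAt : ∀ m < 3, ∀ x, HasDerivAt (V m) (V (m + 1) x) x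
  hasDerivAt_three : ∀ x ∈ Ioo a b, HasDerivAt (V 3) (V 4 x) x
  continuousOn_four : ContinuousOn (V 4) (Icc a b)
  abs_four_le : ∀ x ∈ Icc a b, |V 4 x| ≤ L
  eq_zero : ∀ m ≤ 3, ∀ x ∉ Ioo a b, V m x = 0
  lipschitz : ∀ x y, |V 3 x - V 3 y| ≤ L * |x - y|

lemma sum_range_eq_of_eq_zero {f : ℕ → ℝ} {n m : ℕ} (hnm : n ≤ m) (hf : ∀ k, n ≤ k → f k = 0) :
    ∑ k ∈ Finset.range m, f k = ∑ k ∈ Finset.range n, f k := by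
  symm
  refine Finset.sum_subset (Finset.range_subset_range.2 hnm) fun k _ hk => hf k ?_
  simpa using hk

lemma sum_grunwald_mul_eq_of_eq_zero (β : ℝ) {F : ℕ → ℝ} {n : ℕ} (hF : ∀ k, n ≤ k → F k = 0) :
    ∑ k ∈ Finset.range n, grunwald β k * F k
      = ∑ k ∈ Finset.range n, grunwald (β - 1) k * (F k - F (k + 1)) := by
  have h : ∀ m, ∑ k ∈ Finset.range (m + 1), grunwald β k * F k
      = ∑ k ∈ Finset.range (m + 1), grunwald (β - 1) k * F k
        - ∑ k ∈ Finset.range m, grunwald (β - 1) k * F (k + 1) := by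
    intro m
    induction m with
    | zero => simp [grunwald_zero]
    | succ m ih =>
      rw [Finset.sum_range_succ, ih, Finset.sum_range_succ _ (m + 1),
        Finset.sum_range_succ (fun k => grunwald (β - 1) k * F (k + 1)) m, grunwald_succ_eq_sub]
      ring
  have h1 := h n
  rw [sum_range_eq_of_eq_zero (n := n) (m := n + 1) (by omega) (fun k hk => by rw [hF k hk, mul_zero]),
    sum_range_eq_of_eq_zero (n := n) (m := n + 1) (by omega)
      (fun k hk => by rw [hF k hk, mul_zero])] at h1
  rw [h1, ← Finset.sum_sub_distrib]
  refine Finset.sum_congr rfl fun k _ => ?_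
  ring

lemma sum_weight_mul_eq_of_eq_zero (β : ℝ) {F : ℕ → ℝ} {n : ℕ} (hF : ∀ k, n ≤ k → F k = 0) :
    ∑ k ∈ Finset.range n, weight β k * F k
      = ∑ k ∈ Finset.range n, grunwald β k * ((β ^ 2 + 3 * β + 2) / 12 * F k
        + (4 - β ^ 2) / 6 * F (k + 1) + (β ^ 2 - 3 * β + 2) / 12 * F (k + 2)) := by
  have h : ∀ m, ∑ k ∈ Finset.range (m + 2), weight β k * F k
      = (β ^ 2 + 3 * β + 2) / 12 * ∑ k ∈ Finset.range (m + 2), grunwald β k * F k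
        + (4 - β ^ 2) / 6 * ∑ k ∈ Finset.range (m + 1), grunwald β k * F (k + 1)
        + (β ^ 2 - 3 * β + 2) / 12 * ∑ k ∈ Finset.range m, grunwald β k * F (k + 2) := by
    intro m
    induction m with
    | zero =>
      simp only [zero_add, Finset.sum_range_succ, Finset.sum_range_zero, weight]
      ring
    | succ m ih =>
      rw [Finset.sum_range_succ _ (m + 2), ih, Finset.sum_range_succ (fun k => grunwald β k * F k) (m + 2),
        Finset.sum_range_succ (fun k => grunwald β k * F (k + 1)) (m + 1),
        Finset.sum_range_succ (fun k => grunwald β k * F (k + 2)) m, weight]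
      ring
  have h1 := h n
  rw [sum_range_eq_of_eq_zero (n := n) (m := n + 2) (by omega) (fun k hk => by rw [hF k hk, mul_zero]),
    sum_range_eq_of_eq_zero (n := n) (m := n + 2) (by omega) (fun k hk => by rw [hF k hk, mul_zero]),
    sum_range_eq_of_eq_zero (n := n) (m := n + 1) (by omega)
      (fun k hk => by rw [hF (k + 1) (by omega), mul_zero])] at h1
  rw [h1, Finset.mul_sum, Finset.mul_sum, Finset.mul_sum, ← Finset.sum_add_distrib,
    ← Finset.sum_add_distrib]
  refine Finset.sum_congr rfl fun k _ => ?_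
  ring

lemma sum_weight_mul_eq_sum_second_difference (β : ℝ) {F : ℕ → ℝ} {n : ℕ}
    (hF : ∀ k, n ≤ k → F k = 0) :
    ∑ k ∈ Finset.range n, weight β k * F k
      = ∑ k ∈ Finset.range n, grunwald (-(2 - β)) k *
        ((β ^ 2 + 3 * β + 2) / 12 * (F k - 2 * F (k + 1) + F (k + 2))
        + (4 - β ^ 2) / 6 * (F (k + 1) - 2 * F (k + 2) + F (k + 3))
        + (β ^ 2 - 3 * β + 2) / 12 * (F (k + 2) - 2 * F (k + 3) + F (k + 4))) := by
  rw [sum_weight_mul_eq_of_eq_zero β hF, sum_grunwald_mul_eq_of_eq_zero β (n := n)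
    (F := fun k => (β ^ 2 + 3 * β + 2) / 12 * F k
        + (4 - β ^ 2) / 6 * F (k + 1) + (β ^ 2 - 3 * β + 2) / 12 * F (k + 2)),
    sum_grunwald_mul_eq_of_eq_zero (β - 1) (n := n)
    (F := fun k => ((β ^ 2 + 3 * β + 2) / 12 * F k
        + (4 - β ^ 2) / 6 * F (k + 1) + (β ^ 2 - 3 * β + 2) / 12 * F (k + 2))
        - ((β ^ 2 + 3 * β + 2) / 12 * F (k + 1)
        + (4 - β ^ 2) / 6 * F (k + 1 + 1) + (β ^ 2 - 3 * β + 2) / 12 * F (k + 1 + 2)))]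
  · rw [show β - 1 - 1 = -(2 - β) by ring]
    refine Finset.sum_congr rfl fun k _ => ?_
    rw [show k + 1 + 1 = k + 2 by ring, show k + 1 + 2 = k + 3 by ring,
      show k + 2 + 1 = k + 3 by ring, show k + 2 + 2 = k + 4 by ring]
    ring
  · intro k hk
    simp only [hF k hk, hF (k + 1) (by omega), hF (k + 2) (by omega),
      hF (k + 1 + 2) (by omega)]
    ring
  · intro k hk
    simp only [hF k hk, hF (k + 1) (by omega), hF (k + 2) (by omega)]
    ring

namespace IsC3Extension

variable {a b L : ℝ} {V : ℕ → ℝ → ℝ}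

lemma nonneg (hV : IsC3Extension a b L V) (hab : a ≤ b) : 0 ≤ L :=
  (abs_nonneg _).trans (hV.abs_four_le a ⟨le_rfl, hab⟩)

lemma continuous_three (hV : IsC3Extension a b L V) (hab : a ≤ b) : Continuous (V 3) := by
  have : LipschitzWith ⟨L, hV.nonneg hab⟩ (V 3) :=
    LipschitzWith.of_dist_le_mul fun x y => by
      rw [Real.dist_eq, Real.dist_eq]
      exact hV.lipschitz x y
  exact this.continuous

lemma continuous_two (hV : IsC3Extension a b L V) : Continuous (V 2) :=
  continuous_iff_continuousAt.2 fun x => (hV.hasDerivAt 2 (by norm_num) x).continuousAt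

lemma second_derivative_eq_integral (hV : IsC3Extension a b L V) (hab : a ≤ b) {x y : ℝ}
    (hax : a ≤ x) (hxb : x ≤ b) (hyx : y ≤ x) :
    V 2 y = ∫ z in a..x, max (y - z) 0 * V 4 z := by
  have h4 : ContinuousOn (V 4) (Icc a x) := hV.continuousOn_four.mono (Icc_subset_Icc le_rfl hxb)
  have hint : ∀ p q, a ≤ p → p ≤ q → q ≤ x →
      IntervalIntegrable (fun z => max (y - z) 0 * V 4 z) volume p q := by
    intro p q hp hpq hq
    refine ContinuousOn.intervalIntegrable ?_
    rw [uIcc_of_le hpq]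
    exact ((by fun_prop : Continuous fun z : ℝ => max (y - z) 0).continuousOn).mul
      (h4.mono (Icc_subset_Icc hp hq))
  rcases le_total y a with hya | hya
  · rw [hV.eq_zero 2 (by norm_num) y (fun h => absurd h.1 (not_lt.2 hya))]
    symm
    refine intervalIntegral.integral_zero_ae (Filter.Eventually.of_forall fun z hz => ?_)
    rw [uIoc_of_le hax] at hz
    rw [max_eq_right (by linarith [hz.1]), zero_mul]
  · rw [← intervalIntegral.integral_add_adjacent_intervals (hint a y le_rfl hya hyx)
      (hint y x hya hyx le_rfl)]
    have h1 : ∫ z in y..x, max (y - z) 0 * V 4 z = 0 := by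
      refine intervalIntegral.integral_zero_ae (Filter.Eventually.of_forall fun z hz => ?_)
      rw [uIoc_of_le hyx] at hz
      rw [max_eq_right (by linarith [hz.1]), zero_mul]
    have h2 : ∫ z in a..y, max (y - z) 0 * V 4 z = V 2 y := by
      have h3 : ∫ z in a..y, max (y - z) 0 * V 4 z
          = ((y - y) * V 3 y + V 2 y) - ((y - a) * V 3 a + V 2 a) := by
        refine intervalIntegral.integral_eq_sub_of_hasDerivAt_of_le
          (f := fun z => (y - z) * V 3 z + V 2 z) hya ?_ ?_ (hint a y le_rfl hya hyx)
        · exact ((by fun_prop : Continuous fun z : ℝ => y - z).mul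
            (hV.continuous_three hab)).add hV.continuous_two |>.continuousOn
        · intro z hz
          have hd3 := hV.hasDerivAt_three z ⟨hz.1, hz.2.trans_le (hyx.trans hxb)⟩
          have := (((hasDerivAt_id z).const_sub y).mul hd3).add (hV.hasDerivAt 2 (by norm_num) z)
          refine this.congr_deriv ?_
          rw [max_eq_left (by linarith [hz.2])]
          simp only [id]
          ring
      rw [h3, hV.eq_zero 3 le_rfl a (fun h => absurd h.1 (lt_irrefl _)),
        hV.eq_zero 2 (by norm_num) a (fun h => absurd h.1 (lt_irrefl _))]
      ring
    rw [h1, h2, add_zero]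

lemma fractional_integral_eq (hV : IsC3Extension a b L V) (hab : a ≤ b) {x μ : ℝ} (hμ : 0 < μ)
    (hax : a ≤ x) (hxb : x ≤ b) :
    1 / Real.Gamma μ * ∫ z in a..x, V 2 z * (x - z) ^ (μ - 1)
      = ∫ z in a..x, (x - z) ^ (μ + 1) / Real.Gamma (μ + 2) * V 4 z := by
  have hΓ0 : 0 < Real.Gamma μ := Real.Gamma_pos_of_pos hμ
  have hΓ1 : Real.Gamma (μ + 1) = μ * Real.Gamma μ := Real.Gamma_add_one hμ.ne'
  have hΓ2 : Real.Gamma (μ + 2) = (μ + 1) * Real.Gamma (μ + 1) := by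
    rw [show μ + 2 = μ + 1 + 1 by ring, Real.Gamma_add_one (by linarith)]
  have hΓ1' : 0 < Real.Gamma (μ + 1) := Real.Gamma_pos_of_pos (by linarith)
  have h4 : ContinuousOn (V 4) (Icc a x) := hV.continuousOn_four.mono (Icc_subset_Icc le_rfl hxb)
  have hK : IntervalIntegrable (fun z : ℝ => (x - z) ^ (μ - 1)) volume a x := by
    have := intervalIntegrable_sub_rpow (α := 1 - μ) (t := x) (x := a) (y := x) (by linarith)
    rwa [neg_sub] at this
  have hi1 : IntervalIntegrable (fun z => 1 / Real.Gamma μ * (V 2 z * (x - z) ^ (μ - 1)))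
      volume a x := (hK.continuousOn_mul hV.continuous_two.continuousOn).const_mul _
  have hpc : Continuous fun z : ℝ => (x - z) ^ (μ + 1) :=
    (by fun_prop : Continuous fun z : ℝ => x - z).rpow_const fun _ => Or.inr (by linarith)
  have hpc0 : Continuous fun z : ℝ => (x - z) ^ μ :=
    (by fun_prop : Continuous fun z : ℝ => x - z).rpow_const fun _ => Or.inr hμ.le
  have hi2 : IntervalIntegrable (fun z => (x - z) ^ (μ + 1) / Real.Gamma (μ + 2) * V 4 z)
      volume a x := by
    refine ContinuousOn.intervalIntegrable ?_
    rw [uIcc_of_le hax]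
    exact (hpc.div_const _).continuousOn.mul h4
  rw [← intervalIntegral.integral_const_mul, ← sub_eq_zero, ← intervalIntegral.integral_sub hi1 hi2]
  rw [intervalIntegral.integral_eq_sub_of_hasDerivAt_of_le
    (f := fun z => -(V 2 z * (x - z) ^ μ / Real.Gamma (μ + 1))
      - V 3 z * (x - z) ^ (μ + 1) / Real.Gamma (μ + 2)) hax ?_ ?_ (hi1.sub hi2)]
  · simp only [sub_self]
    rw [hV.eq_zero 3 le_rfl a (fun h => absurd h.1 (lt_irrefl _)),
      hV.eq_zero 2 (by norm_num) a (fun h => absurd h.1 (lt_irrefl _)),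
      Real.zero_rpow hμ.ne', Real.zero_rpow (by linarith)]
    simp
  · exact ((hV.continuous_two.mul hpc0).div_const _).neg.sub
      (((hV.continuous_three hab).mul hpc).div_const _) |>.continuousOn
  · intro z hz
    have hxz : 0 < x - z := by linarith [hz.2]
    have hd3 := hV.hasDerivAt_three z ⟨hz.1, hz.2.trans_le hxb⟩
    have hd2 := hV.hasDerivAt 2 (by norm_num) z
    have hp : ∀ p : ℝ, HasDerivAt (fun z : ℝ => (x - z) ^ p) (-1 * p * (x - z) ^ (p - 1)) z :=
      fun p => ((hasDerivAt_id z).const_sub x).rpow_const (Or.inl hxz.ne')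
    have := ((hd2.mul (hp μ)).div_const (Real.Gamma (μ + 1))).neg.sub
      ((hd3.mul (hp (μ + 1))).div_const (Real.Gamma (μ + 2)))
    refine this.congr_deriv ?_
    rw [hΓ2, hΓ1, add_sub_cancel_right]
    have : μ + 1 ≠ 0 := by linarith
    field_simp
    ring

end IsC3Extension

lemma grunwald_quadrature_error {μ : ℝ} (hμ : 0 < μ) (hμ₁ : μ < 1) {a b : ℝ} (hab : a < b) :
    ∃ C : ℝ, 0 ≤ C ∧ ∀ (L : ℝ) (V : ℕ → ℝ → ℝ), IsC3Extension a b L V →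
      ∀ (h x : ℝ) (K : ℕ), 0 < h → a ≤ x → x ≤ b → x - a ≤ K * h →
        |h ^ μ * ∑ k ∈ Finset.range K, grunwald (-μ) k * V 2 (x - k * h - μ * h / 2)
          - 1 / Real.Gamma μ * ∫ z in a..x, V 2 z * (x - z) ^ (μ - 1)| ≤ C * L * h ^ 2 := by
  obtain ⟨C, hC, hker⟩ := abs_grunwald_kernel_le hμ hμ₁
  have hba : 0 < b - a := by linarith
  refine ⟨C * ((b - a) ^ μ / μ), by positivity, ?_⟩
  intro L V hV h x K hh hax hxb hK
  have hL := hV.nonneg hab.le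
  have h4 : ContinuousOn (V 4) (Icc a x) := hV.continuousOn_four.mono (Icc_subset_Icc le_rfl hxb)
  set κ : ℝ → ℝ := fun z => h ^ μ * (∑ k ∈ Finset.range K, grunwald (-μ) k *
    max (x - k * h - μ * h / 2 - z) 0) - (x - z) ^ (μ + 1) / Real.Gamma (μ + 2) with hκ
  have hpc : Continuous fun z : ℝ => (x - z) ^ (μ + 1) :=
    (by fun_prop : Continuous fun z : ℝ => x - z).rpow_const fun _ => Or.inr (by linarith)
  have hmaxint : ∀ y : ℝ, IntervalIntegrable (fun z => max (y - z) 0 * V 4 z) volume a x := by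
    intro y
    refine ContinuousOn.intervalIntegrable ?_
    rw [uIcc_of_le hax]
    exact ((by fun_prop : Continuous fun z : ℝ => max (y - z) 0).continuousOn).mul h4
  have hpint : IntervalIntegrable (fun z => (x - z) ^ (μ + 1) / Real.Gamma (μ + 2) * V 4 z)
      volume a x := by
    refine ContinuousOn.intervalIntegrable ?_
    rw [uIcc_of_le hax]
    exact (hpc.div_const _).continuousOn.mul h4
  have hrep : h ^ μ * ∑ k ∈ Finset.range K, grunwald (-μ) k * V 2 (x - k * h - μ * h / 2)
      - 1 / Real.Gamma μ * ∫ z in a..x, V 2 z * (x - z) ^ (μ - 1) = ∫ z in a..x, κ z * V 4 z := by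
    rw [hV.fractional_integral_eq hab.le hμ hax hxb]
    have e1 : ∀ k ∈ Finset.range K, grunwald (-μ) k * V 2 (x - k * h - μ * h / 2)
        = ∫ z in a..x, grunwald (-μ) k * (max (x - k * h - μ * h / 2 - z) 0 * V 4 z) := by
      intro k _
      rw [intervalIntegral.integral_const_mul,
        ← hV.second_derivative_eq_integral hab.le hax hxb]
      have : 0 ≤ (k : ℝ) * h := by positivity
      have : 0 ≤ μ * h / 2 := by positivity
      linarith
    rw [Finset.sum_congr rfl e1, ← intervalIntegral.integral_finsetSum
      (fun k _ => (hmaxint _).const_mul _), ← intervalIntegral.integral_const_mul,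
      ← intervalIntegral.integral_sub _ hpint]
    · refine intervalIntegral.integral_congr fun z _ => ?_
      simp only [hκ]
      rw [sub_mul, mul_assoc (h ^ μ), Finset.sum_mul]
      congr 2
      refine Finset.sum_congr rfl fun k _ => ?_
      ring
    · refine IntervalIntegrable.const_mul ?_ _
      have := IntervalIntegrable.sum (μ := volume) (a := a) (b := x) (Finset.range K)
        (f := fun k z => grunwald (-μ) k * (max (x - k * h - μ * h / 2 - z) 0 * V 4 z))
        (fun k _ => (hmaxint _).const_mul _)
      rwa [Finset.sum_fn] at this
  have hκb : ∀ z ∈ Ioo a x, |κ z| ≤ C * h ^ 2 * (x - z) ^ (μ - 1) := by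
    intro z hz
    have hxz : 0 < x - z := by linarith [hz.2]
    set y := (x - z) / h with hy
    have hy0 : 0 < y := by positivity
    have hyK : y ≤ K := by
      rw [hy, div_le_iff₀ hh]
      linarith [hz.1]
    have hxy : x - z = h * y := by rw [hy]; field_simp
    have hb := hker y K hy0 hyK
    have e : κ z = h ^ (μ + 1) * (∑ k ∈ Finset.range K, grunwald (-μ) k * max (y - k - μ / 2) 0
        - y ^ (μ + 1) / Real.Gamma (μ + 2)) := by
      simp only [hκ]
      have hs : ∑ k ∈ Finset.range K, grunwald (-μ) k * max (x - k * h - μ * h / 2 - z) 0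
          = h * ∑ k ∈ Finset.range K, grunwald (-μ) k * max (y - k - μ / 2) 0 := by
        rw [Finset.mul_sum]
        refine Finset.sum_congr rfl fun k _ => ?_
        have : max (x - k * h - μ * h / 2 - z) 0 = h * max (y - k - μ / 2) 0 := by
          rw [mul_max_of_nonneg _ _ hh.le, mul_zero]
          congr 1
          rw [show x - k * h - μ * h / 2 - z = (x - z) - k * h - μ * h / 2 by ring, hxy]
          ring
        rw [this]
        ring
      rw [hs, hxy, Real.mul_rpow hh.le hy0.le, Real.rpow_add_one hh.ne']
      ring
    have hp1 : h ^ (μ + 1) = h ^ 2 * h ^ (μ - 1) := by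
      rw [← Real.rpow_natCast h 2, ← Real.rpow_add hh]
      norm_num
      ring_nf
    rw [e, abs_mul, abs_of_pos (by positivity)]
    calc _ ≤ h ^ (μ + 1) * (C * y ^ (μ - 1)) := by gcongr
      _ = C * h ^ 2 * (h * y) ^ (μ - 1) := by
          rw [Real.mul_rpow hh.le hy0.le, hp1]
          ring
      _ = _ := by rw [hxy]
  rw [hrep, ← Real.norm_eq_abs]
  have hK1 : IntervalIntegrable (fun z : ℝ => (x - z) ^ (μ - 1)) volume a x := by
    have := intervalIntegrable_sub_rpow (α := 1 - μ) (t := x) (x := a) (y := x) (by linarith)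
    rwa [neg_sub] at this
  have hint := intervalIntegral.norm_integral_le_of_norm_le (μ := volume)
    (f := fun z => κ z * V 4 z) (g := fun z => C * h ^ 2 * L * (x - z) ^ (μ - 1)) hax ?_
    (hK1.const_mul _)
  · refine hint.trans ?_
    rw [intervalIntegral.integral_const_mul,
      intervalIntegral.integral_comp_sub_left (fun z => z ^ (μ - 1)), sub_self,
      integral_rpow (Or.inl (by linarith)), sub_add_cancel, Real.zero_rpow hμ.ne', sub_zero]
    have : (x - a) ^ μ ≤ (b - a) ^ μ := Real.rpow_le_rpow (by linarith) (by linarith) hμ.le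
    calc C * h ^ 2 * L * ((x - a) ^ μ / μ) ≤ C * h ^ 2 * L * ((b - a) ^ μ / μ) := by gcongr
      _ = _ := by ring
  · have hne : ∀ᵐ z : ℝ, z ≠ x := by simp [ae_iff, measure_singleton]
    filter_upwards [hne] with z hzx hz
    have hz' : z ∈ Ioo a x := ⟨hz.1, lt_of_le_of_ne hz.2 hzx⟩
    rw [norm_mul, Real.norm_eq_abs, Real.norm_eq_abs]
    have h5 := hκb z hz'
    have h6 := hV.abs_four_le z ⟨hz.1.le, hz.2.trans hxb⟩
    calc |κ z| * |V 4 z| ≤ (C * h ^ 2 * (x - z) ^ (μ - 1)) * L :=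
          mul_le_mul h5 h6 (abs_nonneg _) ((abs_nonneg _).trans h5)
      _ = _ := by ring

lemma IsC3Extension.abs_weighted_second_difference_sub_le {a b L β h x : ℝ} {V : ℕ → ℝ → ℝ}
    (hV : IsC3Extension a b L V) (hab : a ≤ b) (h₁ : 1 ≤ β) (h₂ : β ≤ 2) :
    |(β ^ 2 + 3 * β + 2) / 12 * (V 0 (x + h) - 2 * V 0 x + V 0 (x - h))
        + (4 - β ^ 2) / 6 * (V 0 x - 2 * V 0 (x - h) + V 0 (x - 2 * h))
        + (β ^ 2 - 3 * β + 2) / 12 * (V 0 (x - h) - 2 * V 0 (x - 2 * h) + V 0 (x - 3 * h))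
      - h ^ 2 * V 2 (x - (2 - β) * h / 2)| ≤ 12 * L * h ^ 4 := by
  have hL := hV.nonneg hab
  set y := x - (2 - β) * h / 2 with hy
  have hd : ∀ m < 3, ∀ z ∈ (univ : Set ℝ), HasDerivWithinAt (V m) (V (m + 1) z) univ z :=
    fun m hm z _ => (hV.hasDerivAt m hm z).hasDerivWithinAt
  have key : ∀ θ : ℝ, |θ| ≤ 2 → ∀ c, c = y + θ * h →
      |V 0 (c + h) - 2 * V 0 c + V 0 (c - h) - h ^ 2 * V 2 y - h ^ 2 * (θ * h) * V 3 y|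
        ≤ 6 * L * h ^ 4 := by
    intro θ hθ c hc
    have e1 := abs_second_difference_sub_le convex_univ hL (x := c) (h := h) (mem_univ _)
      (mem_univ _) (mem_univ _) (hd 0 (by norm_num)) (hd 1 (by norm_num)) (hd 2 (by norm_num))
      (fun z _ => hV.lipschitz z c)
    have e2 := taylor_one convex_univ hL (x := y) (y := c) (mem_univ _) (mem_univ _)
      (hd 2 (by norm_num)) (fun z _ => hV.lipschitz z y)
    rw [show c - y = θ * h by rw [hc]; ring] at e2
    have e3 : |θ * h| ^ 2 ≤ 4 * h ^ 2 := by
      rw [sq_abs, mul_pow]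
      have : θ ^ 2 ≤ 2 ^ 2 := sq_le_sq' (by linarith [(abs_le.1 hθ).1]) (abs_le.1 hθ).2
      nlinarith [sq_nonneg h]
    have e4 : |h| ^ 4 = h ^ 4 := by
      rw [show (4 : ℕ) = 2 * 2 by norm_num, pow_mul, sq_abs, ← pow_mul]
    rw [e4] at e1
    have e5 : V 0 (c + h) - 2 * V 0 c + V 0 (c - h) - h ^ 2 * V 2 y - h ^ 2 * (θ * h) * V 3 y
        = (V 0 (c + h) - 2 * V 0 c + V 0 (c - h) - h ^ 2 * V 2 c)
          + h ^ 2 * (V 2 c - V 2 y - θ * h * V 3 y) := by ring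
    rw [e5]
    refine (abs_add_le _ _).trans ?_
    rw [abs_mul, abs_of_nonneg (sq_nonneg h)]
    have e6 : h ^ 2 * |V 2 c - V 2 y - θ * h * V 3 y| ≤ h ^ 2 * (L * (4 * h ^ 2)) := by
      gcongr
      exact e2.trans (by gcongr)
    linarith
  have k0 := key ((2 - β) / 2) (by rw [abs_le]; constructor <;> linarith) x (by rw [hy]; ring)
  have k1 := key ((2 - β) / 2 - 1) (by rw [abs_le]; constructor <;> linarith) (x - h)
    (by rw [hy]; ring)
  have k2 := key ((2 - β) / 2 - 2) (by rw [abs_le]; constructor <;> linarith) (x - 2 * h)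
    (by rw [hy]; ring)
  rw [show x - h + h = x by ring, show x - h - h = x - 2 * h by ring] at k1
  rw [show x - 2 * h + h = x - h by ring, show x - 2 * h - h = x - 3 * h by ring] at k2
  set A := V 0 (x + h) - 2 * V 0 x + V 0 (x - h) with hA
  set B := V 0 x - 2 * V 0 (x - h) + V 0 (x - 2 * h) with hB
  set D := V 0 (x - h) - 2 * V 0 (x - 2 * h) + V 0 (x - 3 * h) with hD
  have e : (β ^ 2 + 3 * β + 2) / 12 * A + (4 - β ^ 2) / 6 * B + (β ^ 2 - 3 * β + 2) / 12 * D
      - h ^ 2 * V 2 y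
      = (β ^ 2 + 3 * β + 2) / 12 *
          (A - h ^ 2 * V 2 y - h ^ 2 * ((2 - β) / 2 * h) * V 3 y)
        + (4 - β ^ 2) / 6 * (B - h ^ 2 * V 2 y - h ^ 2 * (((2 - β) / 2 - 1) * h) * V 3 y)
        + (β ^ 2 - 3 * β + 2) / 12 *
          (D - h ^ 2 * V 2 y - h ^ 2 * (((2 - β) / 2 - 2) * h) * V 3 y) := by
    ring
  have hc : ∀ w X M : ℝ, |X| ≤ 6 * L * h ^ 4 → |w| ≤ M → |w * X| ≤ M * (6 * L * h ^ 4) := by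
    intro w X M hX hw
    rw [abs_mul]
    exact mul_le_mul hw hX (abs_nonneg _) ((abs_nonneg _).trans hw)
  rw [e]
  have c0 := hc ((β ^ 2 + 3 * β + 2) / 12) _ 1 k0
    (by rw [abs_le]; constructor <;> nlinarith)
  have c1 := hc ((4 - β ^ 2) / 6) _ (1 / 2) k1
    (by rw [abs_le]; constructor <;> nlinarith)
  have c2 := hc ((β ^ 2 - 3 * β + 2) / 12) _ (1 / 2) k2
    (by rw [abs_le]; constructor <;> nlinarith)
  refine (abs_add_le _ _).trans ((add_le_add ((abs_add_le _ _).trans (add_le_add c0 c1)) c2).trans ?_)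
  apply le_of_eq
  ring

lemma left_truncation_of_lt_two {β a b : ℝ} (h₁ : 1 < β) (h₂ : β < 2) (hab : a < b) :
    ∃ C : ℝ, 0 ≤ C ∧ ∀ (L : ℝ) (V : ℕ → ℝ → ℝ), IsC3Extension a b L V →
      ∀ (N i : ℕ), i < N → ∀ h : ℝ, h = (b - a) / N →
        |1 / h ^ β * ∑ k ∈ Finset.range (i + 2), weight β k * V 0 (a + ((i + 1 - k : ℕ) : ℝ) * h)
          - 1 / Real.Gamma (2 - β) * ∫ z in a..(a + i * h), V 2 z * (a + i * h - z) ^ (1 - β)|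
          ≤ C * L * h ^ 2 := by
  have hμ : 0 < 2 - β := by linarith
  have hμ₁ : 2 - β < 1 := by linarith
  obtain ⟨C₁, hC₁, hquad⟩ := grunwald_quadrature_error hμ hμ₁ hab
  obtain ⟨C₂, hC₂, hsum⟩ := sum_grunwald_neg_le hμ hμ₁
  have hba : 0 < b - a := by linarith
  refine ⟨12 * C₂ * (b - a) ^ (2 - β) + C₁, by positivity, ?_⟩
  intro L V hV N i hi h hh
  have hL := hV.nonneg hab.le
  have hN : (0 : ℝ) < N := by exact_mod_cast (by omega : 0 < N)
  have hh0 : 0 < h := by rw [hh]; positivity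
  have hNh : N * h = b - a := by rw [hh]; field_simp
  set x := a + i * h with hx
  have hih : ((i : ℝ) + 1) * h ≤ b - a := by
    rw [← hNh]
    have : (i : ℝ) + 1 ≤ N := by exact_mod_cast hi
    gcongr
  have hi0 : (0 : ℝ) ≤ i * h := by positivity
  set F : ℕ → ℝ := fun k => V 0 (x + h - k * h) with hF
  have hF0 : ∀ k, i + 1 ≤ k → F k = 0 := by
    intro k hk
    have hk' : ((i : ℝ) + 1) ≤ k := by exact_mod_cast hk
    refine hV.eq_zero 0 (by norm_num) _ fun hm => absurd hm.1 (not_lt.2 ?_)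
    rw [hx]
    nlinarith
  have hS : ∑ k ∈ Finset.range (i + 2), weight β k * V 0 (a + ((i + 1 - k : ℕ) : ℝ) * h)
      = ∑ k ∈ Finset.range (i + 1), weight β k * F k := by
    rw [← sum_range_eq_of_eq_zero (f := fun k => weight β k * F k) (n := i + 1) (m := i + 2)
      (by omega) (fun k hk => by simp only [hF0 k hk, mul_zero])]
    refine Finset.sum_congr rfl fun k hk => ?_
    rw [Finset.mem_range] at hk
    rw [Nat.cast_sub (by omega)]
    simp only [hF]
    congr 2
    rw [hx]
    push_cast
    ring
  rw [hS, sum_weight_mul_eq_sum_second_difference β hF0]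
  have hq := hquad L V hV h x (i + 1) hh0 (by rw [hx]; linarith) (by rw [hx]; linarith)
    (by rw [hx]; push_cast; linarith)
  rw [show 2 - β - 1 = 1 - β by ring] at hq
  set Q := ∑ k ∈ Finset.range (i + 1),
    grunwald (-(2 - β)) k * V 2 (x - k * h - (2 - β) * h / 2) with hQ
  set R := ∑ k ∈ Finset.range (i + 1), grunwald (-(2 - β)) k *
        ((β ^ 2 + 3 * β + 2) / 12 * (F k - 2 * F (k + 1) + F (k + 2))
        + (4 - β ^ 2) / 6 * (F (k + 1) - 2 * F (k + 2) + F (k + 3))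
        + (β ^ 2 - 3 * β + 2) / 12 * (F (k + 2) - 2 * F (k + 3) + F (k + 4))) with hR
  have hRQ : |R - h ^ 2 * Q| ≤ C₂ * ((i : ℝ) + 1) ^ (2 - β) * (12 * L * h ^ 4) := by
    rw [hR, hQ, Finset.mul_sum, ← Finset.sum_sub_distrib]
    calc _ ≤ ∑ k ∈ Finset.range (i + 1), grunwald (-(2 - β)) k * (12 * L * h ^ 4) := by
          refine (Finset.abs_sum_le_sum_abs _ _).trans (Finset.sum_le_sum fun k _ => ?_)
          have hg := (grunwald_neg_pos hμ k).le
          have hw := hV.abs_weighted_second_difference_sub_le (x := x - k * h) (h := h) hab.le h₁.le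
            h₂.le
          rw [mul_left_comm, ← mul_sub, abs_mul, abs_of_nonneg hg]
          refine mul_le_mul_of_nonneg_left (le_trans (le_of_eq ?_) hw) hg
          simp only [hF]
          push_cast
          rw [show x + h - k * h = x - k * h + h by ring,
            show x + h - (k + 1) * h = x - k * h by ring,
            show x + h - (k + 2) * h = x - k * h - h by ring,
            show x + h - (k + 3) * h = x - k * h - 2 * h by ring,
            show x + h - (k + 4) * h = x - k * h - 3 * h by ring]
      _ ≤ _ := by
          rw [← Finset.sum_mul]
          have := hsum i
          gcongr
  have hhβ : 0 < h ^ β := by positivity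
  have hpow : h ^ (2 - β) = h ^ 2 / h ^ β := by
    rw [Real.rpow_sub hh0]
    norm_num
  have e : 1 / h ^ β * R - 1 / Real.Gamma (2 - β) * ∫ z in a..x, V 2 z * (x - z) ^ (1 - β)
      = 1 / h ^ β * (R - h ^ 2 * Q) + (h ^ (2 - β) * Q
        - 1 / Real.Gamma (2 - β) * ∫ z in a..x, V 2 z * (x - z) ^ (1 - β)) := by
    rw [hpow]
    ring
  rw [e]
  refine (abs_add_le _ _).trans ?_
  rw [abs_mul, abs_of_pos (by positivity : 0 < 1 / h ^ β)]
  have h5 : 1 / h ^ β * |R - h ^ 2 * Q| ≤ 12 * C₂ * (b - a) ^ (2 - β) * L * h ^ 2 := by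
    calc _ ≤ 1 / h ^ β * (C₂ * ((i : ℝ) + 1) ^ (2 - β) * (12 * L * h ^ 4)) := by gcongr
      _ = 12 * C₂ * (((i : ℝ) + 1) * h) ^ (2 - β) * L * h ^ 2 := by
          rw [Real.mul_rpow (by positivity) hh0.le, hpow]
          ring
      _ ≤ _ := by
          have : (((i : ℝ) + 1) * h) ^ (2 - β) ≤ (b - a) ^ (2 - β) :=
            Real.rpow_le_rpow (by positivity) hih hμ.le
          gcongr
  linarith

/-! ### Riemann-Liouville derivatives of functions vanishing at the boundary -/

lemma IsC3Extension.exists_bound {a b L : ℝ} {V : ℕ → ℝ → ℝ} (hV : IsC3Extension a b L V)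
    {m : ℕ} (hm : m < 3) : ∃ B, ∀ x, |V m x| ≤ B := by
  have hc : Continuous (V m) :=
    continuous_iff_continuousAt.2 fun x => (hV.hasDerivAt m hm x).continuousAt
  obtain ⟨B, hB⟩ := isCompact_Icc.exists_bound_of_continuousOn (s := Icc a b) hc.continuousOn
  refine ⟨max B 0, fun x => ?_⟩
  by_cases hx : x ∈ Icc a b
  · exact (hB x hx).trans (le_max_left _ _)
  · rw [hV.eq_zero m hm.le x (fun h => hx (Ioo_subset_Icc_self h)), abs_zero]
    exact le_max_right _ _

lemma IsC3Extension.hasDerivAt_convolution {a b L : ℝ} {V : ℕ → ℝ → ℝ}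
    (hV : IsC3Extension a b L V) {m : ℕ} (hm : m < 2) {p c : ℝ} (hp : -1 < p) (y : ℝ) :
    HasDerivAt (fun y => ∫ s in (0 : ℝ)..c, V m (y - s) * s ^ p)
      (∫ s in (0 : ℝ)..c, V (m + 1) (y - s) * s ^ p) y := by
  have hcont : ∀ m < 3, Continuous (V m) := fun m hm =>
    continuous_iff_continuousAt.2 fun x => (hV.hasDerivAt m hm x).continuousAt
  have hpi : IntervalIntegrable (fun s : ℝ => s ^ p) volume 0 c :=
    intervalIntegral.intervalIntegrable_rpow' hp
  have hint : ∀ m < 3, ∀ y, IntervalIntegrable (fun s => V m (y - s) * s ^ p) volume 0 c := by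
    intro m hm y
    refine hpi.continuousOn_mul ?_
    exact ((hcont m hm).comp (by fun_prop : Continuous fun s : ℝ => y - s)).continuousOn
  obtain ⟨B, hB⟩ := hV.exists_bound (m := m + 1) (by omega)
  refine (intervalIntegral.hasDerivAt_integral_of_dominated_loc_of_deriv_le
    (F := fun y s => V m (y - s) * s ^ p) (F' := fun y s => V (m + 1) (y - s) * s ^ p)
    (bound := fun s => B * |s ^ p|) (s := univ) Filter.univ_mem ?_ (hint m (by omega) y) ?_ ?_ ?_ ?_).2
  · exact Filter.Eventually.of_forall fun z =>
      (intervalIntegrable_iff.1 (hint m (by omega) z)).aestronglyMeasurable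
  · exact (intervalIntegrable_iff.1 (hint (m + 1) (by omega) y)).aestronglyMeasurable
  · refine Filter.Eventually.of_forall fun s _ z _ => ?_
    rw [norm_mul, Real.norm_eq_abs, Real.norm_eq_abs]
    exact mul_le_mul_of_nonneg_right (hB _) (abs_nonneg _)
  · exact hpi.abs.const_mul _
  · refine Filter.Eventually.of_forall fun s _ z _ => ?_
    have := ((hV.hasDerivAt m (by omega) (z - s)).comp z ((hasDerivAt_id z).sub_const s)).mul_const
      (s ^ p)
    simpa [Function.comp_def] using this

lemma IsC3Extension.convolution_eq {a b L : ℝ} {V : ℕ → ℝ → ℝ}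
    (hV : IsC3Extension a b L V) {m : ℕ} (hm : m < 3) {p y : ℝ} (hp : -1 < p)
    (hyb : y ≤ b) :
    ∫ s in (0 : ℝ)..(b - a), V m (y - s) * s ^ p = ∫ z in a..y, V m z * (y - z) ^ p := by
  have hcont : Continuous (V m) :=
    continuous_iff_continuousAt.2 fun x => (hV.hasDerivAt m hm x).continuousAt
  have hint : ∀ c d, IntervalIntegrable (fun s => V m (y - s) * s ^ p) volume c d := by
    intro c d
    refine (intervalIntegral.intervalIntegrable_rpow' hp).continuousOn_mul ?_
    exact (hcont.comp (by fun_prop : Continuous fun s : ℝ => y - s)).continuousOn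
  rw [← intervalIntegral.integral_add_adjacent_intervals (hint 0 (y - a)) (hint (y - a) (b - a))]
  have h0 : ∫ s in (y - a)..(b - a), V m (y - s) * s ^ p = 0 := by
    refine intervalIntegral.integral_zero_ae (Filter.Eventually.of_forall fun s hs => ?_)
    rw [uIoc_of_le (by linarith)] at hs
    rw [hV.eq_zero m hm.le _ (fun h => by linarith [h.1, hs.1]), zero_mul]
  have h1 := intervalIntegral.integral_comp_sub_left (a := a) (b := y)
    (fun s => V m (y - s) * s ^ p) y
  simp only [sub_sub_cancel, sub_self] at h1
  rw [h0, add_zero, ← h1]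

lemma IsC3Extension.leftRL_eq {a b L β : ℝ} {V : ℕ → ℝ → ℝ} (hV : IsC3Extension a b L V)
    (h₂ : β < 2) {v : ℝ → ℝ} (hv : ∀ x ∈ Icc a b, v x = V 0 x) {x : ℝ} (hx : x ∈ Ioo a b) :
    leftRL β a v x
      = 1 / Real.Gamma (2 - β) * ∫ z in a..x, V 2 z * (x - z) ^ (1 - β) := by
  have hp : -1 < 1 - β := by linarith
  rw [leftRL, if_neg h₂.ne, iteratedDeriv_succ, iteratedDeriv_one]
  congr 1
  have e0 : ∀ y ∈ Ioo a b, ∫ η in a..y, v η / (y - η) ^ (β - 1)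
      = ∫ s in (0 : ℝ)..(b - a), V 0 (y - s) * s ^ (1 - β) := by
    intro y hy
    rw [hV.convolution_eq (by norm_num) hp hy.2.le]
    refine intervalIntegral.integral_congr fun z hz => ?_
    rw [uIcc_of_le hy.1.le] at hz
    rw [hv z ⟨hz.1, hz.2.trans hy.2.le⟩, show 1 - β = -(β - 1) by ring,
      Real.rpow_neg (by linarith [hz.2]), div_eq_mul_inv]
  have e1 : ∀ y ∈ Ioo a b, deriv (fun y => ∫ η in a..y, v η / (y - η) ^ (β - 1)) y
      = ∫ s in (0 : ℝ)..(b - a), V 1 (y - s) * s ^ (1 - β) := by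
    intro y hy
    refine ((hV.hasDerivAt_convolution (m := 0) (c := b - a) (by norm_num) hp y).congr_of_eventuallyEq
      ?_).deriv
    filter_upwards [Ioo_mem_nhds hy.1 hy.2] with z hz using e0 z hz
  have e2 : HasDerivAt (deriv fun y => ∫ η in a..y, v η / (y - η) ^ (β - 1))
      (∫ s in (0 : ℝ)..(b - a), V 2 (x - s) * s ^ (1 - β)) x := by
    refine (hV.hasDerivAt_convolution (m := 1) (c := b - a) (by norm_num) hp x).congr_of_eventuallyEq
      ?_
    filter_upwards [Ioo_mem_nhds hx.1 hx.2] with z hz using e1 z hz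
  rw [e2.deriv, hV.convolution_eq (by norm_num) hp hx.2.le]

lemma rightRL_eq_leftRL_reflect (β a b : ℝ) (v : ℝ → ℝ) (x : ℝ) :
    rightRL β b v x = leftRL β a (fun y => v (a + b - y)) (a + b - x) := by
  rw [rightRL, leftRL]
  split_ifs with h
  · rw [iteratedDeriv_comp_const_sub]
    simp
  · have e : (fun y => ∫ η in y..b, v η / (η - y) ^ (β - 1))
        = fun y => (fun w => ∫ η in a..w, v (a + b - η) / (w - η) ^ (β - 1)) (a + b - y) := by
      ext y
      have := intervalIntegral.integral_comp_sub_left (a := a) (b := a + b - y)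
        (fun η => v η / (η - y) ^ (β - 1)) (a + b)
      rw [sub_sub_cancel, add_sub_cancel_left] at this
      rw [← this]
      refine intervalIntegral.integral_congr fun η _ => ?_
      congr 2
      ring
    have e' := congrFun (iteratedDeriv_comp_const_sub (n := 2) (s := a + b)
      (f := fun w => ∫ η in a..w, v (a + b - η) / (w - η) ^ (β - 1))) x
    rw [e, e']
    simp

/-! ### Consistency of the spatial operators -/

/-- `U 0` is of class `C⁴` on `[a, b]` with derivatives `U 1`, ..., `U 4` and `|U 4| ≤ L`. -/
structure IsC4 (a b L : ℝ) (U : ℕ → ℝ → ℝ) : Prop where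
  hasDerivWithinAt : ∀ m < 4, ∀ x ∈ Icc a b, HasDerivWithinAt (U m) (U (m + 1) x) (Icc a b) x
  continuousOn_four : ContinuousOn (U 4) (Icc a b)
  abs_four_le : ∀ x ∈ Icc a b, |U 4 x| ≤ L

/-- Extension by zero of the first three derivatives. -/
def zeroExtension (a b : ℝ) (U : ℕ → ℝ → ℝ) (m : ℕ) : ℝ → ℝ :=
  if m ≤ 3 then (Ioo a b).indicator (U m) else U m

lemma hasDerivAt_indicator {a b : ℝ} {f g : ℝ → ℝ} 
    (hf : ∀ x ∈ Icc a b, HasDerivWithinAt f (g x) (Icc a b) x)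
    (hfa : f a = 0) (hfb : f b = 0) (hga : g a = 0) (hgb : g b = 0) (x : ℝ) :
    HasDerivAt ((Ioo a b).indicator f) ((Ioo a b).indicator g x) x := by
  have hends : ∀ y ∈ Icc a b, y ∉ Ioo a b → y = a ∨ y = b := by
    intro y hy hn
    by_contra hc
    rw [not_or] at hc
    exact hn ⟨lt_of_le_of_ne hy.1 (Ne.symm hc.1), lt_of_le_of_ne hy.2 hc.2⟩
  have hfeq : ∀ y ∈ Icc a b, (Ioo a b).indicator f y = f y := by
    intro y hy
    by_cases h : y ∈ Ioo a b
    · rw [indicator_of_mem h]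
    · rw [indicator_of_notMem h]
      rcases hends y hy h with rfl | rfl
      · exact hfa.symm
      · exact hfb.symm
  have hgeq : ∀ y ∈ Icc a b, (Ioo a b).indicator g y = g y := by
    intro y hy
    by_cases h : y ∈ Ioo a b
    · rw [indicator_of_mem h]
    · rw [indicator_of_notMem h]
      rcases hends y hy h with rfl | rfl
      · exact hga.symm
      · exact hgb.symm
  have hin : ∀ y ∈ Icc a b, HasDerivWithinAt ((Ioo a b).indicator f)
      ((Ioo a b).indicator g y) (Icc a b) y := fun y hy => by
    rw [hgeq y hy]
    exact (hf y hy).congr hfeq (hfeq y hy)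
  have hout : ∀ y ∉ Ioo a b, HasDerivWithinAt ((Ioo a b).indicator f)
      ((Ioo a b).indicator g y) (Ioo a b)ᶜ y := fun y hy => by
    rw [indicator_of_notMem hy]
    exact (hasDerivWithinAt_const y _ (0 : ℝ)).congr
      (fun z hz => indicator_of_notMem hz _) (indicator_of_notMem hy _)
  by_cases h1 : x ∈ Ioo a b
  · exact (hin x (Ioo_subset_Icc_self h1)).hasDerivAt (Icc_mem_nhds h1.1 h1.2)
  by_cases h2 : x ∈ Icc a b
  · have hu := (hin x h2).union (hout x h1)
    rw [(eq_univ_iff_forall.2 fun z => ?_ : Icc a b ∪ (Ioo a b)ᶜ = univ)] at hu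
    · exact hasDerivWithinAt_univ.1 hu
    · by_cases h : z ∈ Ioo a b
      · exact Or.inl (Ioo_subset_Icc_self h)
      · exact Or.inr h
  · refine (hout x h1).hasDerivAt ?_
    exact Filter.mem_of_superset (isClosed_Icc.isOpen_compl.mem_nhds h2)
      (compl_subset_compl.2 Ioo_subset_Icc_self)

namespace IsC4

variable {a b L : ℝ} {U : ℕ → ℝ → ℝ}

lemma nonneg (hU : IsC4 a b L U) (hab : a ≤ b) : 0 ≤ L :=
  (abs_nonneg _).trans (hU.abs_four_le a ⟨le_rfl, hab⟩)

lemma abs_three_sub_le (hU : IsC4 a b L U) (hab : a ≤ b) {x y : ℝ} (hx : x ∈ Icc a b)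
    (hy : y ∈ Icc a b) : |U 3 x - U 3 y| ≤ L * |x - y| := by
  have := abs_sub_le_of_abs_deriv_le_pow (convex_Icc a b) (n := 0) (hU.nonneg hab) hy hx
    (hU.hasDerivWithinAt 3 (by norm_num)) (fun z hz => by simpa using hU.abs_four_le z hz)
  simpa using this

lemma reflect (hU : IsC4 a b L U) : IsC4 a b L (fun m x => (-1) ^ m * U m (a + b - x)) := by
  have hmaps : MapsTo (fun x => a + b - x) (Icc a b) (Icc a b) := fun x hx =>
    ⟨by linarith [hx.2], by linarith [hx.1]⟩
  refine ⟨fun m hm x hx => ?_, ?_, fun x hx => ?_⟩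
  · have h1 := hU.hasDerivWithinAt m hm (a + b - x) (hmaps hx)
    have h2 : HasDerivWithinAt (fun x => a + b - x) (-1) (Icc a b) x :=
      ((hasDerivAt_id x).const_sub (a + b)).hasDerivWithinAt
    refine ((h1.comp x h2 hmaps).const_mul ((-1) ^ m)).congr_deriv ?_
    rw [pow_succ]
    ring
  · exact continuousOn_const.mul (hU.continuousOn_four.comp (by fun_prop) hmaps)
  · have := hU.abs_four_le _ (hmaps hx)
    norm_num
    exact this

lemma convex_combination {U' : ℕ → ℝ → ℝ} (hU : IsC4 a b L U) (hU' : IsC4 a b L U') {θ : ℝ}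
    (hθ₀ : 0 ≤ θ) (hθ₁ : 0 ≤ 1 - θ) :
    IsC4 a b L (fun m x => θ * U m x + (1 - θ) * U' m x) := by
  refine ⟨fun m hm x hx => ?_, ?_, fun x hx => ?_⟩
  · exact ((hU.hasDerivWithinAt m hm x hx).const_mul θ).add
      ((hU'.hasDerivWithinAt m hm x hx).const_mul (1 - θ))
  · exact (continuousOn_const.mul hU.continuousOn_four).add
      (continuousOn_const.mul hU'.continuousOn_four)
  · refine (abs_add_le _ _).trans ?_
    rw [abs_mul, abs_mul, abs_of_nonneg hθ₀, abs_of_nonneg hθ₁]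
    have h1 := mul_le_mul_of_nonneg_left (hU.abs_four_le x hx) hθ₀
    have h2 := mul_le_mul_of_nonneg_left (hU'.abs_four_le x hx) hθ₁
    linarith

lemma zeroExtension_of_mem {m : ℕ} (hz : m ≤ 3 → U m a = 0 ∧ U m b = 0) {x : ℝ}
    (hx : x ∈ Icc a b) : zeroExtension a b U m x = U m x := by
  rw [zeroExtension]
  split_ifs with hm
  · by_cases h : x ∈ Ioo a b
    · rw [indicator_of_mem h]
    · rw [indicator_of_notMem h]
      have : x = a ∨ x = b := by
        by_contra hc
        rw [not_or] at hc
        exact h ⟨lt_of_le_of_ne hx.1 (Ne.symm hc.1), lt_of_le_of_ne hx.2 hc.2⟩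
      rcases this with rfl | rfl
      · exact (hz hm).1.symm
      · exact (hz hm).2.symm
  · rfl

lemma isC3Extension (hU : IsC4 a b L U) (hab : a < b)
    (hz : ∀ m ≤ 3, U m a = 0 ∧ U m b = 0) : IsC3Extension a b L (zeroExtension a b U) := by
  refine ⟨fun m hm x => ?_, fun x hx => ?_, ?_, ?_, fun m hm x hx => ?_, fun x y => ?_⟩
  · simp only [zeroExtension, if_pos hm.le, if_pos (Nat.succ_le_of_lt hm)]
    exact hasDerivAt_indicator (hU.hasDerivWithinAt m (by omega)) (hz m hm.le).1 (hz m hm.le).2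
      (hz (m + 1) hm).1 (hz (m + 1) hm).2 x
  · have h1 := (hU.hasDerivWithinAt 3 (by norm_num) x (Ioo_subset_Icc_self hx)).hasDerivAt
      (Icc_mem_nhds hx.1 hx.2)
    simp only [zeroExtension, le_refl, if_true]
    rw [if_neg (by norm_num)]
    refine h1.congr_of_eventuallyEq ?_
    filter_upwards [Ioo_mem_nhds hx.1 hx.2] with z hz using indicator_of_mem hz _
  · simpa [zeroExtension] using hU.continuousOn_four
  · simpa [zeroExtension] using hU.abs_four_le
  · simp only [zeroExtension, if_pos hm]
    exact indicator_of_notMem hx _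
  · have hclamp : ∀ z, zeroExtension a b U 3 z = U 3 (max a (min b z)) := by
      intro z
      rcases le_total z a with h | h
      · rw [min_eq_right (h.trans hab.le), max_eq_left h, (hz 3 le_rfl).1]
        simp only [zeroExtension, le_refl, if_true]
        exact indicator_of_notMem (fun hm => absurd hm.1 (not_lt.2 h)) _
      · rcases le_total b z with h' | h'
        · rw [min_eq_left h', max_eq_right hab.le, (hz 3 le_rfl).2]
          simp only [zeroExtension, le_refl, if_true]
          exact indicator_of_notMem (fun hm => absurd hm.2 (not_lt.2 h')) _
        · rw [min_eq_right h', max_eq_right h]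
          exact zeroExtension_of_mem (hz 3) ⟨h, h'⟩
    have hmem : ∀ z, max a (min b z) ∈ Icc a b := fun z =>
      ⟨le_max_left _ _, max_le hab.le (min_le_left _ _)⟩
    rw [hclamp, hclamp]
    refine (hU.abs_three_sub_le hab.le (hmem x) (hmem y)).trans ?_
    refine mul_le_mul_of_nonneg_left ?_ (hU.nonneg hab.le)
    refine (abs_max_sub_max_le_max _ _ _ _).trans ?_
    refine max_le (by simp) ((abs_min_sub_min_le_max _ _ _ _).trans ?_)
    exact max_le (by simp) le_rfl

end IsC4

lemma weight_two_eq_zero (k : ℕ) : weight 2 (k + 3) = 0 := by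
  have hg : ∀ k : ℕ, grunwald 2 (k + 3) = 0 := by
    intro k
    induction k with
    | zero => rw [grunwald_three]; norm_num
    | succ k ih => rw [grunwald_succ 2 (k + 3), ih, zero_mul]
  rw [show k + 3 = (k + 1) + 2 by ring, weight, show k + 1 + 2 = k + 3 by ring, hg]
  norm_num

lemma left_consistency {β a b : ℝ} (h₁ : 1 < β) (h₂ : β ≤ 2) (hab : a < b) :
    ∃ C : ℝ, 0 ≤ C ∧ ∀ (L δ : ℝ) (U W : ℕ → ℝ → ℝ) (u : ℝ → ℝ), 0 ≤ δ → IsC4 a b L U →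
      IsC4 a b L W → (∀ x ∈ Icc a b, u x = U 0 x) →
      (β < 2 → ∀ m ≤ 3, (U m a = 0 ∧ U m b = 0) ∧ (W m a = 0 ∧ W m b = 0)) →
      (∀ x ∈ Icc a b, |W 2 x - U 2 x| ≤ δ) →
      ∀ (N i : ℕ), 1 ≤ i → i < N → ∀ h : ℝ, h = (b - a) / N →
        |1 / h ^ β * ∑ k ∈ Finset.range (i + 2), weight β k * W 0 (a + ((i + 1 - k : ℕ) : ℝ) * h)
          - leftRL β a u (a + i * h)| ≤ C * (L * h ^ 2 + δ) := by
  rcases h₂.lt_or_eq with h₂' | h₂'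
  · obtain ⟨C, hC, htr⟩ := left_truncation_of_lt_two h₁ h₂' hab
    have hμ : 0 < 2 - β := by linarith
    have hΓ : 0 < Real.Gamma (2 - β) := Real.Gamma_pos_of_pos hμ
    have hba : 0 < b - a := by linarith
    refine ⟨C + 1 / Real.Gamma (2 - β) * ((b - a) ^ (2 - β) / (2 - β)), by positivity, ?_⟩
    intro L δ U W u hδ hU hW hu hz hWU N i hi hiN h hh
    have hUe := hU.isC3Extension hab fun m hm => (hz h₂' m hm).1
    have hWe := hW.isC3Extension hab fun m hm => (hz h₂' m hm).2
    have hN : (0 : ℝ) < N := by exact_mod_cast (by omega : 0 < N)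
    have hh0 : 0 < h := by rw [hh]; positivity
    have hNh : N * h = b - a := by rw [hh]; field_simp
    have hnode : ∀ n : ℕ, n ≤ N → a + n * h ∈ Icc a b := by
      intro n hn
      have : (n : ℝ) ≤ N := by exact_mod_cast hn
      have : (n : ℝ) * h ≤ N * h := by gcongr
      have : 0 ≤ (n : ℝ) * h := by positivity
      constructor <;> linarith
    have hxI : a + i * h ∈ Ioo a b := by
      have h1 : (i : ℝ) < N := by exact_mod_cast hiN
      have h2 : (i : ℝ) * h < N * h := by gcongr
      have h3 : 0 < (i : ℝ) := by exact_mod_cast hi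
      have h4 : 0 < (i : ℝ) * h := by positivity
      constructor <;> linarith
    have hL := hU.nonneg hab.le
    have h1 := htr L _ hWe N i hiN h hh
    have hrl := hUe.leftRL_eq h₂' (v := u) (fun x hx => by
      rw [IsC4.zeroExtension_of_mem (fun hm => (hz h₂' 0 hm).1) hx, hu x hx]) hxI
    have hsum : ∑ k ∈ Finset.range (i + 2), weight β k * W 0 (a + ((i + 1 - k : ℕ) : ℝ) * h)
        = ∑ k ∈ Finset.range (i + 2),
          weight β k * zeroExtension a b W 0 (a + ((i + 1 - k : ℕ) : ℝ) * h) := by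
      refine Finset.sum_congr rfl fun k hk => ?_
      rw [IsC4.zeroExtension_of_mem (fun hm => (hz h₂' 0 hm).2) (hnode _ (by omega))]
    rw [hsum, hrl]
    set x := a + i * h with hx
    have hK : IntervalIntegrable (fun z : ℝ => (x - z) ^ (1 - β)) volume a x := by
      have := intervalIntegrable_sub_rpow (α := β - 1) (t := x) (x := a) (y := x) (by linarith)
      rwa [neg_sub] at this
    have hdiff : |1 / Real.Gamma (2 - β) * (∫ z in a..x, zeroExtension a b W 2 z * (x - z) ^ (1 - β))
        - 1 / Real.Gamma (2 - β) * ∫ z in a..x, zeroExtension a b U 2 z * (x - z) ^ (1 - β)|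
        ≤ 1 / Real.Gamma (2 - β) * ((b - a) ^ (2 - β) / (2 - β)) * δ := by
      rw [← mul_sub, ← intervalIntegral.integral_sub
        (hK.continuousOn_mul hWe.continuous_two.continuousOn)
        (hK.continuousOn_mul hUe.continuous_two.continuousOn), abs_mul,
        abs_of_pos (by positivity), mul_assoc]
      refine mul_le_mul_of_nonneg_left ?_ (by positivity)
      rw [← Real.norm_eq_abs]
      refine (intervalIntegral.norm_integral_le_of_norm_le hxI.1.le
        (g := fun z => δ * (x - z) ^ (1 - β)) ?_ (hK.const_mul _)).trans ?_
      · refine Filter.Eventually.of_forall fun z hz' => ?_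
        have hzm : z ∈ Icc a b := ⟨hz'.1.le, hz'.2.trans hxI.2.le⟩
        have hp : 0 ≤ (x - z) ^ (1 - β) := Real.rpow_nonneg (by linarith [hz'.2]) _
        rw [← sub_mul, norm_mul, Real.norm_eq_abs, Real.norm_eq_abs, abs_of_nonneg hp,
          IsC4.zeroExtension_of_mem (fun hm => (hz h₂' 2 hm).2) hzm,
          IsC4.zeroExtension_of_mem (fun hm => (hz h₂' 2 hm).1) hzm]
        exact mul_le_mul_of_nonneg_right (hWU z hzm) hp
      · rw [intervalIntegral.integral_const_mul,
          intervalIntegral.integral_comp_sub_left (fun z => z ^ (1 - β)), sub_self,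
          integral_rpow (Or.inl (by linarith)), show 1 - β + 1 = 2 - β by ring,
          Real.zero_rpow hμ.ne', sub_zero]
        have : (x - a) ^ (2 - β) ≤ (b - a) ^ (2 - β) :=
          Real.rpow_le_rpow (by linarith [hxI.1]) (by linarith [hxI.2]) hμ.le
        rw [mul_comm]
        gcongr
    set A := 1 / h ^ β * ∑ k ∈ Finset.range (i + 2),
      weight β k * zeroExtension a b W 0 (a + ((i + 1 - k : ℕ) : ℝ) * h)
    set B := 1 / Real.Gamma (2 - β) * ∫ z in a..x, zeroExtension a b W 2 z * (x - z) ^ (1 - β)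
    set D := 1 / Real.Gamma (2 - β) * ∫ z in a..x, zeroExtension a b U 2 z * (x - z) ^ (1 - β)
    set c := 1 / Real.Gamma (2 - β) * ((b - a) ^ (2 - β) / (2 - β)) with hc
    have hc0 : 0 ≤ c := by positivity
    have h5 : 0 ≤ C * δ := by positivity
    have h6 : 0 ≤ c * (L * h ^ 2) := by positivity
    calc |A - D| ≤ |A - B| + |B - D| := abs_sub_le _ _ _
      _ ≤ C * L * h ^ 2 + c * δ := add_le_add h1 hdiff
      _ ≤ (C + c) * (L * h ^ 2 + δ) := by linarith
  · subst h₂'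
    refine ⟨2, by norm_num, ?_⟩
    intro L δ U W u hδ hU hW hu hz hWU N i hi hiN h hh
    have hL := hU.nonneg hab.le
    have hba : 0 < b - a := by linarith
    have hN : (0 : ℝ) < N := by exact_mod_cast (by omega : 0 < N)
    have hh0 : 0 < h := by rw [hh]; positivity
    have hNh : N * h = b - a := by rw [hh]; field_simp
    have h1 : (i : ℝ) + 1 ≤ N := by exact_mod_cast hiN
    have h2 : ((i : ℝ) + 1) * h ≤ N * h := by gcongr
    have h3 : (1 : ℝ) ≤ i := by exact_mod_cast hi
    have h4 : 1 * h ≤ (i : ℝ) * h := by gcongr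
    set x := a + i * h with hx
    have hxI : x ∈ Ioo a b := by constructor <;> linarith
    have hrl : leftRL 2 a u x = U 2 x := by
      rw [leftRL, if_pos rfl, iteratedDeriv_succ, iteratedDeriv_one]
      have e1 : ∀ y ∈ Ioo a b, deriv u y = U 1 y := by
        intro y hy
        refine (((hU.hasDerivWithinAt 0 (by norm_num) y (Ioo_subset_Icc_self hy)).hasDerivAt
          (Icc_mem_nhds hy.1 hy.2)).congr_of_eventuallyEq ?_).deriv
        filter_upwards [Icc_mem_nhds hy.1 hy.2] with z hz using hu z hz
      refine (((hU.hasDerivWithinAt 1 (by norm_num) x (Ioo_subset_Icc_self hxI)).hasDerivAt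
          (Icc_mem_nhds hxI.1 hxI.2)).congr_of_eventuallyEq ?_).deriv
      filter_upwards [Ioo_mem_nhds hxI.1 hxI.2] with z hz using e1 z hz
    have hsum : ∑ k ∈ Finset.range (i + 2), weight 2 k * W 0 (a + ((i + 1 - k : ℕ) : ℝ) * h)
        = W 0 (x + h) - 2 * W 0 x + W 0 (x - h) := by
      rw [← Finset.sum_subset (Finset.range_subset_range.2 (by omega : 3 ≤ i + 2))]
      · simp only [Finset.sum_range_succ, Finset.sum_range_zero, weight_zero, weight_one, weight_two]
        have e0 : a + ((i + 1 - 0 : ℕ) : ℝ) * h = x + h := by rw [hx]; push_cast; ring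
        have e1 : a + ((i + 1 - 1 : ℕ) : ℝ) * h = x := by rw [hx]; push_cast; ring
        have e2 : a + ((i + 1 - 2 : ℕ) : ℝ) * h = x - h := by
          rw [hx, show i + 1 - 2 = i - 1 by omega, Nat.cast_sub hi]; push_cast; ring
        rw [e0, e1, e2]
        norm_num
        ring
      · intro k _ hk
        rw [Finset.mem_range, not_lt] at hk
        obtain ⟨m, rfl⟩ := Nat.exists_eq_add_of_le' hk
        rw [weight_two_eq_zero, zero_mul]
    have hsd := abs_second_difference_sub_le (convex_Icc a b) hL (x := x) (h := h)
      (Ioo_subset_Icc_self hxI) ⟨by linarith, by linarith⟩ ⟨by linarith, by linarith⟩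
      (hW.hasDerivWithinAt 0 (by norm_num)) (hW.hasDerivWithinAt 1 (by norm_num))
      (hW.hasDerivWithinAt 2 (by norm_num))
      (fun z hz => hW.abs_three_sub_le hab.le hz (Ioo_subset_Icc_self hxI))
    rw [abs_of_pos hh0] at hsd
    rw [hrl, hsum, Real.rpow_two]
    have e : 1 / h ^ 2 * (W 0 (x + h) - 2 * W 0 x + W 0 (x - h)) - U 2 x
        = 1 / h ^ 2 * (W 0 (x + h) - 2 * W 0 x + W 0 (x - h) - h ^ 2 * W 2 x)
          + (W 2 x - U 2 x) := by
      field_simp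
      ring
    rw [e]
    refine (abs_add_le _ _).trans ?_
    rw [abs_mul, abs_of_pos (by positivity : 0 < 1 / h ^ 2)]
    have h5 := hWU x (Ioo_subset_Icc_self hxI)
    have h6 : 1 / h ^ 2 * |W 0 (x + h) - 2 * W 0 x + W 0 (x - h) - h ^ 2 * W 2 x|
        ≤ 1 / h ^ 2 * (2 * L * h ^ 4) := by gcongr
    have h7 : 1 / h ^ 2 * (2 * L * h ^ 4) = 2 * (L * h ^ 2) := by field_simp
    linarith

lemma right_consistency {β a b : ℝ} (h₁ : 1 < β) (h₂ : β ≤ 2) (hab : a < b) :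
    ∃ C : ℝ, 0 ≤ C ∧ ∀ (L δ : ℝ) (U W : ℕ → ℝ → ℝ) (u : ℝ → ℝ), 0 ≤ δ → IsC4 a b L U →
      IsC4 a b L W → (∀ x ∈ Icc a b, u x = U 0 x) →
      (β < 2 → ∀ m ≤ 3, (U m a = 0 ∧ U m b = 0) ∧ (W m a = 0 ∧ W m b = 0)) →
      (∀ x ∈ Icc a b, |W 2 x - U 2 x| ≤ δ) →
      ∀ (N i : ℕ), 1 ≤ i → i < N → ∀ h : ℝ, h = (b - a) / N →
        |1 / h ^ β * ∑ k ∈ Finset.range (N - i + 2),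
            weight β k * W 0 (a + ((i + k - 1 : ℕ) : ℝ) * h)
          - rightRL β b u (a + i * h)| ≤ C * (L * h ^ 2 + δ) := by
  obtain ⟨C, hC, hleft⟩ := left_consistency h₁ h₂ hab
  refine ⟨C, hC, ?_⟩
  intro L δ U W u hδ hU hW hu hz hWU N i hi hiN h hh
  have hmem : ∀ x ∈ Icc a b, a + b - x ∈ Icc a b := fun x hx =>
    ⟨by linarith [hx.2], by linarith [hx.1]⟩
  have hN : (0 : ℝ) < N := by exact_mod_cast (by omega : 0 < N)
  have hNh : N * h = b - a := by rw [hh]; field_simp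
  have key := hleft L δ _ _ (fun y => u (a + b - y)) hδ hU.reflect hW.reflect
    (fun x hx => by simp [hu _ (hmem x hx)])
    (fun hβ m hm => by
      have := hz hβ m hm
      simp [this.1.1, this.1.2, this.2.1, this.2.2])
    (fun x hx => by simpa using hWU _ (hmem x hx)) N (N - i) (by omega) (by omega) h hh
  have hnode : ∀ n : ℕ, n ≤ N → a + ((N - n : ℕ) : ℝ) * h = a + b - (a + n * h) := by
    intro n hn
    rw [Nat.cast_sub hn, sub_mul, hNh]
    ring
  rw [rightRL_eq_leftRL_reflect β a b u, ← hnode i hiN.le,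
    right_sum_eq_left_sum_reflect β hiN hi (fun n => W 0 (a + (n : ℝ) * h))]
  refine le_trans (le_of_eq ?_) key
  congr 3
  refine Finset.sum_congr rfl fun k hk => ?_
  simp only [pow_zero, one_mul]
  rw [hnode _ (by omega)]

/-! ### Vanishing of the derivatives at the boundary -/

open scoped FourierTransform in
lemma MemFourierClass.contDiff_three {r : ℝ} (hr : 3 ≤ r) {v : ℝ → ℝ} (hv : Continuous v)
    (h : MemFourierClass r v) : ContDiff ℝ 3 v := by
  have hpi := Real.pi_pos
  set V : ℝ → ℂ := fun x => (v x : ℂ) with hV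
  have hVc : Continuous V := Complex.continuous_ofReal.comp hv
  have hVi : Integrable V := h.1.ofReal
  have hF : ∀ w : ℝ, ∫ x : ℝ, Complex.exp (Complex.I * ((-(2 * Real.pi) * w : ℝ) : ℂ) * (x : ℂ))
      * (v x : ℂ) = 𝓕 V w := by
    intro w
    rw [Real.fourier_real_eq_integral_exp_smul]
    refine integral_congr_ae (Filter.Eventually.of_forall fun x => ?_)
    simp only [hV, smul_eq_mul]
    congr 2
    push_cast
    ring
  have hFc : Continuous (𝓕 V) :=
    VectorFourier.fourierIntegral_continuous Real.continuous_fourierChar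
      (innerSL ℝ (E := ℝ)).continuous₂ hVi
  have hint := h.2.comp_mul_left' (R := -(2 * Real.pi)) (by linarith)
  simp only [hF] at hint
  have hpow : ∀ n : ℕ, (n : ℕ∞) ≤ 3 → Integrable (fun w : ℝ => ‖w‖ ^ n * ‖𝓕 V w‖) := by
    intro n hn
    have hn' : n ≤ 3 := by exact_mod_cast hn
    refine hint.mono' (by fun_prop) (Filter.Eventually.of_forall fun w => ?_)
    rw [norm_mul, norm_pow, norm_norm, norm_norm]
    refine mul_le_mul_of_nonneg_right ?_ (norm_nonneg _)
    have h1 : ‖w‖ ≤ 1 + |-(2 * Real.pi) * w| := by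
      rw [abs_mul, abs_neg, abs_of_pos (by linarith : (0 : ℝ) < 2 * Real.pi), Real.norm_eq_abs]
      nlinarith [abs_nonneg w, Real.pi_gt_three]
    have h2 : (1 : ℝ) ≤ 1 + |-(2 * Real.pi) * w| := by linarith [abs_nonneg (-(2 * Real.pi) * w)]
    calc ‖w‖ ^ n ≤ (1 + |-(2 * Real.pi) * w|) ^ n := pow_le_pow_left₀ (norm_nonneg _) h1 n
      _ ≤ (1 + |-(2 * Real.pi) * w|) ^ 3 := pow_le_pow_right₀ h2 hn'
      _ = (1 + |-(2 * Real.pi) * w|) ^ (3 : ℝ) := by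
        rw [← Real.rpow_natCast]; norm_num
      _ ≤ (1 + |-(2 * Real.pi) * w|) ^ r := Real.rpow_le_rpow_of_exponent_le h2 hr
  have hFi : Integrable (𝓕 V) := by
    refine (integrable_norm_iff hFc.aestronglyMeasurable).1 ?_
    simpa using hpow 0 (by simp)
  have hsm : ContDiff ℝ 3 (𝓕 (𝓕 V)) := Real.contDiff_fourier (N := 3) hpow
  have hinv : V = fun x => 𝓕 (𝓕 V) (-x) := by
    rw [← hVc.fourierInv_fourier_eq hVi hFi]
    funext x
    rw [hVc.fourierInv_fourier_eq hVi hFi, ← Real.fourierInv_eq_fourier_neg,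
      hVc.fourierInv_fourier_eq hVi hFi]
  have hVs : ContDiff ℝ 3 V := by
    rw [hinv]
    exact hsm.comp contDiff_neg
  exact Complex.reCLM.contDiff.comp hVs

lemma eq_zero_of_contDiff_indicator {a b : ℝ} (hab : a < b) {n : ℕ} {U : ℕ → ℝ → ℝ}
    (hU : ∀ m ≤ n, ∀ x ∈ Icc a b, HasDerivWithinAt (U m) (U (m + 1) x) (Icc a b) x)
    (hv : ContDiff ℝ n ((Icc a b).indicator (U 0))) {m : ℕ} (hm : m ≤ n) :
    U m a = 0 ∧ U m b = 0 := by
  set v := (Icc a b).indicator (U 0) with hvdef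
  have hin : ∀ m ≤ n, EqOn (iteratedDeriv m v) (U m) (Ioo a b) := by
    intro m
    induction m with
    | zero =>
      intro _ x hx
      simp [hvdef, indicator_of_mem (Ioo_subset_Icc_self hx)]
    | succ m ih =>
      intro hm x hx
      rw [iteratedDeriv_succ]
      have h1 := (hU m (by omega) x (Ioo_subset_Icc_self hx)).hasDerivAt (Icc_mem_nhds hx.1 hx.2)
      refine (h1.congr_of_eventuallyEq ?_).deriv
      filter_upwards [isOpen_Ioo.mem_nhds hx] with y hy using ih (by omega) hy
  have hout : ∀ m, EqOn (iteratedDeriv m v) 0 (Icc a b)ᶜ := by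
    intro m x hx
    have h0 : v =ᶠ[nhds x] fun _ => (0 : ℝ) := by
      filter_upwards [isClosed_Icc.isOpen_compl.mem_nhds hx] with y hy
      exact indicator_of_notMem hy _
    rw [h0.iteratedDeriv_eq m]
    simp
  have hcont : Continuous (iteratedDeriv m v) :=
    hv.continuous_iteratedDeriv m (by exact_mod_cast hm)
  have hUc : ContinuousOn (U m) (Icc a b) := fun x hx => (hU m hm x hx).continuousWithinAt
  have hIcc : EqOn (iteratedDeriv m v) (U m) (Icc a b) :=
    (hin m hm).of_subset_closure hcont.continuousOn hUc Ioo_subset_Icc_self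
      (closure_Ioo hab.ne).ge
  have hz : EqOn (iteratedDeriv m v) 0 (closure (Icc a b)ᶜ) :=
    (hout m).closure hcont continuous_const
  have hclosure : closure (Icc a b)ᶜ = (Ioo a b)ᶜ := by rw [closure_compl, interior_Icc]
  rw [hclosure] at hz
  constructor
  · rw [← hIcc (left_mem_Icc.2 hab.le)]; exact hz (by simp)
  · rw [← hIcc (right_mem_Icc.2 hab.le)]; exact hz (by simp)

lemma MemFourierClass.eq_zero_of_indicator {a b r : ℝ} (hab : a < b) (hr : 3 ≤ r)
    {U : ℕ → ℝ → ℝ}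
    (hU : ∀ m ≤ 3, ∀ x ∈ Icc a b, HasDerivWithinAt (U m) (U (m + 1) x) (Icc a b) x)
    (ha : U 0 a = 0) (hb : U 0 b = 0) (h : MemFourierClass r ((Icc a b).indicator (U 0)))
    {m : ℕ} (hm : m ≤ 3) : U m a = 0 ∧ U m b = 0 := by
  refine eq_zero_of_contDiff_indicator hab hU (h.contDiff_three hr ?_) hm
  have hUc : ContinuousOn (U 0) (Icc a b) :=
    fun x hx => (hU 0 (by omega) x hx).continuousWithinAt
  refine continuous_indicator (fun x hx => ?_) (by rwa [closure_Icc])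
  rw [frontier_Icc hab.le] at hx
  rcases hx with rfl | rfl
  exacts [ha, hb]

/-! ### The error equation -/

lemma discreteCaputo_sub (α σ τ : ℝ) (j : ℕ) (v w : ℕ → ℝ) :
    discreteCaputo α σ τ j (fun s => v s - w s)
      = discreteCaputo α σ τ j v - discreteCaputo α σ τ j w := by
  unfold discreteCaputo
  rw [← mul_sub, ← Finset.sum_sub_distrib]
  congr 1
  exact Finset.sum_congr rfl fun s _ => by ring

lemma discreteSpace_sub (β h : ℝ) (N : ℕ) (g p q : ℝ) (v w : ℕ → ℝ) (i : ℕ) :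
    discreteSpace β h N g p q (fun l => v l - w l) i
      = discreteSpace β h N g p q v i - discreteSpace β h N g p q w i := by
  unfold discreteSpace
  simp only [mul_sub, Finset.sum_sub_distrib]
  ring

lemma caputoDeriv_congr {α T : ℝ} {v w : ℝ → ℝ} (h : EqOn v w (Icc 0 T)) {t : ℝ}
    (ht : t ∈ Icc 0 T) : caputoDeriv α T v t = caputoDeriv α T w t := by
  unfold caputoDeriv
  have hd : ∀ s ∈ Icc 0 T, derivWithin v (Icc 0 T) s = derivWithin w (Icc 0 T) s :=
    fun s hs => derivWithin_congr h (h hs)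
  split_ifs
  · exact hd t ht
  · congr 1
    refine intervalIntegral.integral_congr fun s hs => ?_
    rw [uIcc_of_le ht.1] at hs
    simp only [hd s ⟨hs.1, hs.2.trans ht.2⟩]

lemma abs_sub_le_of_abs_deriv_le {s : Set ℝ} (hs : Convex ℝ s) {f g : ℝ → ℝ} {B : ℝ}
    (hf : ∀ x ∈ s, HasDerivWithinAt f (g x) s x) (hg : ∀ x ∈ s, |g x| ≤ B) {x y : ℝ}
    (hx : x ∈ s) (hy : y ∈ s) : |f x - f y| ≤ B * |x - y| := by
  simpa only [Real.norm_eq_abs] using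
    hs.norm_image_sub_le_of_norm_hasDerivWithin_le (fun z hz => hf z hz) hg hy hx

/-- Second order consistency of the spatial operator, up to a perturbation `δ` of the function it
is applied to. -/
lemma space_consistency {β a b : ℝ} (hβ₁ : 1 < β) (hβ₂ : β ≤ 2) (hab : a < b) :
    ∃ C : ℝ, 0 ≤ C ∧ ∀ (L δ K g p q : ℝ) (U W : ℕ → ℝ → ℝ) (u : ℝ → ℝ), 0 ≤ δ →
      |g| ≤ K → |p| ≤ K → |q| ≤ K → IsC4 a b L U → IsC4 a b L W →
      (∀ x ∈ Icc a b, |W 3 x| ≤ L) → (∀ x ∈ Icc a b, u x = U 0 x) →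
      (β < 2 → ∀ m ≤ 3, (U m a = 0 ∧ U m b = 0) ∧ (W m a = 0 ∧ W m b = 0)) →
      (∀ x ∈ Icc a b, |W 1 x - U 1 x| ≤ δ) → (∀ x ∈ Icc a b, |W 2 x - U 2 x| ≤ δ) →
      ∀ N i : ℕ, 1 ≤ i → i < N → ∀ h, h = (b - a) / N →
        |discreteSpace β h N g p q (fun l => W 0 (a + l * h)) i
            - (g * deriv u (a + i * h) + p * leftRL β a u (a + i * h)
              + q * rightRL β b u (a + i * h))| ≤ C * K * (L * h ^ 2 + δ) := by
  obtain ⟨C₁, hC₁, hl⟩ := left_consistency hβ₁ hβ₂ hab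
  obtain ⟨C₂, hC₂, hr⟩ := right_consistency hβ₁ hβ₂ hab
  refine ⟨1 + C₁ + C₂, by positivity, ?_⟩
  intro L δ K g p q U W u hδ hg hp hq hU hW hW3 hu hz h1 h2 N i hi hiN h hh
  have hL : 0 ≤ L := (abs_nonneg _).trans (hW3 a (left_mem_Icc.2 hab.le))
  have hK : 0 ≤ K := (abs_nonneg _).trans hg
  have hN : (0 : ℝ) < N := by exact_mod_cast (by omega : 0 < N)
  have hba : 0 < b - a := sub_pos.2 hab
  have hh0 : 0 < h := by rw [hh]; positivity
  have hhN : h * N = b - a := by rw [hh]; field_simp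
  have hi1 : (1 : ℝ) ≤ i := by exact_mod_cast hi
  have hiN1 : (i : ℝ) + 1 ≤ N := by exact_mod_cast hiN
  set x := a + i * h with hxdef
  have hxm : a ≤ x - h := by rw [hxdef]; nlinarith
  have hxp : x + h ≤ b := by rw [hxdef]; nlinarith
  have hx : x ∈ Icc a b := ⟨by linarith, by linarith⟩
  have hcentral : |(W 0 (x + h) - W 0 (x - h)) / (2 * h) - W 1 x| ≤ L * h ^ 2 :=
    abs_central_difference_sub_le (convex_Icc a b) hL hh0 hx ⟨by linarith, hxp⟩
      ⟨hxm, by linarith⟩ (hW.hasDerivWithinAt 0 (by norm_num)) (hW.hasDerivWithinAt 1 (by norm_num))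
      fun z hz => abs_sub_le_of_abs_deriv_le (convex_Icc a b)
        (hW.hasDerivWithinAt 2 (by norm_num)) hW3 hz hx
  have hderiv : deriv u x = U 1 x := by
    have hnhds : Icc a b ∈ nhds x := Icc_mem_nhds (by linarith) (by linarith)
    refine ((((hU.hasDerivWithinAt 0 (by norm_num) x hx).hasDerivAt hnhds)).congr_of_eventuallyEq
      ?_).deriv
    filter_upwards [hnhds] with y hy using hu y hy
  have hadv : |(W 0 (x + h) - W 0 (x - h)) / (2 * h) - deriv u x| ≤ L * h ^ 2 + δ := by
    rw [hderiv]
    calc |(W 0 (x + h) - W 0 (x - h)) / (2 * h) - U 1 x|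
        ≤ |(W 0 (x + h) - W 0 (x - h)) / (2 * h) - W 1 x| + |W 1 x - U 1 x| :=
          abs_sub_le _ _ _
      _ ≤ _ := add_le_add hcentral (h1 x hx)
  have hL' := hl L δ U W u hδ hU hW hu hz h2 N i hi hiN h hh
  have hR' := hr L δ U W u hδ hU hW hu hz h2 N i hi hiN h hh
  have hxp' : a + ((i + 1 : ℕ) : ℝ) * h = x + h := by push_cast; ring
  have hxm' : a + ((i - 1 : ℕ) : ℝ) * h = x - h := by push_cast [hi]; ring
  rw [← hxdef] at hL' hR'
  simp only [discreteSpace, hxp', hxm']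
  set S₁ := ∑ k ∈ Finset.range (i + 2), weight β k * W 0 (a + ((i + 1 - k : ℕ) : ℝ) * h)
  set S₂ := ∑ k ∈ Finset.range (N - i + 2), weight β k * W 0 (a + ((i + k - 1 : ℕ) : ℝ) * h)
  set A := (W 0 (x + h) - W 0 (x - h)) / (2 * h)
  have hsplit : g * A + p / h ^ β * S₁ + q / h ^ β * S₂
      - (g * deriv u x + p * leftRL β a u x + q * rightRL β b u x)
      = g * (A - deriv u x) + p * (1 / h ^ β * S₁ - leftRL β a u x)
        + q * (1 / h ^ β * S₂ - rightRL β b u x) := by ring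
  rw [hsplit]
  have hnn : 0 ≤ L * h ^ 2 + δ := by positivity
  calc _ ≤ |g * (A - deriv u x)| + |p * (1 / h ^ β * S₁ - leftRL β a u x)|
        + |q * (1 / h ^ β * S₂ - rightRL β b u x)| := abs_add_three _ _ _
    _ ≤ K * (L * h ^ 2 + δ) + K * (C₁ * (L * h ^ 2 + δ)) + K * (C₂ * (L * h ^ 2 + δ)) := by
        simp only [abs_mul]
        gcongr
    _ = _ := by ring

/-- A bound for all the derivatives of a function of class `C^{4,3}` on a closed rectangle. -/
lemma exists_abs_le {a b T : ℝ} {D : ℕ → ℕ → ℝ → ℝ → ℝ}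
    (hD : ∀ m ≤ 4, ∀ n ≤ 3,
      ContinuousOn (fun p : ℝ × ℝ => D m n p.1 p.2) (Icc a b ×ˢ Icc 0 T)) :
    ∃ B : ℝ, 0 ≤ B ∧ ∀ m ≤ 4, ∀ n ≤ 3, ∀ x ∈ Icc a b, ∀ t ∈ Icc 0 T, |D m n x t| ≤ B := by
  have hcomp : IsCompact (Icc a b ×ˢ Icc (0 : ℝ) T) := isCompact_Icc.prod isCompact_Icc
  have h1 : ∀ m n : ℕ, ∃ B : ℝ, 0 ≤ B ∧
      (m ≤ 4 → n ≤ 3 → ∀ x ∈ Icc a b, ∀ t ∈ Icc 0 T, |D m n x t| ≤ B) := by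
    intro m n
    by_cases hmn : m ≤ 4 ∧ n ≤ 3
    · obtain ⟨B, hB⟩ := hcomp.exists_bound_of_continuousOn (hD m hmn.1 n hmn.2)
      refine ⟨|B|, abs_nonneg _, fun _ _ x hx t ht => ?_⟩
      exact (hB (x, t) ⟨hx, ht⟩).trans (le_abs_self B)
    · exact ⟨0, le_rfl, fun hm hn => absurd ⟨hm, hn⟩ hmn⟩
  choose B hB0 hB using h1
  refine ⟨∑ m ∈ Finset.range 5, ∑ n ∈ Finset.range 4, B m n,
    Finset.sum_nonneg fun m _ => Finset.sum_nonneg fun n _ => hB0 m n, ?_⟩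
  intro m hm n hn x hx t ht
  calc |D m n x t| ≤ B m n := hB m n hm hn x hx t ht
    _ ≤ ∑ n ∈ Finset.range 4, B m n :=
        Finset.single_le_sum (f := fun n => B m n) (fun k _ => hB0 m k)
          (Finset.mem_range.2 (by omega))
    _ ≤ _ := Finset.single_le_sum (f := fun m => ∑ n ∈ Finset.range 4, B m n)
          (fun k _ => Finset.sum_nonneg fun l _ => hB0 k l) (Finset.mem_range.2 (by omega))

lemma eq_zero_of_eq_zero_on_Ioc {T : ℝ} (hT : 0 < T) {g : ℝ → ℝ} (hg : ContinuousOn g (Icc 0 T))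
    (h0 : ∀ t ∈ Ioc 0 T, g t = 0) {t : ℝ} (ht : t ∈ Icc 0 T) : g t = 0 := by
  have h : EqOn g (fun _ => 0) (Icc 0 T) :=
    EqOn.of_subset_closure (s := Ioc 0 T) h0 hg continuousOn_const Ioc_subset_Icc_self
      (closure_Ioc hT.ne).ge
  exact h ht

/-- The truncation error of the scheme at a sufficiently smooth solution. -/
lemma truncation_error {α β a b T : ℝ} (hα₀ : 0 < α) (hα₁ : α ≤ 1) (hβ₁ : 1 < β) (hβ₂ : β ≤ 2)
    (hab : a < b) (hT : 0 < T) {γ dp dm : ℝ → ℝ} {f : ℝ → ℝ → ℝ} {φ : ℝ → ℝ} {K : ℝ}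
    (hγ : ∀ t ∈ Ioc 0 T, |γ t| ≤ K) (hdp : ∀ t ∈ Ioc 0 T, |dp t| ≤ K)
    (hdm : ∀ t ∈ Ioc 0 T, |dm t| ≤ K) {u : ℝ → ℝ → ℝ} {D : ℕ → ℕ → ℝ → ℝ → ℝ}
    (hDu : ∀ x ∈ Icc a b, ∀ t ∈ Icc 0 T, D 0 0 x t = u x t)
    (hDc : ∀ m ≤ 4, ∀ n ≤ 3,
      ContinuousOn (fun p : ℝ × ℝ => D m n p.1 p.2) (Icc a b ×ˢ Icc 0 T))
    (hDx : ∀ m < 4, ∀ n ≤ 3, ∀ x ∈ Icc a b, ∀ t ∈ Icc 0 T,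
      HasDerivWithinAt (fun y => D m n y t) (D (m + 1) n x t) (Icc a b) x)
    (hDt : ∀ m ≤ 4, ∀ n < 3, ∀ x ∈ Icc a b, ∀ t ∈ Icc 0 T,
      HasDerivWithinAt (fun s => D m n x s) (D m (n + 1) x t) (Icc 0 T) t)
    (hsol : IsSolution α β a b T γ dp dm f φ u)
    (hzero : β < 2 → ∀ t ∈ Icc 0 T, ∀ m ≤ 3, D m 0 a t = 0 ∧ D m 0 b t = 0) :
    ∃ C : ℝ, 0 ≤ C ∧ ∀ N M : ℕ, ∀ h τ : ℝ, h = (b - a) / N → τ = T / M →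
      ∀ i j : ℕ, 1 ≤ i → i < N → j < M →
        |discreteCaputo α (1 - α / 2) τ j (fun s => D 0 0 (a + i * h) (s * τ))
          - discreteSpace β h N (γ ((j + (1 - α / 2)) * τ)) (dp ((j + (1 - α / 2)) * τ))
              (dm ((j + (1 - α / 2)) * τ))
              (fun l => (1 - α / 2) * D 0 0 (a + l * h) ((j + 1 : ℕ) * τ)
                + (1 - (1 - α / 2)) * D 0 0 (a + l * h) (j * τ)) i
          - f (a + i * h) ((j + (1 - α / 2)) * τ)| ≤ C * (τ ^ 2 + h ^ 2) := by
  obtain ⟨B, hB, hBD⟩ := exists_abs_le hDc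
  obtain ⟨Ct, hCt, hcap⟩ := caputo_truncation hα₀ hα₁ hT
  obtain ⟨Cs, hCs, hspace⟩ := space_consistency hβ₁ hβ₂ hab
  have hK : 0 ≤ K := (abs_nonneg _).trans (hγ T ⟨hT, le_rfl⟩)
  refine ⟨Ct * B + Cs * K * B, by positivity, ?_⟩
  intro N M h τ hh hτ i j hi hiN hjM
  set σ := 1 - α / 2 with hσ
  have hσ₀ : 0 < σ := by rw [hσ]; linarith
  have hσ₁ : σ ≤ 1 := by rw [hσ]; linarith
  have hM : (0 : ℝ) < M := by exact_mod_cast (by omega : 0 < M)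
  have hτ0 : 0 < τ := by rw [hτ]; positivity
  have hτM : τ * M = T := by rw [hτ]; field_simp
  have hj0 : (0 : ℝ) ≤ j := Nat.cast_nonneg j
  have hjM1 : (j : ℝ) + 1 ≤ M := by exact_mod_cast hjM
  have hj1T : ((j : ℝ) + 1) * τ ≤ T := by nlinarith
  have ht0 : (j : ℝ) * τ ∈ Icc 0 T := ⟨by positivity, by nlinarith⟩
  have ht1 : ((j : ℝ) + 1) * τ ∈ Icc 0 T := ⟨by positivity, hj1T⟩
  have htσ : ((j : ℝ) + σ) * τ ∈ Ioc 0 T := ⟨by positivity, by nlinarith⟩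
  have htσ' : ((j : ℝ) + σ) * τ ∈ Icc 0 T := Ioc_subset_Icc_self htσ
  have hN : (0 : ℝ) < N := by exact_mod_cast (by omega : 0 < N)
  have hba : 0 < b - a := sub_pos.2 hab
  have hh0 : 0 < h := by rw [hh]; positivity
  have hhN : h * N = b - a := by rw [hh]; field_simp
  have hi1 : (1 : ℝ) ≤ i := by exact_mod_cast hi
  have hiN1 : (i : ℝ) + 1 ≤ N := by exact_mod_cast hiN
  have hx : a + i * h ∈ Ioo a b := ⟨by nlinarith, by nlinarith⟩
  have hx' : a + i * h ∈ Icc a b := Ioo_subset_Icc_self hx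
  -- time discretisation
  have htime := hcap B (fun s => D 0 0 (a + i * h) s) (fun s => D 0 1 (a + i * h) s)
    (fun s => D 0 2 (a + i * h) s) hB (fun t ht => hDt 0 (by norm_num) 0 (by norm_num) _ hx' t ht)
    (fun t ht => hDt 0 (by norm_num) 1 (by norm_num) _ hx' t ht)
    (fun t ht s hs => abs_sub_le_of_abs_deriv_le (convex_Icc 0 T)
      (fun r hr => hDt 0 (by norm_num) 2 (by norm_num) _ hx' r hr)
      (fun r hr => hBD 0 (by norm_num) 3 (by norm_num) _ hx' r hr) ht hs) τ j hτ0 hj1T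
  have hcongr : caputoDeriv α T (fun s => D 0 0 (a + i * h) s) ((j + σ) * τ)
      = caputoDeriv α T (fun s => u (a + i * h) s) ((j + σ) * τ) :=
    caputoDeriv_congr (fun s hs => hDu _ hx' s hs) htσ'
  rw [hcongr, hsol.equation _ hx _ htσ] at htime
  -- space discretisation
  have hC4 : ∀ t ∈ Icc 0 T, IsC4 a b B (fun m x => D m 0 x t) := fun t ht =>
    { hasDerivWithinAt := fun m hm x hx => hDx m hm 0 (by norm_num) x hx t ht
      continuousOn_four := (hDc 4 le_rfl 0 (by norm_num)).comp
        (f := fun x => ((x, t) : ℝ × ℝ)) (by fun_prop) fun x hx => ⟨hx, ht⟩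
      abs_four_le := fun x hx => hBD 4 le_rfl 0 (by norm_num) x hx t ht }
  have hinterp : ∀ m ≤ 4, ∀ x ∈ Icc a b,
      |σ * D m 0 x ((j + 1) * τ) + (1 - σ) * D m 0 x (j * τ) - D m 0 x ((j + σ) * τ)|
        ≤ B * τ ^ 2 := by
    intro m hm x hx
    have hp : (j : ℝ) * τ + τ = (j + 1) * τ := by ring
    have := abs_linear_interpolation_sub_le (f := fun s => D m 0 x s) (f₁ := fun s => D m 1 x s)
      (τ := τ) (convex_Icc 0 T) hB hσ₀.le hσ₁ ht0 (by rwa [hp])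
      (fun t ht => hDt m hm 0 (by norm_num) x hx t ht)
      (fun t ht s hs => abs_sub_le_of_abs_deriv_le (convex_Icc 0 T)
        (fun r hr => hDt m hm 1 (by norm_num) x hx r hr)
        (fun r hr => hBD m hm 2 (by norm_num) x hx r hr) ht hs)
    rwa [hp, ← add_mul] at this
  have hs := hspace B (B * τ ^ 2) K (γ ((j + σ) * τ)) (dp ((j + σ) * τ)) (dm ((j + σ) * τ))
    (fun m x => D m 0 x ((j + σ) * τ))
    (fun m x => σ * D m 0 x ((j + 1) * τ) + (1 - σ) * D m 0 x (j * τ))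
    (fun x => u x ((j + σ) * τ)) (by positivity) (hγ _ htσ) (hdp _ htσ) (hdm _ htσ)
    (hC4 _ htσ') ((hC4 _ ht1).convex_combination (hC4 _ ht0) hσ₀.le (by linarith))
    (fun x hx => by
      have e1 := hBD 3 (by norm_num) 0 (by norm_num) x hx _ ht1
      have e0 := hBD 3 (by norm_num) 0 (by norm_num) x hx _ ht0
      rw [abs_le] at e0 e1 ⊢
      constructor <;> nlinarith)
    (fun x hx => (hDu x hx _ htσ').symm)
    (fun hβ m hm => ⟨hzero hβ _ htσ' m hm, by
      simp [(hzero hβ _ ht1 m hm).1, (hzero hβ _ ht1 m hm).2, (hzero hβ _ ht0 m hm).1,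
        (hzero hβ _ ht0 m hm).2]⟩)
    (hinterp 1 (by norm_num)) (hinterp 2 (by norm_num)) N i hi hiN h hh
  push_cast
  set P := discreteCaputo α σ τ j (fun s => D 0 0 (a + i * h) (s * τ))
  set Q := discreteSpace β h N (γ ((j + σ) * τ)) (dp ((j + σ) * τ)) (dm ((j + σ) * τ))
    (fun l => σ * D 0 0 (a + l * h) ((j + 1) * τ) + (1 - σ) * D 0 0 (a + l * h) (j * τ)) i
  set S := γ ((j + σ) * τ) * deriv (fun x => u x ((j + σ) * τ)) (a + i * h)
    + dp ((j + σ) * τ) * leftRL β a (fun x => u x ((j + σ) * τ)) (a + i * h)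
    + dm ((j + σ) * τ) * rightRL β b (fun x => u x ((j + σ) * τ)) (a + i * h)
  set F := f (a + i * h) ((j + σ) * τ)
  calc |P - Q - F| = |(P - (S + F)) - (Q - S)| := by congr 1; ring
    _ ≤ |P - (S + F)| + |Q - S| := abs_sub _ _
    _ ≤ Ct * B * τ ^ 2 + Cs * K * (B * h ^ 2 + B * τ ^ 2) := add_le_add htime hs
    _ ≤ _ := by
      have : 0 ≤ Ct * B * h ^ 2 := by positivity
      linarith
end TSFCDE
end

theorem mainTheorem3 (α β a b T : ℝ) (hα₀ : 0 < α) (hα₁ : α ≤ 1) (hβ₁ : 1 < β) (hβ₂ : β ≤ 2)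
    (hab : a < b) (hT : 0 < T) (γ dp dm : ℝ → ℝ) (f : ℝ → ℝ → ℝ) (φ : ℝ → ℝ)
    (hdp : ∀ t ∈ Set.Ioc 0 T, 0 ≤ dp t) (hdm : ∀ t ∈ Set.Ioc 0 T, 0 ≤ dm t)
    (hbdd : ∃ K : ℝ, ∀ t ∈ Set.Ioc 0 T, |γ t| ≤ K ∧ dp t ≤ K ∧ dm t ≤ K)
    (u : ℝ → ℝ → ℝ) (hu : TSFCDE.IsC43 a b T u)
    (hsol : TSFCDE.IsSolution α β a b T γ dp dm f φ u)
    (hext : β < 2 → ∀ t ∈ Set.Icc 0 T,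
      TSFCDE.MemFourierClass (2 + β) (Set.indicator (Set.Icc a b) (fun x => u x t))) :
    ∃ c : ℝ, 0 < c ∧ ∀ N M : ℕ, 0 < N → 0 < M → ∀ U : ℕ → ℕ → ℝ,
      TSFCDE.IsSchemeSolution α β a b T γ dp dm f φ N M U →
      ∀ j : ℕ, j ≤ M →
        TSFCDE.discreteNorm ((b - a) / N) N
            (fun i => u (a + i * ((b - a) / N)) (j * (T / M)) - U j i)
          ≤ c * ((T / M) ^ 2 + ((b - a) / N) ^ 2) := by
  obtain ⟨K, hK⟩ := hbdd
  obtain ⟨D, hDu, hDc, hDx, hDt⟩ := hu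
  have haI : a ∈ Icc a b := left_mem_Icc.2 hab.le
  have hbI : b ∈ Icc a b := right_mem_Icc.2 hab.le
  have hba : 0 < b - a := sub_pos.2 hab
  have hbdry : ∀ t ∈ Icc 0 T, D 0 0 a t = 0 ∧ D 0 0 b t = 0 := by
    have hcont : ∀ x ∈ Icc a b, ContinuousOn (fun t => D 0 0 x t) (Icc 0 T) := fun x hx t ht =>
      (hDt 0 (by norm_num) 0 (by norm_num) x hx t ht).continuousWithinAt
    refine fun t ht => ⟨TSFCDE.eq_zero_of_eq_zero_on_Ioc hT (hcont a haI) (fun s hs => ?_) ht,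
      TSFCDE.eq_zero_of_eq_zero_on_Ioc hT (hcont b hbI) (fun s hs => ?_) ht⟩
    · rw [hDu a haI s (Ioc_subset_Icc_self hs)]; exact (hsol.boundary s hs).1
    · rw [hDu b hbI s (Ioc_subset_Icc_self hs)]; exact (hsol.boundary s hs).2
  have hzero : β < 2 → ∀ t ∈ Icc 0 T, ∀ m ≤ 3, D m 0 a t = 0 ∧ D m 0 b t = 0 := by
    intro hβ t ht m hm
    refine TSFCDE.MemFourierClass.eq_zero_of_indicator (r := 2 + β) (U := fun m x => D m 0 x t)
      hab (by linarith) (fun m hm x hx => hDx m (by omega) 0 (by norm_num) x hx t ht)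
      (hbdry t ht).1 (hbdry t ht).2 ?_ hm
    convert hext hβ t ht using 1
    exact indicator_congr fun x hx => hDu x hx t ht
  obtain ⟨C, hC, htrunc⟩ := TSFCDE.truncation_error hα₀ hα₁ hβ₁ hβ₂ hab hT
    (fun t ht => (hK t ht).1)
    (fun t ht => (abs_of_nonneg (hdp t ht)).trans_le (hK t ht).2.1)
    (fun t ht => (abs_of_nonneg (hdm t ht)).trans_le (hK t ht).2.2) hDu hDc hDx hDt hsol hzero
  obtain ⟨S, hS, hstab⟩ := TSFCDE.scheme_stability hα₀ hα₁ hT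
  refine ⟨Real.sqrt (S * (b - a)) * C + 1, by positivity, ?_⟩
  intro N M hN hM U hU j hj
  have hN' : (0 : ℝ) < N := by exact_mod_cast hN
  have hM' : (0 : ℝ) < M := by exact_mod_cast hM
  set h := (b - a) / N with hh
  set τ := T / M with hτ
  have hh0 : 0 < h := by positivity
  have hτ0 : 0 < τ := by positivity
  have hhN : h * N = b - a := by rw [hh]; field_simp
  have hτM : τ * M = T := by rw [hτ]; field_simp
  have htime : ∀ j ≤ M, (j : ℝ) * τ ∈ Icc 0 T := fun j hj => by
    have : (j : ℝ) ≤ M := by exact_mod_cast hj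
    exact ⟨by positivity, by nlinarith⟩
  have htimeσ : ∀ j < M, ((j : ℝ) + (1 - α / 2)) * τ ∈ Ioc 0 T := fun j hj => by
    have h1 : (j : ℝ) + 1 ≤ M := by exact_mod_cast hj
    have h2 : (0 : ℝ) < 1 - α / 2 := by linarith
    exact ⟨by positivity, by nlinarith⟩
  have hnode : ∀ i ≤ N, a + i * h ∈ Icc a b := fun i hi => by
    have : (i : ℝ) ≤ N := by exact_mod_cast hi
    have h0 : (0 : ℝ) ≤ i * h := by positivity
    exact ⟨by linarith, by nlinarith⟩
  have hmain := hstab β h (C * (τ ^ 2 + h ^ 2)) N M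
    (fun j => γ ((j + (1 - α / 2)) * τ)) (fun j => dp ((j + (1 - α / 2)) * τ))
    (fun j => dm ((j + (1 - α / 2)) * τ))
    (fun j i => D 0 0 (a + i * h) (j * τ) - U j i)
    (fun j i => TSFCDE.discreteCaputo α (1 - α / 2) τ j (fun s => D 0 0 (a + i * h) (s * τ))
      - TSFCDE.discreteSpace β h N (γ ((j + (1 - α / 2)) * τ)) (dp ((j + (1 - α / 2)) * τ))
          (dm ((j + (1 - α / 2)) * τ))
          (fun l => (1 - α / 2) * D 0 0 (a + l * h) ((j + 1 : ℕ) * τ)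
            + (1 - (1 - α / 2)) * D 0 0 (a + l * h) (j * τ)) i
      - f (a + i * h) ((j + (1 - α / 2)) * τ))
    hβ₁.le hβ₂ hh0 hM (by positivity) (fun j hj => hdp _ (htimeσ j hj))
    (fun j hj => hdm _ (htimeσ j hj))
    (fun j hj => by
      have hb : a + N * h = b := by linarith
      simp [hb, hbdry _ (htime j hj), hU.boundary j hj])
    (fun i hi hiN => by
      have hx := hnode i hiN.le
      have h0 : (0 : ℝ) ∈ Icc 0 T := ⟨le_rfl, hT.le⟩
      simp only [Nat.cast_zero, zero_mul]
      rw [hDu _ hx _ h0, hsol.initial _ hx, hU.initial i hi hiN, sub_self])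
    (fun i j hi hiN hjM => by
      have hstep := hU.step i j hi hiN hjM
      have hsub := TSFCDE.discreteSpace_sub β h N (γ ((j + (1 - α / 2)) * τ))
        (dp ((j + (1 - α / 2)) * τ)) (dm ((j + (1 - α / 2)) * τ))
        (fun l => (1 - α / 2) * D 0 0 (a + l * h) ((j + 1 : ℕ) * τ)
          + (1 - (1 - α / 2)) * D 0 0 (a + l * h) (j * τ))
        (fun l => (1 - α / 2) * U (j + 1) l + (1 - (1 - α / 2)) * U j l) i
      have hlin : (fun l : ℕ =>
          (1 - α / 2) * (D 0 0 (a + l * h) ((j + 1 : ℕ) * τ) - U (j + 1) l)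
            + (1 - (1 - α / 2)) * (D 0 0 (a + l * h) (j * τ) - U j l))
          = fun l : ℕ => ((1 - α / 2) * D 0 0 (a + l * h) ((j + 1 : ℕ) * τ)
            + (1 - (1 - α / 2)) * D 0 0 (a + l * h) (j * τ))
            - ((1 - α / 2) * U (j + 1) l + (1 - (1 - α / 2)) * U j l) := by
        funext l; ring
      rw [hlin, hsub, TSFCDE.discreteCaputo_sub, hstep]
      ring)
    (fun i j hi hiN hjM => htrunc N M h τ hh hτ i j hi hiN hjM) j hj
  have hnorm : TSFCDE.discreteNorm h N (fun i => u (a + i * h) (j * τ) - U j i)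
      ≤ Real.sqrt (S * (b - a)) * (C * (τ ^ 2 + h ^ 2)) := by
    unfold TSFCDE.discreteNorm
    rw [← Real.sqrt_sq (by positivity : 0 ≤ C * (τ ^ 2 + h ^ 2)), ← Real.sqrt_mul (by positivity)]
    refine Real.sqrt_le_sqrt ?_
    rw [hhN] at hmain
    refine le_trans (le_of_eq ?_) (hmain.trans_eq (by ring))
    congr 1
    refine Finset.sum_congr rfl fun i hi => ?_
    rw [hDu _ (hnode i (Finset.mem_Ico.1 hi).2.le) _ (htime j hj)]
  have : 0 ≤ τ ^ 2 + h ^ 2 := by positivity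
  linarith
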